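/- **Setting.** Let $1\le p<l\le d$ and let $X\in\mathbb R^{n\times d}$ have rows $x_1,\dots,x_n$ with labels $y_1,\dots,y_n\in\{1,\dots,l\}$, every label occurring ($n_k\ge1$ times). Let $m_k$ be the mean of class $k$, $m$ the mean of all samples, $\hat X\in\mathbb R^{n\times d}$ the matrix with rows $(x_i-m_{y_i})^T$, $\hat Y\in\mathbb R^{l\times d}$ the matrix with rows $\sqrt{n_k}(m_k-m)^T$, $S_B=\sum_k n_k(m_k-m)(m_k-m)^T=\hat Y^T\hat Y$ and $S_w=\sum_i(x_i-m_{y_i})(x_i-m_{y_i})^T=\hat X^T\hat X$. Let $\lambda\ge0$ be such that $B:=S_w+\lambda I_d$ is positive definite, and let $\rho_1\ge\dots\ge\rho_d\ge 0$ be the generalized eigenvalues of the pencil $(S_B,B)$. Put $s_\lambda(\hat X)=\mathrm{Tr}\big((\hat X^T\hat X+\lambda I)^{-1}\hat X^T\hat X\big)$ and $\mathbf{St}_B(p,d)=\{W\in\mathbb R^{d\times p}:W^TBW=I_p\}$. For $N=\mathrm{diag}(\mu_1,\dots,\mu_p)$ with $\mu_1>\dots>\mu_p>0$ let $f_{\rm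 FDA}(W)=-\tfrac12\mathrm{Tr}(W^TS_BWN)$ and $$\kappa^\star_{\rm FDA}=\frac{\mu_1(\rho_1-\rho_d)}{\min\{\mu_p(\rho_p-\rho_{p+1}),\ \min_{1\le j<p}\tfrac12(\mu_j-\mu_{j+1})(\rho_j-\rho_{j+1})\}}.$$ Let $S\in\mathbb R^{s\times n}$ be a CountSketch matrix: column $j$ has the single nonzero entry $g(j)$ in row $h(j)$, where $h:\{1,\dots,n\}\to\{1,\dots,s\}$ and $g:\{1,\dots,n\}\to\{-1,1\}$ are independent and uniformly random. Put $M=(S\hat X)^T(S\hat X)+\lambda I_d$; when $M$ is positive definite, $\mathbf{St}_B(p,d)$ carries the Riemannian metric $g(\xi,\eta)=\mathrm{Tr}(\xi^TM\eta)$. The condition number of a self-adjoint operator is the ratio of the largest to the smallest absolute value of its eigenvalues ($\infty$ if $0$ is an eigenvalue). **(1) Conditioning.** Suppose $\rho_1>\rho_2>\dots>\rho_{p+1}$, let $\delta\in(0,1)$ and $s=\max(\lceil 20\,s_\lambda(\hat X)^2/\delta\rceil,d)$. Then with probability at least $1-\delta$ the matrix $M$ is positive definite and, for every choice of $\mu_1>\dots>\mu_p>0$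 and every global minimizer $W^\star$ of $f_{\rm FDA}$ on $\mathbf{St}_B(p,d)$, the Riemannian Hessian of $f_{\rm FDA}$ at $W^\star$ has condition number at most $3\kappa^\star_{\rm FDA}$ (regardless of the condition number of $S_w+\lambda I$). **(2) Costs.** Costs are numbers of real arithmetic operations ($+,-,\times,/$, square root, comparison) on the worst path of an algebraic computation tree, which may depend on the sizes, the labels, the hash and sign functions and the sparsity patterns, but not on the values of the real data. There is an absolute constant $C$ such that for all $1\le p<l\le d\le s$, all $n$, all labels and all $h,g$: * $\hat X$ and $\hat Y$ can be computed from $X$ with at most $C\,nd$ operations; * $S\hat X$ can be computed from $\hat X$ with at most $C\,\mathrm{nnz}(\hat X)$ operations, and $\mathrm{nnz}(\hat X)\le nd$; * given $S\hat X$ and $\lambda$ with $M$ positive definite, $M$ and $M^{-1}$ can be computed with at most $C(sd^2+d^2)$ operations; * given the data and the above results, with $B$ and $M$ positive definite, one iteration of Riemannian conjugate gradient for $f_{\rm FDA}$ on $\mathbf{St}_B(p,d)$ with the metric defined by $M$ (from a point $W$ of the manifold and a tangent search direction at $W$), using the QR-based retraction, vector transport by $g$-orthogonal projection, Armijo backtracking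 with at most $L$ trials, and the Fletcher–Reeves, Polak–Ribière(+), Hestenes–Stiefel(+) or Dai–Yuan rule, can be carried out with at most $$C(L+1)\big(p(\mathrm{nnz}(X)+ld)+\mathrm{nnz}(\hat X)\,p+d^2p+dp^2\big)$$ operations. -/

import Mathlib

open Matrix MeasureTheory ProbabilityTheory
open scoped ENNReal

noncomputable section

namespace SketchedFDA

/-! ### Geometry of the generalized Stiefel manifold with the metric given by `M` -/

/-- The generalized Stiefel manifold `St_B(p, d) = {W ∈ ℝ^{d × p} : Wᵀ B W = I_p}`. -/
def stiefel {d : ℕ} (p : ℕ) (B : Matrix (Fin d) (Fin d) ℝ) : Set (Matrix (Fin d) (Fin p) ℝ) :=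
  {W | Wᵀ * B * W = 1}

/-- The tangent space at `W`: all `ξ` with `ξᵀ B W + Wᵀ B ξ = 0`. -/
def tangentSpace {d p : ℕ} (B : Matrix (Fin d) (Fin d) ℝ) (W : Matrix (Fin d) (Fin p) ℝ) :
    Submodule ℝ (Matrix (Fin d) (Fin p) ℝ) where
  carrier := {ξ | ξᵀ * B * W + Wᵀ * B * ξ = 0}
  zero_mem' := by simp
  add_mem' := by
    intro a b ha hb
    simp only [Set.mem_ofPred_eq] at ha hb ⊢
    rw [Matrix.transpose_add, Matrix.add_mul, Matrix.add_mul, Matrix.mul_add,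
      add_add_add_comm, ha, hb, add_zero]
  smul_mem' := by
    intro c a ha
    simp only [Set.mem_ofPred_eq] at ha ⊢
    rw [Matrix.transpose_smul, Matrix.smul_mul, Matrix.smul_mul, Matrix.mul_smul,
      ← smul_add, ha, smul_zero]

/-- The Riemannian metric `g(ξ, η) = Tr(ξᵀ M η)`. -/
def metric {d : ℕ} (p : ℕ) (M : Matrix (Fin d) (Fin d) ℝ) :
    LinearMap.BilinForm ℝ (Matrix (Fin d) (Fin p) ℝ) :=
  LinearMap.mk₂ ℝ (fun ξ η => (ξᵀ * M * η).trace)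
    (by intros; simp [Matrix.add_mul]) (by intros; simp)
    (by intros; simp [Matrix.mul_add]) (by intros; simp)

/-- The normal space at `W`: the `g`-orthogonal complement of the tangent space. -/
def normalSpace {d p : ℕ} (B M : Matrix (Fin d) (Fin d) ℝ) (W : Matrix (Fin d) (Fin p) ℝ) :
    Submodule ℝ (Matrix (Fin d) (Fin p) ℝ) :=
  (metric p M).orthogonal (tangentSpace B W)

open Classical in
/-- The `g`-orthogonal projection `Π_W` onto the tangent space at `W`. If `M` is symmetric positive
definite, tangent and normal space are always complementary. -/
def tangentProj {d p : ℕ} (B M : Matrix (Fin d) (Fin d) ℝ) (W : Matrix (Fin d) (Fin p) ℝ) :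
    Matrix (Fin d) (Fin p) ℝ →ₗ[ℝ] tangentSpace B W :=
  if h : IsCompl (tangentSpace B W) (normalSpace B M W) then
    (tangentSpace B W).projectionOnto (normalSpace B M W) h
  else 0

/-- The matrix `∇f(W)` of partial derivatives of `f`. -/
def euclideanGradient {d p : ℕ} (f : Matrix (Fin d) (Fin p) ℝ → ℝ)
    (W : Matrix (Fin d) (Fin p) ℝ) : Matrix (Fin d) (Fin p) ℝ :=
  Matrix.of fun i j => fderiv ℝ f W (Matrix.single i j 1)

/-- The Riemannian gradient `grad f(W) = Π_W(M⁻¹ ∇f(W))`. The same formula is used off the manifold;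
it is a smooth extension of the gradient field to a neighbourhood of the manifold. -/
def riemannianGradient {d p : ℕ} (B M : Matrix (Fin d) (Fin d) ℝ)
    (f : Matrix (Fin d) (Fin p) ℝ → ℝ) (W : Matrix (Fin d) (Fin p) ℝ) :
    Matrix (Fin d) (Fin p) ℝ :=
  (tangentProj B M W (M⁻¹ * euclideanGradient f W) : Matrix (Fin d) (Fin p) ℝ)

/-- The Riemannian Hessian `Hess f(W)[ξ] = ∇_ξ grad f`. The metric is the restriction of a constant
inner product on `ℝ^{d × p}`, so the Levi-Civita connection of the manifold is the tangential
projection of the ambient directional derivative of any smooth extension. -/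
def riemannianHessian {d p : ℕ} (B M : Matrix (Fin d) (Fin d) ℝ)
    (f : Matrix (Fin d) (Fin p) ℝ → ℝ) (W : Matrix (Fin d) (Fin p) ℝ) :
    Module.End ℝ (tangentSpace B W) :=
  tangentProj B M W ∘ₗ (fderiv ℝ (riemannianGradient B M f) W).toLinearMap ∘ₗ
    (tangentSpace B W).subtype

open Classical in
/-- Condition number of an endomorphism (used for self-adjoint ones): the ratio of the largest and
the smallest absolute value of an eigenvalue, and `∞` if `0` is an eigenvalue. -/
def condNumber {V : Type*} [AddCommGroup V] [Module ℝ V] (T : Module.End ℝ V) : ℝ≥0∞ :=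
  if T.HasEigenvalue 0 then ⊤
  else (⨆ a ∈ {a : ℝ | T.HasEigenvalue a}, ENNReal.ofReal |a|) /
    (⨅ a ∈ {a : ℝ | T.HasEigenvalue a}, ENNReal.ofReal |a|)

/-! ### The FDA problem -/

/-- Number `n_k` of samples with label `k`. -/
def classSize {n l : ℕ} (y : Fin n → Fin l) (k : Fin l) : ℕ :=
  (Finset.univ.filter fun i => y i = k).card

/-- Sample mean `m_k` of class `k`. The samples are the rows of `X`. -/
def classMean {n d l : ℕ} (X : Matrix (Fin n) (Fin d) ℝ) (y : Fin n → Fin l) (k : Fin l) :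
    Fin d → ℝ :=
  fun j => (classSize y k : ℝ)⁻¹ * ∑ i with y i = k, X i j

/-- Sample mean `m` of the entire dataset. -/
def totalMean {n d : ℕ} (X : Matrix (Fin n) (Fin d) ℝ) : Fin d → ℝ :=
  fun j => (n : ℝ)⁻¹ * ∑ i, X i j

/-- The centered data `X̂`, with rows `(x_i - m_{y_i})ᵀ`. -/
def centered {n d l : ℕ} (X : Matrix (Fin n) (Fin d) ℝ) (y : Fin n → Fin l) :
    Matrix (Fin n) (Fin d) ℝ :=
  Matrix.of fun i j => X i j - classMean X y (y i) j

/-- The matrix `Ŷ`, with rows `√n_k (m_k - m)ᵀ`. -/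
def between {n d l : ℕ} (X : Matrix (Fin n) (Fin d) ℝ) (y : Fin n → Fin l) :
    Matrix (Fin l) (Fin d) ℝ :=
  Matrix.of fun k j => √(classSize y k : ℝ) * (classMean X y k j - totalMean X j)

/-- Between-class scatter matrix `S_B = ∑ₖ n_k (m_k - m)(m_k - m)ᵀ`. -/
def scatterB {n d l : ℕ} (X : Matrix (Fin n) (Fin d) ℝ) (y : Fin n → Fin l) :
    Matrix (Fin d) (Fin d) ℝ :=
  ∑ k, (classSize y k : ℝ) •
    Matrix.vecMulVec (classMean X y k - totalMean X) (classMean X y k - totalMean X)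

/-- Within-class scatter matrix `S_w = ∑ᵢ (x_i - m_{y_i})(x_i - m_{y_i})ᵀ`. -/
def scatterW {n d l : ℕ} (X : Matrix (Fin n) (Fin d) ℝ) (y : Fin n → Fin l) :
    Matrix (Fin d) (Fin d) ℝ :=
  ∑ i, Matrix.vecMulVec (X i - classMean X y (y i)) (X i - classMean X y (y i))

/-- The regularized within-class scatter matrix `S_w + λ I_d`. -/
def regScatterW {n d l : ℕ} (X : Matrix (Fin n) (Fin d) ℝ) (y : Fin n → Fin l) (lam : ℝ) :
    Matrix (Fin d) (Fin d) ℝ :=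
  scatterW X y + lam • (1 : Matrix (Fin d) (Fin d) ℝ)

/-- The cost `f_FDA(W) = -½ Tr(Wᵀ S_B W N)`, `N = diag(μ₁, …, μ_p)`. -/
def fdaCost {n d l p : ℕ} (X : Matrix (Fin n) (Fin d) ℝ) (y : Fin n → Fin l) (μ : Fin p → ℝ)
    (W : Matrix (Fin d) (Fin p) ℝ) : ℝ :=
  -(1 / 2) * (Wᵀ * scatterB X y * W * Matrix.diagonal μ).trace

/-- `ρ₁ ≥ … ≥ ρ_d` are the generalized eigenvalues, with multiplicity, of the pencil `(A, B)`
(`A` symmetric, `B` symmetric positive definite): there is a `B`-orthonormal basis (the columns of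
`V`) of generalized eigenvectors. -/
def IsGenEigenvalues {d : ℕ} (A B : Matrix (Fin d) (Fin d) ℝ) (ρ : Fin d → ℝ) : Prop :=
  Antitone ρ ∧ ∃ V : Matrix (Fin d) (Fin d) ℝ,
    Vᵀ * B * V = 1 ∧ A * V = B * V * Matrix.diagonal ρ

/-- `κ*_FDA = μ₁(ρ₁ - ρ_d) / min{μ_p(ρ_p - ρ_{p+1}), min_{1≤j<p} ½(μ_j - μ_{j+1})(ρ_j - ρ_{j+1})}`
(indices start at `0` below). -/
def kappaFDA {d p : ℕ} (hp : 0 < p) (hpd : p < d) (μ : Fin p → ℝ) (ρ : Fin d → ℝ) : ℝ :=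
  μ ⟨0, hp⟩ * (ρ ⟨0, by omega⟩ - ρ ⟨d - 1, by omega⟩) /
    ⨅ j : Fin p,
      if h : j.val + 1 < p then
        1 / 2 * (μ j - μ ⟨j.val + 1, h⟩) * (ρ ⟨j.val, by omega⟩ - ρ ⟨j.val + 1, by omega⟩)
      else μ j * (ρ ⟨j.val, by omega⟩ - ρ ⟨j.val + 1, by omega⟩)

/-! ### CountSketch -/

/-- Random bits of a CountSketch transform of `ℝⁿ` into `ℝˢ`: a hash function and a sign function
(`true` is `+1`, `false` is `-1`). -/
abbrev SketchSeed (n s : ℕ) : Type := (Fin n → Fin s) × (Fin n → Bool)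

/-- The CountSketch matrix: column `j` has the single nonzero entry `g(j)`, in row `h(j)`. -/
def countSketch {n s : ℕ} (ω : SketchSeed n s) : Matrix (Fin s) (Fin n) ℝ :=
  Matrix.of fun i j => if ω.1 j = i then (if ω.2 j then 1 else -1) else 0

/-- `Aᵀ A + λ I`. With `A = S X̂` this is the preconditioner `M`. -/
def regGram {s d : ℕ} (A : Matrix (Fin s) (Fin d) ℝ) (lam : ℝ) : Matrix (Fin d) (Fin d) ℝ :=
  Aᵀ * A + lam • (1 : Matrix (Fin d) (Fin d) ℝ)

/-- `s_λ(Z) = Tr((ZᵀZ + λI)⁻¹ ZᵀZ)`. -/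
def effectiveDim {n d : ℕ} (Z : Matrix (Fin n) (Fin d) ℝ) (lam : ℝ) : ℝ :=
  ((regGram Z lam)⁻¹ * (Zᵀ * Z)).trace

/-! ### Riemannian conjugate gradient -/

/-- `Q` is the `B`-orthonormal factor of the QR factorization `Y = Q R` (`Qᵀ B Q = I`, `R` upper
triangular with positive diagonal). -/
def IsQF {d p : ℕ} (B : Matrix (Fin d) (Fin d) ℝ) (Y Q : Matrix (Fin d) (Fin p) ℝ) : Prop :=
  Qᵀ * B * Q = 1 ∧ ∃ R : Matrix (Fin p) (Fin p) ℝ,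
    (∀ i j, j < i → R i j = 0) ∧ (∀ i, 0 < R i i) ∧ Y = Q * R

/-- `qf_B(Y)`; the factor exists and is unique if `B` is positive definite and `Y` has full column
rank. -/
def qf {d p : ℕ} (B : Matrix (Fin d) (Fin d) ℝ) (Y : Matrix (Fin d) (Fin p) ℝ) :
    Matrix (Fin d) (Fin p) ℝ :=
  Classical.epsilon (IsQF B Y)

/-- The QR-based retraction `R_W(ξ) = qf_B(W + ξ)`. -/
def retraction {d p : ℕ} (B : Matrix (Fin d) (Fin d) ℝ) (W ξ : Matrix (Fin d) (Fin p) ℝ) :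
    Matrix (Fin d) (Fin p) ℝ :=
  qf B (W + ξ)

open Classical in
/-- Backtracking: the first acceptable step among `t, τt, τ²t, …`, giving up after `L` rejected
trials. -/
def backtrack (ok : ℝ → Prop) (τ : ℝ) : ℕ → ℝ → ℝ
  | 0, t => t
  | L + 1, t => if ok t then t else backtrack ok τ L (τ * t)

/-- The usual rules for the conjugate gradient parameter `β`. -/
inductive CGRule
  | fletcherReeves
  | polakRibiere
  | polakRibierePlus
  | hestenesStiefel
  | hestenesStiefelPlus
  | daiYuan

/-- `β` in terms of `a = ⟨G⁺, G⁺⟩`, `b = ⟨G⁺, G⁺ - 𝒯G⟩`, `c = ⟨G, G⟩`, `e = ⟨𝒯η, G⁺ - 𝒯G⟩`, where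
`G`, `G⁺` are the old and the new gradient, `η` the old direction, `𝒯` the transport. -/
def CGRule.beta (rule : CGRule) (a b c e : ℝ) : ℝ :=
  match rule with
  | .fletcherReeves => a / c
  | .polakRibiere => b / c
  | .polakRibierePlus => max 0 (b / c)
  | .hestenesStiefel => b / e
  | .hestenesStiefelPlus => max 0 (b / e)
  | .daiYuan => a / e

/-- One iteration of Riemannian conjugate gradient for `f` on `St_B(p, d)` with the metric `M`, from
the iterate `W` and the search direction `η`: Armijo backtracking (initial step `t₀`, contraction
factor `τ`, sufficient decrease parameter `c`, at most `L` trials), the QR-based retraction, vector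
transport by projection. It returns the next iterate and the next search direction. -/
def cgStep {d p : ℕ} (B M : Matrix (Fin d) (Fin d) ℝ) (f : Matrix (Fin d) (Fin p) ℝ → ℝ)
    (rule : CGRule) (L : ℕ) (t₀ τ c : ℝ) (W η : Matrix (Fin d) (Fin p) ℝ) :
    Matrix (Fin d) (Fin p) ℝ × Matrix (Fin d) (Fin p) ℝ :=
  let g := metric p M
  let G := riemannianGradient B M f W
  let t := backtrack (fun t => f (retraction B W (t • η)) ≤ f W + c * t * g G η) τ L t₀
  let W' := retraction B W (t • η)
  let G' := riemannianGradient B M f W'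
  let transport : Matrix (Fin d) (Fin p) ℝ → Matrix (Fin d) (Fin p) ℝ :=
    fun ζ => (tangentProj B M W' ζ : Matrix (Fin d) (Fin p) ℝ)
  let β := rule.beta (g G' G') (g G' (G' - transport G)) (g G G)
    (g (transport η) (G' - transport G))
  (W', -G' + β • transport η)

/-! ### Counting arithmetic operations -/

/-- Algebraic computation trees over the reals. `Computes f D S T`: there is a computation tree
which, for every instance `ω ∈ D`, computes all the numbers `f ω k` from the quantities in `S`
(numbers depending on the instance, available at the beginning) with at most `T` operations on every
path. The operations are `+`, `-`, `*`, `/` (a division by `0` returns `0`), square root, and the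
comparison of two available quantities, after which the computation may branch; each of them costs
`1`. Rational constants are free. The tree is one and the same for all `ω ∈ D`. -/
inductive Computes {Ω κ : Type} (f : Ω → κ → ℝ) : Set Ω → Set (Ω → ℝ) → ℕ → Prop
  | output {D : Set Ω} {S : Set (Ω → ℝ)}
      (h : ∀ k, ∃ q ∈ S, ∀ ω ∈ D, f ω k = q ω) : Computes f D S 0
  | const {D : Set Ω} {S : Set (Ω → ℝ)} {T : ℕ} (r : ℚ)
      (h : Computes f D (insert (fun _ => (r : ℝ)) S) T) : Computes f D S T
  | add {D : Set Ω} {S : Set (Ω → ℝ)} {T : ℕ} {a b : Ω → ℝ} (ha : a ∈ S) (hb : b ∈ S)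
      (h : Computes f D (insert (fun ω => a ω + b ω) S) T) : Computes f D S (T + 1)
  | sub {D : Set Ω} {S : Set (Ω → ℝ)} {T : ℕ} {a b : Ω → ℝ} (ha : a ∈ S) (hb : b ∈ S)
      (h : Computes f D (insert (fun ω => a ω - b ω) S) T) : Computes f D S (T + 1)
  | mul {D : Set Ω} {S : Set (Ω → ℝ)} {T : ℕ} {a b : Ω → ℝ} (ha : a ∈ S) (hb : b ∈ S)
      (h : Computes f D (insert (fun ω => a ω * b ω) S) T) : Computes f D S (T + 1)
  | div {D : Set Ω} {S : Set (Ω → ℝ)} {T : ℕ} {a b : Ω → ℝ} (ha : a ∈ S) (hb : b ∈ S)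
      (h : Computes f D (insert (fun ω => a ω / b ω) S) T) : Computes f D S (T + 1)
  | sqrt {D : Set Ω} {S : Set (Ω → ℝ)} {T : ℕ} {a : Ω → ℝ} (ha : a ∈ S)
      (h : Computes f D (insert (fun ω => √(a ω)) S) T) : Computes f D S (T + 1)
  | branch {D : Set Ω} {S : Set (Ω → ℝ)} {T₁ T₂ : ℕ} {a b : Ω → ℝ} (ha : a ∈ S) (hb : b ∈ S)
      (hle : Computes f (D ∩ {ω | a ω ≤ b ω}) S T₁)
      (hlt : Computes f (D ∩ {ω | b ω < a ω}) S T₂) : Computes f D S (max T₁ T₂ + 1)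

/-- `f` can be computed on `D` from the quantities in `S` with at most `T` operations. -/
def ComputableWithin {Ω κ : Type} (f : Ω → κ → ℝ) (D : Set Ω) (S : Set (Ω → ℝ)) (T : ℕ) : Prop :=
  ∃ T' ≤ T, Computes f D S T'

/-- The entries of a matrix that depends on the instance, as quantities. -/
def entries {Ω : Type} {a b : ℕ} (A : Ω → Matrix (Fin a) (Fin b) ℝ) : Set (Ω → ℝ) :=
  {q | ∃ i j, q = fun ω => A ω i j}

/-- A pair of matrices as one family of numbers, to be used as the output of a computation. -/
def pairOut {a b a' b' : ℕ} (A : Matrix (Fin a) (Fin b) ℝ) (A' : Matrix (Fin a') (Fin b') ℝ) :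
    (Fin a × Fin b) ⊕ (Fin a' × Fin b') → ℝ :=
  Sum.elim (fun ij => A ij.1 ij.2) (fun ij => A' ij.1 ij.2)

/-- The positions of the nonzero entries of `A`; `nnz(A)` is its number of elements. -/
def sparsity {a b : ℕ} (A : Matrix (Fin a) (Fin b) ℝ) : Finset (Fin a × Fin b) :=
  Finset.univ.filter fun ij => A ij.1 ij.2 ≠ 0

/-- The real data on which an iteration of the algorithm operates: the data matrix, the
regularization parameter, the weights `μ`, the line search parameters, the current iterate `W` and
the current search direction `η`. -/
structure IterData (n d p : ℕ) where
  X : Matrix (Fin n) (Fin d) ℝ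
  lam : ℝ
  μ : Fin p → ℝ
  t₀ : ℝ
  τ : ℝ
  c : ℝ
  W : Matrix (Fin d) (Fin p) ℝ
  η : Matrix (Fin d) (Fin p) ℝ

/-- The sketch `S X̂`. -/
def IterData.sketch {n d l p s : ℕ} (y : Fin n → Fin l) (seed : SketchSeed n s)
    (ω : IterData n d p) : Matrix (Fin s) (Fin d) ℝ :=
  countSketch seed * centered ω.X y

/-- The preconditioner `M = (S X̂)ᵀ (S X̂) + λ I`. -/
def IterData.precond {n d l p s : ℕ} (y : Fin n → Fin l) (seed : SketchSeed n s)
    (ω : IterData n d p) : Matrix (Fin d) (Fin d) ℝ :=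
  regGram (ω.sketch y seed) ω.lam

/-- The admissible data: the nonzero entries of `X` and `X̂` lie at the positions `E` and `E'`,
`S_w + λI` and `M` are positive definite, `μ₁ > … > μ_p > 0`, `W` is on the manifold and `η` is a
tangent vector at `W`. -/
def iterDomain {n d l p s : ℕ} (y : Fin n → Fin l) (seed : SketchSeed n s)
    (E E' : Finset (Fin n × Fin d)) : Set (IterData n d p) :=
  {ω | sparsity ω.X ⊆ E ∧ sparsity (centered ω.X y) ⊆ E' ∧ 0 ≤ ω.lam ∧
    (regScatterW ω.X y ω.lam).PosDef ∧ (ω.precond y seed).PosDef ∧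
    StrictAnti ω.μ ∧ (∀ j, 0 < ω.μ j) ∧
    ω.W ∈ stiefel p (regScatterW ω.X y ω.lam) ∧
    ω.η ∈ tangentSpace (regScatterW ω.X y ω.lam) ω.W}

/-- The quantities available to an iteration: the data, the parameters, the current state, and the
results of the preprocessing (`X̂`, `Ŷ`, `S X̂`, `M` and `M⁻¹`). -/
def iterInputs {n d l p s : ℕ} (y : Fin n → Fin l) (seed : SketchSeed n s) :
    Set (IterData n d p → ℝ) :=
  entries (fun ω => ω.X) ∪ entries (fun ω => centered ω.X y) ∪ entries (fun ω => between ω.X y) ∪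
    entries (fun ω => ω.sketch y seed) ∪ entries (fun ω => ω.precond y seed) ∪
    entries (fun ω => (ω.precond y seed)⁻¹) ∪ entries (fun ω => ω.W) ∪ entries (fun ω => ω.η) ∪
    {q | ∃ j, q = fun ω => ω.μ j} ∪ {fun ω => ω.lam, fun ω => ω.t₀, fun ω => ω.τ, fun ω => ω.c}

end SketchedFDA

end

open SketchedFDA

open SketchedFDA

/-! Conditioning. Let `V` be a `B`-orthonormal eigenbasis of the pencil and `U = X̂V`; then `‖U‖_F²
= s_λ` (`effectiveDim_eq`). Signs and hash collisions of a CountSketch average out, so the mean of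
`‖(SU)ᵀSU - UᵀU‖_F²` is at most `2‖U‖_F⁴/s` (`sum_sketch_gram_sub_sq_le`). Markov's inequality makes
this error at most `1/4` with the required probability. The term `λI` is the same in `M` and `B`, so
in the basis `V` the bound reads `½B ≤ M ≤ (3/2)B`.

In the coordinates of `V`, minimizing the cost is a linear assignment problem for the squared
entries. An explicit dual solution with strict complementary slackness forces every global minimizer
to consist of the first `p` eigenvectors up to sign (`IsMinOn.coeff_eq_zero`). At such a point the
gradient field is the projection of a linear field vanishing there, so the projection need not be
differentiated, and `M` drops out of the quadratic form of the Hessian (`metric_riemannianHessian`).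
The form equals `∑ μ_j(ρ_j - ρ_i)ζ_ij²`, where `ζ` are the coordinates of the tangent vector.
Tangency gives `ζ_ij² = ζ_ji²` for `i, j ≤ p`; pairing these terms bounds the form below and above
by the denominator and the numerator of `κ*` times the squared `B`-norm. Passing from the `B`-norm
to the metric costs `(3/2)/(1/2) = 3`.

Costs. Computation trees compose (`Computes.seq`), and a quantity may be computed by any formula
valid on the domain, so costs add up along mathematical identities. The delicate ingredient is the
tangent projection: it requires a `p × p` Lyapunov equation `KS + SK = R` with `K` positive
definite, to be solved exactly with `O(p³)` operations although eigenvalues are not available.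
Householder reflections make `K` tridiagonal. If no off-diagonal entry vanishes, each row of the
solution follows from the two rows before it, so everything is determined by one unknown row; the
last equation is a linear system for this row, nonsingular because the Lyapunov operator is
injective (`isUnit_det_sweepMatrix`). Vanishing off-diagonal entries are located by comparisons and
split the problem into independent rectangles whose costs add up. The remaining ingredients are
inversion by rank-one updates, Gram–Schmidt, and products with the sparse factor `X̂` in place of
`B`. -/

namespace SketchedFDA

/-! ### A calculus of computation trees -/

section Calculus

variable {Ω κ : Type}

/-- On `D`, the quantity `q` agrees with a member of `S`. -/
def Known (D : Set Ω) (S : Set (Ω → ℝ)) (q : Ω → ℝ) : Prop := ∃ q' ∈ S, ∀ ω ∈ D, q ω = q' ω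

theorem Known.of_mem {D : Set Ω} {S : Set (Ω → ℝ)} {q : Ω → ℝ} (h : q ∈ S) : Known D S q :=
  ⟨q, h, fun _ _ => rfl⟩

theorem Known.mono {D D' : Set Ω} {S S' : Set (Ω → ℝ)} {q : Ω → ℝ} (h : Known D S q)
    (hD : D' ⊆ D) (hS : S ⊆ S') : Known D' S' q := by
  obtain ⟨q', h1, h2⟩ := h
  exact ⟨q', hS h1, fun ω hω => h2 ω (hD hω)⟩

theorem known_insert {D : Set Ω} {S S' : Set (Ω → ℝ)} {r r' : Ω → ℝ}
    (hS : ∀ q ∈ S, Known D S' q) (hr : ∀ ω ∈ D, r ω = r' ω) :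
    ∀ q ∈ insert r S, Known D (insert r' S') q := by
  rintro q (rfl | hq)
  · exact ⟨r', Set.mem_insert _ _, hr⟩
  · exact (hS q hq).mono subset_rfl (Set.subset_insert _ _)

/-- Only the values on the domain matter, so a tree can be replayed with each available quantity
replaced by one that agrees with it on the smaller domain. By induction along the tree the newly
computed quantities keep agreeing, and the two sides of each comparison select the same instances.
-/
theorem Computes.weaken {f : Ω → κ → ℝ} {D : Set Ω} {S : Set (Ω → ℝ)} {T : ℕ}
    (h : Computes f D S T) : ∀ {D' : Set Ω} {S' : Set (Ω → ℝ)}, D' ⊆ D →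
      (∀ q ∈ S, Known D' S' q) → Computes f D' S' T := by
  induction h with
  | output h =>
    intro D' S' hD hS
    refine .output fun k => ?_
    obtain ⟨q, hq, hk⟩ := h k
    obtain ⟨q', hq', hk'⟩ := hS q hq
    exact ⟨q', hq', fun ω hω => (hk ω (hD hω)).trans (hk' ω hω)⟩
  | const r _ ih =>
    intro D' S' hD hS
    exact .const r (ih hD (known_insert hS fun _ _ => rfl))
  | add ha hb _ ih =>
    intro D' S' hD hS
    obtain ⟨a', ha', ea⟩ := hS _ ha
    obtain ⟨b', hb', eb⟩ := hS _ hb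
    exact .add ha' hb' (ih hD (known_insert hS fun ω hω => by rw [ea ω hω, eb ω hω]))
  | sub ha hb _ ih =>
    intro D' S' hD hS
    obtain ⟨a', ha', ea⟩ := hS _ ha
    obtain ⟨b', hb', eb⟩ := hS _ hb
    exact .sub ha' hb' (ih hD (known_insert hS fun ω hω => by rw [ea ω hω, eb ω hω]))
  | mul ha hb _ ih =>
    intro D' S' hD hS
    obtain ⟨a', ha', ea⟩ := hS _ ha
    obtain ⟨b', hb', eb⟩ := hS _ hb
    exact .mul ha' hb' (ih hD (known_insert hS fun ω hω => by rw [ea ω hω, eb ω hω]))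
  | div ha hb _ ih =>
    intro D' S' hD hS
    obtain ⟨a', ha', ea⟩ := hS _ ha
    obtain ⟨b', hb', eb⟩ := hS _ hb
    exact .div ha' hb' (ih hD (known_insert hS fun ω hω => by rw [ea ω hω, eb ω hω]))
  | sqrt ha _ ih =>
    intro D' S' hD hS
    obtain ⟨a', ha', ea⟩ := hS _ ha
    exact .sqrt ha' (ih hD (known_insert hS fun ω hω => by rw [ea ω hω]))
  | branch ha hb _ _ ih1 ih2 =>
    intro D' S' hD hS
    obtain ⟨a', ha', ea⟩ := hS _ ha
    obtain ⟨b', hb', eb⟩ := hS _ hb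
    refine .branch ha' hb' (ih1 ?_ fun q hq => (hS q hq).mono Set.inter_subset_left subset_rfl)
      (ih2 ?_ fun q hq => (hS q hq).mono Set.inter_subset_left subset_rfl)
    · rintro ω ⟨h1, h2⟩
      refine ⟨hD h1, ?_⟩
      simpa [ea ω h1, eb ω h1] using h2
    · rintro ω ⟨h1, h2⟩
      refine ⟨hD h1, ?_⟩
      simpa [ea ω h1, eb ω h1] using h2

/-- One operation is wasted on `0 + 0`. -/
theorem Computes.succ {f : Ω → κ → ℝ} {D : Set Ω} {S : Set (Ω → ℝ)} {T : ℕ}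
    (h : Computes f D S T) : Computes f D S (T + 1) :=
  .const 0 <| .add (Set.mem_insert _ _) (Set.mem_insert _ _) <| h.weaken subset_rfl fun _ hq =>
    .of_mem (Set.mem_insert_of_mem _ (Set.mem_insert_of_mem _ hq))

theorem Computes.le {f : Ω → κ → ℝ} {D : Set Ω} {S : Set (Ω → ℝ)} {T T' : ℕ}
    (h : Computes f D S T) (hT : T ≤ T') : Computes f D S T' := by
  induction hT with
  | refl => exact h
  | step _ ih => exact ih.succ

/-- The second tree is grafted onto every leaf of the first. The set `S₀` stays fixed while `S`
grows along the induction, so the second tree can be stated in terms of the original inputs and the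
outputs alone, whatever the path taken. -/
theorem Computes.seq {κ' : Type} {f : Ω → κ → ℝ} {g : Ω → κ' → ℝ} {D : Set Ω} {S : Set (Ω → ℝ)}
    {T : ℕ} (h : Computes f D S T) : ∀ {S₀ : Set (Ω → ℝ)} {T₂ : ℕ}, S₀ ⊆ S →
      Computes g D (S₀ ∪ {q | ∃ k, q = fun ω => f ω k}) T₂ → Computes g D S (T + T₂) := by
  induction h with
  | output h =>
    intro S₀ T₂ hS hg
    rw [zero_add]
    refine hg.weaken subset_rfl ?_
    rintro q (hq | ⟨k, rfl⟩)
    · exact .of_mem (hS hq)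
    · exact h k
  | const r _ ih =>
    intro S₀ T₂ hS hg
    exact .const r (ih (hS.trans (Set.subset_insert _ _)) hg)
  | add ha hb _ ih =>
    intro S₀ T₂ hS hg
    rw [add_right_comm]
    exact .add ha hb (ih (hS.trans (Set.subset_insert _ _)) hg)
  | sub ha hb _ ih =>
    intro S₀ T₂ hS hg
    rw [add_right_comm]
    exact .sub ha hb (ih (hS.trans (Set.subset_insert _ _)) hg)
  | mul ha hb _ ih =>
    intro S₀ T₂ hS hg
    rw [add_right_comm]
    exact .mul ha hb (ih (hS.trans (Set.subset_insert _ _)) hg)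
  | div ha hb _ ih =>
    intro S₀ T₂ hS hg
    rw [add_right_comm]
    exact .div ha hb (ih (hS.trans (Set.subset_insert _ _)) hg)
  | sqrt ha _ ih =>
    intro S₀ T₂ hS hg
    rw [add_right_comm]
    exact .sqrt ha (ih (hS.trans (Set.subset_insert _ _)) hg)
  | branch ha hb _ _ ih1 ih2 =>
    intro S₀ T₂ hS hg
    rw [add_right_comm, ← max_add_add_right]
    exact .branch ha hb
      (ih1 hS (hg.weaken Set.inter_subset_left fun q hq => .of_mem hq))
      (ih2 hS (hg.weaken Set.inter_subset_left fun q hq => .of_mem hq))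

/-- On `D`, all the quantities in `Q` can be computed from those in `S` with at most `T`
operations. -/
def Gen (D : Set Ω) (S : Set (Ω → ℝ)) (T : ℕ) (Q : Set (Ω → ℝ)) : Prop :=
  Computes (fun ω (q : Q) => q.1 ω) D S T

variable {D D' : Set Ω} {S S' Q Q' : Set (Ω → ℝ)} {T T' T₁ T₂ : ℕ} {a b : Ω → ℝ}

theorem Gen.of_known (h : ∀ q ∈ Q, Known D S q) : Gen D S 0 Q :=
  .output fun q => h q.1 q.2

theorem Gen.le (h : Gen D S T Q) (hT : T ≤ T') : Gen D S T' Q := Computes.le h hT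

theorem Gen.of_subset (h : Q ⊆ S) : Gen D S 0 Q := .of_known fun _ hq => .of_mem (h hq)

theorem Gen.of_mem (h : a ∈ S) : Gen D S 0 {a} := .of_subset (by simpa using h)

theorem Gen.bind_computes {g : Ω → κ → ℝ} (h : Gen D S T₁ Q) (h' : Computes g D (S ∪ Q) T₂) :
    Computes g D S (T₁ + T₂) := by
  refine Computes.seq h subset_rfl (h'.weaken subset_rfl ?_)
  rintro q (hq | hq)
  · exact .of_mem (.inl hq)
  · exact .of_mem (.inr ⟨⟨q, hq⟩, rfl⟩)

theorem Gen.bind (h : Gen D S T₁ Q) (h' : Gen D (S ∪ Q) T₂ Q') : Gen D S (T₁ + T₂) Q' :=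
  h.bind_computes h'

theorem Gen.mono (h : Gen D S T Q) (hD : D' ⊆ D) (hS : S ⊆ S') : Gen D' S' T Q :=
  Computes.weaken h hD fun _ hq => .of_mem (hS hq)

theorem Gen.known (h : Gen D S T Q) (hQ : ∀ q ∈ Q', Known D Q q) : Gen D S T Q' := by
  simpa using h.bind (.of_known (Q := Q') fun q hq => (hQ q hq).mono subset_rfl
    Set.subset_union_right)

theorem Gen.subset (h : Gen D S T Q) (hQ : Q' ⊆ Q) : Gen D S T Q' :=
  h.known fun _ hq => .of_mem (hQ hq)

theorem Gen.congr (h : Gen D S T {a}) (hab : ∀ ω ∈ D, b ω = a ω) : Gen D S T {b} :=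
  h.known (by rintro q rfl; exact ⟨a, rfl, hab⟩)

theorem Gen.computableWithin {f : Ω → κ → ℝ} (h : Gen D S T Q) (hT : T ≤ T')
    (hf : ∀ k, Known D Q fun ω => f ω k) : ComputableWithin f D S T' := by
  refine ⟨T, hT, ?_⟩
  simpa using h.bind_computes (.output fun k => (hf k).mono subset_rfl Set.subset_union_right)

theorem Gen.union (h : Gen D S T₁ Q) (h' : Gen D S T₂ Q') : Gen D S (T₁ + T₂) (Q ∪ Q') := by
  refine h.bind ?_
  rw [← add_zero T₂]
  refine (h'.mono subset_rfl Set.subset_union_left).bind (.of_subset ?_)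
  exact Set.union_subset_union_left _ Set.subset_union_right

theorem Gen.biUnion {ι : Type*} {t : Finset ι} {T : ι → ℕ} {Q : ι → Set (Ω → ℝ)}
    (h : ∀ i ∈ t, Gen D S (T i) (Q i)) : Gen D S (∑ i ∈ t, T i) (⋃ i ∈ t, Q i) := by
  classical
  induction t using Finset.induction_on with
  | empty => exact .of_subset (by simp)
  | insert i t hi ih =>
    rw [Finset.sum_insert hi, Finset.set_biUnion_insert]
    exact (h i (by simp)).union (ih fun j hj => h j (by simp [hj]))

theorem Gen.const (r : ℚ) : Gen D S 0 {fun _ => (r : ℝ)} :=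
  Computes.const r (Gen.of_subset (by simp))

theorem Gen.add (ha : Gen D S T₁ {a}) (hb : Gen D S T₂ {b}) :
    Gen D S (T₁ + T₂ + 1) {fun ω => a ω + b ω} :=
  (ha.union hb).bind (Computes.add (a := a) (b := b) (by simp) (by simp) (Gen.of_subset (by simp)))

theorem Gen.sub (ha : Gen D S T₁ {a}) (hb : Gen D S T₂ {b}) :
    Gen D S (T₁ + T₂ + 1) {fun ω => a ω - b ω} :=
  (ha.union hb).bind (Computes.sub (a := a) (b := b) (by simp) (by simp) (Gen.of_subset (by simp)))

theorem Gen.mul (ha : Gen D S T₁ {a}) (hb : Gen D S T₂ {b}) :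
    Gen D S (T₁ + T₂ + 1) {fun ω => a ω * b ω} :=
  (ha.union hb).bind (Computes.mul (a := a) (b := b) (by simp) (by simp) (Gen.of_subset (by simp)))

theorem Gen.div (ha : Gen D S T₁ {a}) (hb : Gen D S T₂ {b}) :
    Gen D S (T₁ + T₂ + 1) {fun ω => a ω / b ω} :=
  (ha.union hb).bind (Computes.div (a := a) (b := b) (by simp) (by simp) (Gen.of_subset (by simp)))

theorem Gen.sqrt (ha : Gen D S T {a}) : Gen D S (T + 1) {fun ω => √(a ω)} :=
  ha.bind (Computes.sqrt (a := a) (by simp) (Gen.of_subset (by simp)))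

theorem Gen.neg (ha : Gen D S T {a}) : Gen D S (T + 1) {fun ω => -a ω} := by
  simpa using (Gen.const (D := D) (S := S) 0).sub ha

/-- Branching on a comparison. -/
theorem Gen.branch {T₃ T₄ : ℕ} (ha : Gen D S T₁ {a}) (hb : Gen D S T₂ {b})
    (hle : Gen (D ∩ {ω | a ω ≤ b ω}) S T₃ Q) (hlt : Gen (D ∩ {ω | b ω < a ω}) S T₄ Q) :
    Gen D S (T₁ + T₂ + (max T₃ T₄ + 1)) Q :=
  (ha.union hb).bind (Computes.branch (a := a) (b := b) (by simp) (by simp)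
    (hle.mono subset_rfl Set.subset_union_left) (hlt.mono subset_rfl Set.subset_union_left))

theorem Gen.maximum (ha : Gen D S T₁ {a}) (hb : Gen D S T₂ {b}) :
    Gen D S (T₁ + T₂ + 1) {fun ω => max (a ω) (b ω)} := by
  refine (ha.union hb).bind ((Gen.branch (a := a) (b := b) (T₁ := 0) (T₂ := 0) (T₃ := 0) (T₄ := 0)
    (.of_mem (by simp)) (.of_mem (by simp)) ?_ ?_).le (by simp))
  · exact (Gen.of_mem (a := b) (by simp)).congr fun ω hω => max_eq_right hω.2
  · exact (Gen.of_mem (a := a) (by simp)).congr fun ω hω => max_eq_left (le_of_lt hω.2)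

theorem Gen.sum {ι : Type*} {t : Finset ι} {T : ι → ℕ} {q : ι → Ω → ℝ}
    (h : ∀ i ∈ t, Gen D S (T i) {q i}) :
    Gen D S (∑ i ∈ t, (T i + 1)) {fun ω => ∑ i ∈ t, q i ω} := by
  classical
  induction t using Finset.induction_on with
  | empty => simpa using Gen.const (D := D) (S := S) 0
  | insert i t hi ih =>
    rw [Finset.sum_insert hi]
    have := (h i (by simp)).add (ih fun j hj => h j (by simp [hj]))
    refine (this.le (by omega)).congr fun ω _ => by rw [Finset.sum_insert hi]

theorem Gen.sum_const {ι : Type*} {t : Finset ι} {q : ι → Ω → ℝ}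
    (h : ∀ i ∈ t, Gen D S T {q i}) :
    Gen D S (t.card * (T + 1)) {fun ω => ∑ i ∈ t, q i ω} := by
  simpa using Gen.sum h

theorem Gen.ofEntries {m n : ℕ} {A : Ω → Matrix (Fin m) (Fin n) ℝ} {T : Fin m → Fin n → ℕ}
    (h : ∀ i j, Gen D S (T i j) {fun ω => A ω i j}) :
    Gen D S (∑ i, ∑ j, T i j) (entries A) := by
  refine (Gen.biUnion (t := Finset.univ) fun i _ => Gen.biUnion (t := Finset.univ)
    fun j _ => h i j).subset ?_
  rintro q ⟨i, j, rfl⟩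
  simp only [Set.mem_iUnion]
  exact ⟨i, Finset.mem_univ _, j, Finset.mem_univ _, rfl⟩

theorem Gen.ofEntries_const {m n : ℕ} {A : Ω → Matrix (Fin m) (Fin n) ℝ}
    (h : ∀ i j, Gen D S T {fun ω => A ω i j}) : Gen D S (m * n * T) (entries A) := by
  refine (Gen.ofEntries h).le (by simp [mul_assoc])

/-- The members of a family of numbers that depends on the instance, as quantities. -/
def coords {ι : Type*} (f : Ω → ι → ℝ) : Set (Ω → ℝ) := {q | ∃ i, q = fun ω => f ω i}

theorem Gen.coords_const {ι : Type*} [Fintype ι] {f : Ω → ι → ℝ}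
    (h : ∀ i, Gen D S T {fun ω => f ω i}) : Gen D S (Fintype.card ι * T) (coords f) := by
  refine (Gen.biUnion (t := Finset.univ) fun i _ => h i).le (by simp) |>.subset ?_
  rintro q ⟨i, rfl⟩
  simp only [Set.mem_iUnion]
  exact ⟨i, Finset.mem_univ _, rfl⟩

theorem mem_entries {m n : ℕ} (A : Ω → Matrix (Fin m) (Fin n) ℝ) (i : Fin m) (j : Fin n) :
    (fun ω => A ω i j) ∈ entries A := ⟨i, j, rfl⟩

theorem mem_coords {ι : Type*} (f : Ω → ι → ℝ) (i : ι) : (fun ω => f ω i) ∈ coords f := ⟨i, rfl⟩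

theorem Gen.entry {m n : ℕ} {A : Ω → Matrix (Fin m) (Fin n) ℝ} (h : Gen D S T (entries A))
    (i : Fin m) (j : Fin n) : Gen D S T {fun ω => A ω i j} :=
  h.subset (by simpa using mem_entries A i j)

theorem Gen.coord {ι : Type*} {f : Ω → ι → ℝ} (h : Gen D S T (coords f)) (i : ι) :
    Gen D S T {fun ω => f ω i} :=
  h.subset (by simpa using mem_coords f i)

/-- This is where identities enter a cost estimate: a matrix may be computed by any formula that is
valid on the domain, for instance one that needs positive definiteness. -/
theorem Gen.entries_congr {m n : ℕ} {A A' : Ω → Matrix (Fin m) (Fin n) ℝ}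
    (h : Gen D S T (entries A)) (hA : ∀ ω ∈ D, A' ω = A ω) :
    Gen D S T (entries A') := by
  refine h.known ?_
  rintro q ⟨i, j, rfl⟩
  exact ⟨_, mem_entries A i j, fun ω hω => congrFun (congrFun (hA ω hω) i) j⟩

theorem Gen.coords_congr {ι : Type*} {f f' : Ω → ι → ℝ}
    (h : Gen D S T (coords f)) (hf : ∀ ω ∈ D, f' ω = f ω) : Gen D S T (coords f') := by
  refine h.known ?_
  rintro q ⟨i, rfl⟩
  exact ⟨_, mem_coords f i, fun ω hω => congrFun (hf ω hω) i⟩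

/-! ### Costs of the basic matrix operations. -/

section Matrix

variable {l m n : ℕ} {A : Ω → Matrix (Fin l) (Fin m) ℝ} {B : Ω → Matrix (Fin m) (Fin n) ℝ}
  {A' : Ω → Matrix (Fin l) (Fin m) ℝ} {x y : Ω → Fin m → ℝ} {z : Ω → Fin l → ℝ}

theorem Gen.matTranspose (hA : Gen D S T (entries A)) :
    Gen D S T (entries fun ω => (A ω)ᵀ) := by
  refine hA.subset ?_
  rintro q ⟨i, j, rfl⟩
  exact ⟨j, i, rfl⟩

theorem Gen.matAdd (hA : Gen D S T₁ (entries A))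
    (hA' : Gen D S T₂ (entries A')) :
    Gen D S (T₁ + T₂ + l * m) (entries fun ω => A ω + A' ω) := by
  refine (hA.union hA').bind ?_
  refine (Gen.ofEntries_const (T := 1) fun i j => ?_).le (by simp)
  exact (((Gen.of_mem (.inr (.inl (mem_entries A i j)))).add
      (Gen.of_mem (.inr (.inr (mem_entries A' i j)))))).le (by simp)

theorem Gen.matSub (hA : Gen D S T₁ (entries A))
    (hA' : Gen D S T₂ (entries A')) :
    Gen D S (T₁ + T₂ + l * m) (entries fun ω => A ω - A' ω) := by
  refine (hA.union hA').bind ?_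
  refine (Gen.ofEntries_const (T := 1) fun i j => ?_).le (by simp)
  exact (((Gen.of_mem (.inr (.inl (mem_entries A i j)))).sub
      (Gen.of_mem (.inr (.inr (mem_entries A' i j)))))).le (by simp)

theorem Gen.matSmul {c : Ω → ℝ} (hc : Gen D S T₁ {c}) (hA : Gen D S T₂ (entries A)) :
    Gen D S (T₁ + T₂ + l * m) (entries fun ω => c ω • A ω) := by
  refine (hc.union hA).bind ?_
  refine (Gen.ofEntries_const (T := 1) fun i j => ?_).le (by simp)
  exact (((Gen.of_mem (.inr (.inl rfl))).mul
      (Gen.of_mem (.inr (.inr (mem_entries A i j)))))).le (by simp)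

theorem Gen.dotProduct {ι : Type*} [Fintype ι] {u v : Ω → ι → ℝ} (hu : Gen D S T₁ (coords u))
    (hv : Gen D S T₂ (coords v)) :
    Gen D S (T₁ + T₂ + 2 * Fintype.card ι) {fun ω => u ω ⬝ᵥ v ω} := by
  refine (hu.union hv).bind ?_
  refine (Gen.sum_const (T := 1) fun i _ => ?_).le (by simp [mul_comm])
  exact (((Gen.of_mem (.inr (.inl (mem_coords u i)))).mul
      (Gen.of_mem (.inr (.inr (mem_coords v i)))))).le (by simp)

theorem Gen.coords_row (hA : Gen D S T (entries A)) (i : Fin l) :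
    Gen D S T (coords fun ω => A ω i) := by
  refine hA.subset ?_
  rintro q ⟨j, rfl⟩
  exact ⟨i, j, rfl⟩

theorem Gen.coords_col (hA : Gen D S T (entries A)) (j : Fin m) :
    Gen D S T (coords fun ω i => A ω i j) := by
  refine hA.subset ?_
  rintro q ⟨i, rfl⟩
  exact ⟨i, j, rfl⟩

theorem Gen.of_rows (h : ∀ i, Gen D S T (coords fun ω => A ω i)) :
    Gen D S (l * T) (entries A) := by
  refine (Gen.biUnion (t := Finset.univ) fun i _ => h i).le (by simp) |>.subset ?_
  rintro q ⟨i, j, rfl⟩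
  simp only [Set.mem_iUnion]
  exact ⟨i, Finset.mem_univ _, j, rfl⟩

theorem Gen.mulVec (hA : Gen D S T₁ (entries A)) (hx : Gen D S T₂ (coords x)) :
    Gen D S (T₁ + T₂ + 2 * (l * m)) (coords fun ω => A ω *ᵥ x ω) := by
  refine (hA.union hx).bind ?_
  refine (Gen.coords_const (T := 2 * m) fun i => ?_).le (by simp; apply le_of_eq; ring)
  exact ((((Gen.of_subset (Q := entries A) (fun q hq => .inr (.inl hq))).coords_row
      i).dotProduct (Gen.of_subset (Q := coords x) (fun q hq => .inr (.inr hq))))).le (by simp)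

theorem Gen.matMul (hA : Gen D S T₁ (entries A))
    (hB : Gen D S T₂ (entries B)) :
    Gen D S (T₁ + T₂ + 2 * (l * m * n)) (entries fun ω => A ω * B ω) := by
  refine (hA.union hB).bind ?_
  refine (Gen.ofEntries_const (T := 2 * m) fun i j => ?_).le (by apply le_of_eq; ring)
  exact ((((Gen.of_subset (Q := entries A) (fun q hq => .inr (.inl hq))).coords_row
      i).dotProduct ((Gen.of_subset (Q := entries B)
        (fun q hq => .inr (.inr hq))).coords_col j))).le (by simp)

theorem Gen.matVecMulVec (hz : Gen D S T₁ (coords z)) (hx : Gen D S T₂ (coords x)) :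
    Gen D S (T₁ + T₂ + l * m) (entries fun ω => vecMulVec (z ω) (x ω)) := by
  refine (hz.union hx).bind ?_
  refine (Gen.ofEntries_const (T := 1) fun i j => ?_).le (by simp)
  exact (((Gen.of_mem (.inr (.inl (mem_coords z i)))).mul
      (Gen.of_mem (.inr (.inr (mem_coords x j)))))).le (by simp)

theorem Gen.vecSmul {ι : Type*} [Fintype ι] {c : Ω → ℝ} {v : Ω → ι → ℝ} (hc : Gen D S T₁ {c})
    (hv : Gen D S T₂ (coords v)) :
    Gen D S (T₁ + T₂ + Fintype.card ι) (coords fun ω => c ω • v ω) := by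
  refine (hc.union hv).bind ?_
  refine (Gen.coords_const (T := 1) fun i => ?_).le (by simp)
  exact (((Gen.of_mem (.inr (.inl rfl))).mul (Gen.of_mem (.inr (.inr (mem_coords v i)))))).le (by simp)

theorem Gen.vecSub {ι : Type*} [Fintype ι] {u v : Ω → ι → ℝ} (hu : Gen D S T₁ (coords u))
    (hv : Gen D S T₂ (coords v)) :
    Gen D S (T₁ + T₂ + Fintype.card ι) (coords fun ω => u ω - v ω) := by
  refine (hu.union hv).bind ?_
  refine (Gen.coords_const (T := 1) fun i => ?_).le (by simp)
  exact (((Gen.of_mem (.inr (.inl (mem_coords u i)))).sub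
      (Gen.of_mem (.inr (.inr (mem_coords v i)))))).le (by simp)

/-- The product of a sparse and a dense matrix. -/
theorem Gen.sparseMul {E : Finset (Fin l × Fin m)} (hE : ∀ ω ∈ D, sparsity (A ω) ⊆ E)
    (hA : Gen D S T₁ (entries A)) (hB : Gen D S T₂ (entries B)) :
    Gen D S (T₁ + T₂ + 2 * (E.card * n)) (entries fun ω => A ω * B ω) := by
  classical
  refine (hA.union hB).bind ?_
  have key : ∀ i j, Gen D (S ∪ (entries A ∪ entries B))
      ((Finset.univ.filter fun k => (i, k) ∈ E).card * 2) {fun ω => (A ω * B ω) i j} := by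
    intro i j
    refine (Gen.sum_const (T := 1) (t := Finset.univ.filter fun k => (i, k) ∈ E) fun k _ =>
      ((Gen.of_mem (.inr (.inl (mem_entries A i k)))).mul
        (Gen.of_mem (.inr (.inr (mem_entries B k j)))))).congr fun ω hω => ?_
    rw [Matrix.mul_apply, Finset.sum_filter]
    refine Finset.sum_congr rfl fun k _ => ?_
    split_ifs with h
    · rfl
    · have : A ω i k = 0 := by
        by_contra h0
        exact h (hE ω hω (by simpa [sparsity] using h0))
      rw [this, zero_mul]
  refine (Gen.ofEntries key).le ?_
  -- Row `i` costs its number of admissible positions for each of the `n` columns; summing over the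
  -- rows counts every position of `E` once.
  have : E.card = ∑ i, (Finset.univ.filter fun k => (i, k) ∈ E).card := by
    rw [Finset.card_eq_sum_card_fiberwise (f := Prod.fst) (t := Finset.univ) (by simp)]
    refine Finset.sum_congr rfl fun i _ => ?_
    rw [← Finset.card_map ⟨fun k : Fin m => (i, k), fun a b h => by simpa using h⟩]
    congr 1
    ext ⟨i', k⟩
    constructor
    · intro h
      obtain ⟨h, rfl⟩ := Finset.mem_filter.1 h
      exact Finset.mem_map.2 ⟨k, by simpa using h, rfl⟩
    · intro h
      obtain ⟨k', hk, h'⟩ := Finset.mem_map.1 h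
      obtain ⟨rfl, rfl⟩ := Prod.mk.injEq .. ▸ h'
      exact Finset.mem_filter.2 ⟨by simpa using hk, rfl⟩
  rw [this]
  simp only [Finset.sum_const, Finset.card_univ, Fintype.card_fin, smul_eq_mul, Finset.sum_mul,
    Finset.mul_sum]
  refine le_of_eq (Finset.sum_congr rfl fun i _ => by ring)

/-- The product of the transpose of a sparse matrix and a dense matrix. -/
theorem Gen.sparseTransposeMul {E : Finset (Fin m × Fin l)} {A : Ω → Matrix (Fin m) (Fin l) ℝ}
    (hE : ∀ ω ∈ D, sparsity (A ω) ⊆ E)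
    (hA : Gen D S T₁ (entries A)) (hB : Gen D S T₂ (entries B)) :
    Gen D S (T₁ + T₂ + 2 * (E.card * n)) (entries fun ω => (A ω)ᵀ * B ω) := by
  classical
  have := Gen.sparseMul (E := E.map (Equiv.prodComm _ _).toEmbedding) (D := D)
    (A := fun ω => (A ω)ᵀ) (fun ω hω => by
      rintro ⟨i, j⟩ hij
      have : (j, i) ∈ E := hE ω hω (by
        simp only [sparsity, Finset.mem_filter] at hij ⊢
        simpa using hij)
      simpa using this) hA.matTranspose hB
  simpa using this

/-- The trace inner product of two matrices. -/
theorem Gen.traceInner (hA : Gen D S T₁ (entries A))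
    (hA' : Gen D S T₂ (entries A')) :
    Gen D S (T₁ + T₂ + 2 * (l * m) + m) {fun ω => ((A ω)ᵀ * A' ω).trace} := by
  rw [add_assoc (T₁ + T₂)]
  refine (hA.union hA').bind ?_
  refine (Gen.sum_const (t := Finset.univ) (T := 2 * l) fun j _ =>
    (((Gen.of_subset (Q := entries A) (fun q hq => .inr (.inl hq))).coords_col
      j).dotProduct ((Gen.of_subset (Q := entries A')
        (fun q hq => .inr (.inr hq))).coords_col j)).le (by simp)).le ?_
  simp
  apply le_of_eq; ring

theorem Gen.matOne : Gen D S 0 (entries fun _ : Ω => (1 : Matrix (Fin n) (Fin n) ℝ)) := by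
  refine (Gen.ofEntries_const (T := 0) fun i j => ?_).le (by simp)
  by_cases h : i = j
  · simpa [Matrix.one_apply, h] using Gen.const (D := D) (S := S) 1
  · simpa [Matrix.one_apply, h] using Gen.const (D := D) (S := S) 0

end Matrix

end Calculus

end SketchedFDA

namespace SketchedFDA

/-! ### Inverting matrices -/

section Inverse

variable {d : ℕ}

theorem isUnit_det_of_mulVec_eq_zero {ι : Type*} [Fintype ι] [DecidableEq ι] {A : Matrix ι ι ℝ}
    (h : ∀ x, A *ᵥ x = 0 → x = 0) : IsUnit A.det := by
  rw [isUnit_iff_ne_zero]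
  intro h0
  obtain ⟨v, hv, hv'⟩ := Matrix.exists_mulVec_eq_zero_iff.2 h0
  exact hv (h v hv')

/-- Sherman–Morrison formula. The denominator needs no separate hypothesis: were it zero, `A⁻¹u`
would lie in the kernel of the invertible updated matrix, hence vanish, and the denominator would be
`1`. -/
theorem inv_add_vecMulVec {ι : Type*} [Fintype ι] [DecidableEq ι] {A : Matrix ι ι ℝ} {u v : ι → ℝ}
    (hA : IsUnit A.det) (h : IsUnit (A + vecMulVec u v).det) :
    (A + vecMulVec u v)⁻¹ = A⁻¹ - (1 / (1 + v ⬝ᵥ (A⁻¹ *ᵥ u))) • vecMulVec (A⁻¹ *ᵥ u) (v ᵥ* A⁻¹) := by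
  have hne : 1 + v ⬝ᵥ (A⁻¹ *ᵥ u) ≠ 0 := by
    intro h0
    have h1 : (A + vecMulVec u v) *ᵥ (A⁻¹ *ᵥ u) = 0 := by
      rw [Matrix.add_mulVec, Matrix.mulVec_mulVec, Matrix.mul_nonsing_inv _ hA, Matrix.one_mulVec,
        Matrix.vecMulVec_mulVec]
      ext i
      simp only [Pi.add_apply, Pi.smul_apply, MulOpposite.smul_eq_mul_unop, MulOpposite.unop_op,
        Pi.zero_apply]
      linear_combination u i * h0
    have h2 : A⁻¹ *ᵥ u = 0 := by
      have := congrArg (fun z => (A + vecMulVec u v)⁻¹ *ᵥ z) h1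
      rwa [Matrix.mulVec_mulVec, Matrix.nonsing_inv_mul _ h, Matrix.one_mulVec, Matrix.mulVec_zero]
        at this
    rw [h2] at h0
    simp at h0
  refine Matrix.inv_eq_right_inv ?_
  rw [Matrix.add_mul, Matrix.mul_sub, Matrix.mul_nonsing_inv _ hA, Matrix.mul_sub,
    Matrix.mul_smul, Matrix.mul_smul, Matrix.mul_vecMulVec, Matrix.mulVec_mulVec,
    Matrix.mul_nonsing_inv _ hA, Matrix.one_mulVec, Matrix.vecMulVec_mul_vecMulVec,
    Matrix.vecMulVec_mul]
  ext i j
  simp only [Matrix.add_apply, Matrix.sub_apply, Matrix.smul_apply, vecMulVec_apply, smul_eq_mul,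
    Pi.smul_apply]
  field_simp
  ring

/-- The first `k` rows of `M`, completed by rows of the identity matrix. -/
def leadingRows (M : Matrix (Fin d) (Fin d) ℝ) (k : ℕ) : Matrix (Fin d) (Fin d) ℝ :=
  Matrix.of fun i j => if i.val < k then M i j else (1 : Matrix (Fin d) (Fin d) ℝ) i j

/-- A kernel vector `x` is supported on the first `k` coordinates, and `Mx` vanishes on those, so
`xᵀMx = 0`. Thus positive definiteness keeps all intermediate matrices invertible and no pivoting is
needed. -/
theorem isUnit_det_leadingRows {M : Matrix (Fin d) (Fin d) ℝ} (hM : M.PosDef) (k : ℕ) :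
    IsUnit (leadingRows M k).det := by
  refine isUnit_det_of_mulVec_eq_zero fun x hx => ?_
  have h1 : ∀ i : Fin d, ¬ i.val < k → x i = 0 := by
    intro i hi
    have := congrFun hx i
    simpa [leadingRows, Matrix.mulVec, dotProduct, hi, Matrix.one_apply] using this
  have h2 : ∀ i : Fin d, i.val < k → (M *ᵥ x) i = 0 := by
    intro i hi
    have := congrFun hx i
    simpa [leadingRows, Matrix.mulVec, dotProduct, hi] using this
  have h3 : x ⬝ᵥ (M *ᵥ x) = 0 := by
    refine Finset.sum_eq_zero fun i _ => ?_
    by_cases hi : i.val < k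
    · rw [h2 i hi, mul_zero]
    · rw [h1 i hi, zero_mul]
  by_contra hne
  have := hM.dotProduct_mulVec_pos hne
  simp [h3] at this

theorem leadingRows_succ (M : Matrix (Fin d) (Fin d) ℝ) (k : Fin d) :
    leadingRows M (k + 1) = leadingRows M k +
      vecMulVec (Pi.single k 1) (M k - (1 : Matrix (Fin d) (Fin d) ℝ) k) := by
  ext i j
  simp only [leadingRows, Matrix.of_apply, Matrix.add_apply, vecMulVec_apply, Pi.sub_apply]
  rcases lt_trichotomy i k with h | rfl | h
  · have h' : i.val < k.val := h
    simp [h', h.ne, Nat.lt_succ_of_lt h']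
  · simp
  · have h' : k.val < i.val := h
    simp [h.ne', show ¬ i.val < k.val by omega, show ¬ i.val < k.val + 1 by omega]

variable {Ω : Type} {D : Set Ω} {S : Set (Ω → ℝ)} {T T₁ T₂ : ℕ}

/-- Replacing one more row of the identity by a row of `M` is a rank-one update, so each inverse
follows from the previous one with `O(d²)` operations. The required product of the old inverse with
a unit vector is one of its columns and costs nothing. -/
theorem Gen.inv_leadingRows {M : Ω → Matrix (Fin d) (Fin d) ℝ} (hM : ∀ ω ∈ D, (M ω).PosDef)
    (h : entries M ⊆ S) (k : ℕ) (hk : k ≤ d) :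
    Gen D S (k * (11 * d ^ 2)) (entries fun ω => (leadingRows (M ω) k)⁻¹) := by
  induction k with
  | zero =>
    rw [zero_mul]
    refine Gen.matOne.entries_congr fun ω _ => ?_
    have : leadingRows (M ω) 0 = 1 := by ext i j; simp [leadingRows]
    rw [this, inv_one]
  | succ k ih =>
    have hk' : k < d := hk
    set k' : Fin d := ⟨k, hk'⟩
    have hd : 1 ≤ d := by omega
    rw [add_mul]
    refine (ih hk'.le).bind ?_
    set S' := S ∪ entries fun ω => (leadingRows (M ω) k)⁻¹
    have hN : Gen D S' 0 (entries fun ω => (leadingRows (M ω) k)⁻¹) :=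
      .of_subset Set.subset_union_right
    have hMk : Gen D S' 0 (coords fun ω => M ω k') :=
      (Gen.of_subset (h.trans Set.subset_union_left)).coords_row k'
    have h1 : Gen D S' 0 (coords fun _ : Ω => (1 : Matrix (Fin d) (Fin d) ℝ) k') :=
      Gen.matOne.coords_row k'
    have hv := hMk.vecSub h1
    have hx : Gen D S' 0 (coords fun ω => (leadingRows (M ω) k)⁻¹ *ᵥ (Pi.single k' 1)) :=
      (hN.coords_col k').coords_congr fun ω _ => by
        ext i; simp
    have hw := (hN.matTranspose.mulVec hv).coords_congr
      (f' := fun ω => (M ω k' - (1 : Matrix (Fin d) (Fin d) ℝ) k') ᵥ* (leadingRows (M ω) k)⁻¹)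
      fun ω _ => by rw [Matrix.mulVec_transpose]
    have hδ := (Gen.const 1).div ((Gen.const (D := D) (S := S') 1).add (hv.dotProduct hx))
    have := hN.matSub (hδ.matSmul (hx.matVecMulVec hw))
    refine (this.le ?_).entries_congr fun ω hω => ?_
    · simp only [Fintype.card_fin]
      nlinarith
    · have e := leadingRows_succ (M ω) k'
      have := inv_add_vecMulVec (isUnit_det_leadingRows (hM ω hω) k)
        (by rw [← e]; exact isUnit_det_leadingRows (hM ω hω) (k' + 1))
      rw [show k + 1 = k' + 1 from rfl, e, this]
      simp

/-- Inversion of a positive definite matrix. -/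
theorem Gen.inv_posDef {M : Ω → Matrix (Fin d) (Fin d) ℝ} (hM : ∀ ω ∈ D, (M ω).PosDef)
    (h : Gen D S T (entries M)) : Gen D S (T + 11 * d ^ 3) (entries fun ω => (M ω)⁻¹) := by
  refine h.bind (((Gen.inv_leadingRows (S := S ∪ entries M) hM Set.subset_union_right d
    le_rfl).le (by apply le_of_eq; ring)).entries_congr fun ω _ => ?_)
  congr 1
  ext i j
  simp [leadingRows]

/-- Inversion of a matrix. -/
theorem Gen.inv {A : Ω → Matrix (Fin d) (Fin d) ℝ} (hA : ∀ ω ∈ D, IsUnit (A ω).det)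
    (h : Gen D S T (entries A)) : Gen D S (T + 15 * d ^ 3) (entries fun ω => (A ω)⁻¹) := by
  refine h.bind ?_
  have h0 : Gen D (S ∪ entries A) 0 (entries A) := .of_subset Set.subset_union_right
  -- The general case is reduced to the positive definite one by `A⁻¹ = (AᵀA)⁻¹Aᵀ`.
  refine (((h0.matTranspose.matMul h0).inv_posDef fun ω hω => ?_).matMul
    h0.matTranspose).le (by apply le_of_eq; ring) |>.entries_congr fun ω hω => ?_
  · have := Matrix.PosDef.conjTranspose_mul_self (A ω)
      (Matrix.mulVec_injective_of_isUnit ((Matrix.isUnit_iff_isUnit_det _).2 (hA ω hω)))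
    simpa using this
  · refine Matrix.inv_eq_left_inv ?_
    rw [Matrix.mul_assoc]
    refine Matrix.nonsing_inv_mul _ ?_
    rw [Matrix.det_mul, Matrix.det_transpose]
    exact (hA ω hω).mul (hA ω hω)

end Inverse

end SketchedFDA

namespace SketchedFDA

/-! ### Householder reduction -/

section Householder

variable {p : ℕ}

/-- The reflection at the hyperplane orthogonal to `u` (the identity if `u = 0`). -/
noncomputable def reflector (u : Fin p → ℝ) : Matrix (Fin p) (Fin p) ℝ :=
  1 - (2 / (u ⬝ᵥ u)) • vecMulVec u u

theorem reflector_transpose (u : Fin p → ℝ) : (reflector u)ᵀ = reflector u := by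
  simp [reflector, transpose_vecMulVec]

theorem reflector_mulVec (u x : Fin p → ℝ) :
    reflector u *ᵥ x = x - (2 / (u ⬝ᵥ u) * (u ⬝ᵥ x)) • u := by
  rw [reflector, Matrix.sub_mulVec, Matrix.one_mulVec, Matrix.smul_mulVec,
    Matrix.vecMulVec_mulVec]
  ext i
  simp only [Pi.sub_apply, Pi.smul_apply, smul_eq_mul, MulOpposite.smul_eq_mul_unop,
    MulOpposite.unop_op]
  ring

theorem reflector_mul_self (u : Fin p → ℝ) : reflector u * reflector u = 1 := by
  by_cases h : u ⬝ᵥ u = 0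
  · simp [reflector, h]
  · refine Matrix.ext_of_mulVec_single fun i => ?_
    rw [← Matrix.mulVec_mulVec, reflector_mulVec, reflector_mulVec, Matrix.one_mulVec]
    simp only [dotProduct_sub, dotProduct_smul, smul_eq_mul]
    ext j
    simp only [Pi.sub_apply, Pi.smul_apply, smul_eq_mul]
    field_simp
    ring

theorem mul_reflector (A : Matrix (Fin p) (Fin p) ℝ) (u : Fin p → ℝ) :
    A * reflector u = A - (2 / (u ⬝ᵥ u)) • vecMulVec (A *ᵥ u) u := by
  rw [reflector, Matrix.mul_sub, Matrix.mul_one, Matrix.mul_smul, Matrix.mul_vecMulVec]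

/-- Two vectors of equal length are exchanged by the reflection at their bisecting hyperplane. For
`x = y` the division by zero makes the reflector the identity, which is again correct. -/
theorem reflector_mulVec_eq {x y : Fin p → ℝ} (h : x ⬝ᵥ x = y ⬝ᵥ y) :
    reflector (x - y) *ᵥ x = y := by
  rw [reflector_mulVec]
  by_cases h0 : (x - y) ⬝ᵥ (x - y) = 0
  · have : x - y = 0 := dotProduct_self_eq_zero.1 h0
    rw [this]
    simpa [sub_eq_zero] using this
  · have h1 : (x - y) ⬝ᵥ (x - y) = 2 * ((x - y) ⬝ᵥ x) := by
      simp only [dotProduct_sub, sub_dotProduct]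
      rw [dotProduct_comm y x, ← h]
      ring
    have h2 : (x - y) ⬝ᵥ x ≠ 0 := by
      intro h2; rw [h1, h2] at h0; simp at h0
    rw [h1]
    have : 2 / (2 * ((x - y) ⬝ᵥ x)) * ((x - y) ⬝ᵥ x) = 1 := by field_simp
    rw [this]
    simp

/-- The part below the diagonal of column `k`. -/
noncomputable def belowDiag (T : Matrix (Fin p) (Fin p) ℝ) (k : Fin p) : Fin p → ℝ :=
  fun i => if k < i then T i k else 0

/-- The normal vector of the reflection that creates zeros in column `k`. -/
noncomputable def householderVec (T : Matrix (Fin p) (Fin p) ℝ) (k k' : Fin p) : Fin p → ℝ :=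
  belowDiag T k - Pi.single k' (√(belowDiag T k ⬝ᵥ belowDiag T k))

/-- The vector `u` is supported strictly below position `k`. Hence multiplication from the right
leaves the columns up to `k` alone, multiplication from the left preserves the zeros already created
in earlier columns, and column `k` loses everything below its subdiagonal entry. -/
theorem householder_step (T : Matrix (Fin p) (Fin p) ℝ) {k k' : Fin p} (hk : k'.val = k + 1)
    (hT : ∀ i j : Fin p, j < k → j.val + 1 < i → T i j = 0) (i j : Fin p) (hj : j ≤ k)
    (hij : j.val + 1 < i) :
    (reflector (householderVec T k k') * T * reflector (householderVec T k k')) i j = 0 := by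
  set u := householderVec T k k' with hu
  have hu0 : ∀ i, i ≤ k → u i = 0 := by
    intro i hi
    have : i ≠ k' := by intro h; rw [h] at hi; have : k'.val ≤ k.val := hi; omega
    simp [hu, householderVec, belowDiag, not_lt.2 hi, this]
  rw [mul_reflector]
  rw [Matrix.sub_apply, Matrix.smul_apply, vecMulVec_apply, hu0 j hj, mul_zero, smul_zero, sub_zero]
  have e1 : (reflector u * T) i j = (reflector u *ᵥ fun i => T i j) i := rfl
  rw [e1]
  rcases hj.lt_or_eq with hj | rfl
  · have : u ⬝ᵥ (fun i => T i j) = 0 := by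
      refine Finset.sum_eq_zero fun r _ => ?_
      by_cases hr : r ≤ k
      · rw [hu0 r hr, zero_mul]
      · have h1 : j.val < k.val := hj
        have h2 : k.val < r.val := not_le.1 hr
        exact mul_eq_zero_of_right _ (hT r j hj (by omega))
    rw [reflector_mulVec, this]
    simpa using hT i j hj hij
  -- The part below the diagonal is sent to a multiple of a unit vector; the rest of the column is
  -- orthogonal to `u` and does not move.
  · have e2 : (fun i => T i j) = belowDiag T j + fun i => if j < i then 0 else T i j := by
      ext i
      by_cases h : j < i <;> simp [belowDiag, h]
    rw [e2, Matrix.mulVec_add, hu, householderVec, reflector_mulVec_eq, ← householderVec, ← hu,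
      reflector_mulVec]
    · have : u ⬝ᵥ (fun i => if j < i then 0 else T i j) = 0 := by
        refine Finset.sum_eq_zero fun r _ => ?_
        by_cases hr : r ≤ j
        · rw [hu0 r hr, zero_mul]
        · simp [not_le.1 hr]
      rw [this]
      have h1 : j < i := by show j.val < i.val; omega
      have h2 : i ≠ k' := by rintro rfl; omega
      simp [h1, h2]
    · simp only [single_dotProduct, Pi.single_eq_same]
      rw [Real.mul_self_sqrt]
      exact Finset.sum_nonneg fun _ _ => mul_self_nonneg _

variable {Ω : Type} {D : Set Ω} {S : Set (Ω → ℝ)} {T T₁ T₂ : ℕ}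

/-- The reflector is never formed: the product is a rank-one correction of `A`, so it costs `O(p²)`
rather than `O(p³)`. -/
theorem Gen.mulReflector {A : Ω → Matrix (Fin p) (Fin p) ℝ} {u : Ω → Fin p → ℝ}
    (hA : Gen D S T₁ (entries A)) (hu : Gen D S T₂ (coords u)) :
    Gen D S (T₁ + T₂ + (5 * p ^ 2 + 2 * p + 1)) (entries fun ω => A ω * reflector (u ω)) := by
  refine (hA.union hu).bind ?_
  have hA' : Gen D (S ∪ (entries A ∪ coords u)) 0 (entries A) :=
    .of_subset fun q hq => .inr (.inl hq)
  have hu' : Gen D (S ∪ (entries A ∪ coords u)) 0 (coords u) :=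
    .of_subset fun q hq => .inr (.inr hq)
  refine ((hA'.matSub (((Gen.const 2).div (hu'.dotProduct hu')).matSmul
    ((hA'.mulVec hu').matVecMulVec hu'))).le ?_).entries_congr fun ω _ => ?_
  · simp only [Fintype.card_fin]
    nlinarith
  · rw [mul_reflector]
    simp

theorem Gen.householderVec {A : Ω → Matrix (Fin p) (Fin p) ℝ} (hA : Gen D S T (entries A))
    (k k' : Fin p) :
    Gen D S (T + (3 * p + 1)) (coords fun ω => householderVec (A ω) k k') := by
  refine hA.bind ?_
  have hA' : Gen D (S ∪ entries A) 0 (entries A) := .of_subset Set.subset_union_right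
  have hx : Gen D (S ∪ entries A) 0 (coords fun ω => belowDiag (A ω) k) := by
    refine (Gen.coords_const (T := 0) fun i => ?_).le (by simp)
    by_cases h : k < i
    · simpa [belowDiag, h] using hA'.entry i k
    · simpa [belowDiag, h] using Gen.const (D := D) (S := S ∪ entries A) 0
  have hs := ((hx.dotProduct hx).sqrt)
  refine (hx.union hs).bind (T₂ := p * 1) ?_ |>.le (by simp; omega)
  refine (Gen.coords_const (T := 1) fun i => ?_).le (by simp)
  by_cases h : i = k'
  · refine ((Gen.of_mem (.inr (.inl (mem_coords _ i)))).sub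
      (Gen.of_mem (.inr (.inr rfl)))).congr fun ω _ => ?_
    simp [SketchedFDA.householderVec, h]
  · refine ((Gen.of_mem (.inr (.inl (mem_coords _ i)))).le (by simp)).congr fun ω _ => ?_
    simp [SketchedFDA.householderVec, h]

/-- Householder reduction to Hessenberg form. -/
theorem Gen.hessenberg {K : Ω → Matrix (Fin p) (Fin p) ℝ} (h : entries K ⊆ S) (k : ℕ) :
    ∃ H Q : Ω → Matrix (Fin p) (Fin p) ℝ, Gen D S (k * (30 * p ^ 2)) (entries H ∪ entries Q) ∧
      ∀ ω ∈ D, (Q ω)ᵀ * Q ω = 1 ∧ H ω = (Q ω)ᵀ * K ω * Q ω ∧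
        ∀ i j : Fin p, j.val < k → j.val + 1 < i → H ω i j = 0 := by
  induction k with
  | zero =>
    refine ⟨K, fun _ => 1, ?_, by simp⟩
    exact ((Gen.of_subset h).union Gen.matOne).le (by simp)
  | succ k ih =>
    obtain ⟨H, Q, hG, hHQ⟩ := ih
    by_cases hk : k + 1 < p
    · set k₀ : Fin p := ⟨k, by omega⟩
      set k₁ : Fin p := ⟨k + 1, hk⟩
      let u : Ω → Fin p → ℝ := fun ω => SketchedFDA.householderVec (H ω) k₀ k₁
      refine ⟨fun ω => reflector (u ω) * H ω * reflector (u ω), fun ω => Q ω * reflector (u ω),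
        ?_, ?_⟩
      · rw [add_mul]
        refine hG.bind ?_
        set S' := S ∪ (entries H ∪ entries Q)
        have hH : Gen D S' 0 (entries H) := .of_subset fun q hq => .inr (.inl hq)
        have hu : Gen D S' _ (coords u) := hH.householderVec k₀ k₁
        refine (hu.bind (T₂ := 3 * (5 * p ^ 2 + 2 * p + 1)) ?_).le (by nlinarith)
        have hu' : Gen D (S' ∪ coords u) 0 (coords u) := .of_subset Set.subset_union_right
        have hH' : Gen D (S' ∪ coords u) 0 (entries H) :=
          .of_subset fun q hq => .inl (.inr (.inl hq))
        have hQ' : Gen D (S' ∪ coords u) 0 (entries Q) :=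
          .of_subset fun q hq => .inl (.inr (.inr hq))
        -- Multiplication from the left is multiplication from the right of the transpose, the
        -- reflector being symmetric.
        refine ((((hH'.matTranspose.mulReflector hu').matTranspose.entries_congr
          (A' := fun ω => reflector (u ω) * H ω) fun ω _ => ?_).mulReflector
          hu').union (hQ'.mulReflector hu')).le (by apply le_of_eq; ring)
        rw [Matrix.transpose_mul, reflector_transpose, Matrix.transpose_transpose]
      · intro ω hω
        obtain ⟨h1, h2, h3⟩ := hHQ ω hω
        refine ⟨?_, ?_, fun i j hj hij => ?_⟩
        · beta_reduce
          rw [Matrix.transpose_mul, Matrix.mul_assoc, ← Matrix.mul_assoc _ (Q ω), h1, Matrix.one_mul,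
            reflector_transpose, reflector_mul_self]
        · beta_reduce
          rw [h2, Matrix.transpose_mul, reflector_transpose]
          simp only [Matrix.mul_assoc]
        · exact householder_step (H ω) (k := k₀) (k' := k₁) rfl (fun i j hj hij => h3 i j hj hij) i j
            (Nat.lt_succ_iff.1 hj) hij
    -- The remaining columns have no entry more than one place below the diagonal, so nothing is
    -- left to do.
    · refine ⟨H, Q, hG.le (by nlinarith), fun ω hω => ?_⟩
      obtain ⟨h1, h2, h3⟩ := hHQ ω hω
      exact ⟨h1, h2, fun i j hj hij => h3 i j (by omega) hij⟩

end Householder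

end SketchedFDA

namespace SketchedFDA

/-! ### Tridiagonal Lyapunov equations -/

section Tridiagonal

/-- The entry `(i, j)` of `T s + s T`, where `T` is the symmetric tridiagonal matrix with the
diagonal `a` and the entries `b i` at the positions `(i, i - 1)` and `(i - 1, i)`. -/
def triLyap (a b : ℕ → ℝ) (s : ℕ → ℕ → ℝ) (i j : ℕ) : ℝ :=
  b i * s (i - 1) j + a i * s i j + b (i + 1) * s (i + 1) j +
    (b j * s i (j - 1) + a j * s i j + b (j + 1) * s i (j + 1))

theorem triLyap_swap (a b : ℕ → ℝ) (s : ℕ → ℕ → ℝ) (i j : ℕ) :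
    triLyap a b (fun i j => s j i) i j = triLyap a b s j i := by
  simp only [triLyap]
  ring

/-- Row recursion for the equations `triLyap a b s = c` on `[α, α + m) × [β, β + k)`. Row `i + 1`
is row `α + i` of the solution, computed from the row `α`, which is `σ`; row `m + 1` is the
residual of the last equation. -/
noncomputable def sweep (a b : ℕ → ℝ) (α m β k : ℕ) (c : ℕ → ℕ → ℝ) (σ : ℕ → ℝ) : ℕ → ℕ → ℝ
  | 0, _ => 0
  | 1, j => if β ≤ j ∧ j < β + k then σ j else 0
  | i + 2, j =>
    if β ≤ j ∧ j < β + k then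
      (c (α + i) j - (a (α + i) + a j) * sweep a b α m β k c σ (i + 1) j
        - b j * sweep a b α m β k c σ (i + 1) (j - 1)
        - b (j + 1) * sweep a b α m β k c σ (i + 1) (j + 1)
        - b (α + i) * sweep a b α m β k c σ i j) / (if i + 1 < m then b (α + i + 1) else 1)
    else 0

variable {a b : ℕ → ℝ} {α m β k p : ℕ} {c c' : ℕ → ℕ → ℝ} {σ σ' : ℕ → ℝ}

theorem sweep_of_not (i : ℕ) {j : ℕ} (hj : ¬ (β ≤ j ∧ j < β + k)) :
    sweep a b α m β k c σ i j = 0 := by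
  match i with
  | 0 => simp [sweep]
  | 1 => simp [sweep, hj]
  | i + 2 => simp [sweep, hj]

theorem sweep_add (i : ℕ) : ∀ j, sweep a b α m β k (fun i j => c i j + c' i j)
    (fun j => σ j + σ' j) i j = sweep a b α m β k c σ i j + sweep a b α m β k c' σ' i j := by
  induction i using Nat.twoStepInduction with
  | zero => simp [sweep]
  | one =>
    intro j
    simp only [sweep]
    split_ifs <;> simp
  | more i ih1 ih2 =>
    intro j
    simp only [sweep, ih1, ih2]
    by_cases h : β ≤ j ∧ j < β + k
    · simp only [h, and_self, if_true]
      rw [← add_div]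
      congr 1
      ring
    · simp [h]

theorem sweep_smul (r : ℝ) (i : ℕ) : ∀ j, sweep a b α m β k (fun _ _ => 0)
    (fun j => r * σ j) i j = r * sweep a b α m β k (fun _ _ => 0) σ i j := by
  induction i using Nat.twoStepInduction with
  | zero => simp [sweep]
  | one =>
    intro j
    simp only [sweep]
    split_ifs <;> simp
  | more i ih1 ih2 =>
    intro j
    simp only [sweep, ih1, ih2]
    by_cases h : β ≤ j ∧ j < β + k
    · simp only [h, and_self, if_true]
      rw [mul_div_assoc']
      congr 1
      ring
    · simp [h]

theorem sweep_congr (hσ : ∀ j, β ≤ j → j < β + k → σ j = σ' j) (i : ℕ) :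
    ∀ j, sweep a b α m β k c σ i j = sweep a b α m β k c σ' i j := by
  induction i using Nat.twoStepInduction with
  | zero => simp [sweep]
  | one =>
    intro j
    simp only [sweep]
    split_ifs with h
    · exact hσ j h.1 h.2
    · rfl
  | more i ih1 ih2 =>
    intro j
    simp only [sweep, ih1, ih2]

/-- The `q`-th unit row of the rectangle. -/
noncomputable def unitRow (β q : ℕ) : ℕ → ℝ := fun j => if j = β + q then 1 else 0

theorem sweep_sum (t : Finset ℕ) (r : ℕ → ℝ) (i j : ℕ) :
    sweep a b α m β k (fun _ _ => 0) (fun j => ∑ q ∈ t, r q * unitRow β q j) i j =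
      ∑ q ∈ t, r q * sweep a b α m β k (fun _ _ => 0) (unitRow β q) i j := by
  induction t using Finset.induction_on with
  | empty =>
    have := sweep_smul (a := a) (b := b) (α := α) (m := m) (β := β) (k := k) (σ := 0) 0 i j
    simpa using this
  | insert q t hq ih =>
    simp only [Finset.sum_insert hq]
    rw [← ih, ← sweep_smul]
    have := sweep_add (a := a) (b := b) (α := α) (m := m) (β := β) (k := k) (c := fun _ _ => 0)
      (c' := fun _ _ => 0) (σ := fun j => r q * unitRow β q j)
      (σ' := fun j => ∑ q ∈ t, r q * unitRow β q j) i j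
    simpa using this

theorem sum_unitRow (σ : ℕ → ℝ) (j : ℕ) (hj : β ≤ j) (hj' : j < β + k) :
    ∑ q ∈ Finset.range k, σ (β + q) * unitRow β q j = σ j := by
  rw [Finset.sum_eq_single (j - β)]
  · rw [unitRow, if_pos (by omega), mul_one]
    congr 1
    omega
  · intro q _ hq
    rw [unitRow, if_neg (by omega), mul_zero]
  · intro h
    exact absurd (Finset.mem_range.2 (by omega)) h

/-- Superposition: the recursion is linear in the right-hand side and the first row together. Its
result is the one for first row zero plus a combination of the homogeneous results for unit rows, so
the influence of the unknown row is captured by a matrix. -/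
theorem sweep_eq (σ : ℕ → ℝ) (i j : ℕ) :
    sweep a b α m β k c σ i j = sweep a b α m β k c 0 i j +
      ∑ q ∈ Finset.range k, sweep a b α m β k (fun _ _ => 0) (unitRow β q) i j * σ (β + q) := by
  have h1 := sweep_add (a := a) (b := b) (α := α) (m := m) (β := β) (k := k) (c := c)
    (c' := fun _ _ => 0) (σ := 0) (σ' := σ) i j
  simp only [add_zero, Pi.zero_apply, zero_add] at h1
  rw [h1]
  congr 1
  rw [sweep_congr (σ' := fun j => ∑ q ∈ Finset.range k, σ (β + q) * unitRow β q j)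
    (fun j hj hj' => (sum_unitRow σ j hj hj').symm), sweep_sum]
  exact Finset.sum_congr rfl fun q _ => mul_comm _ _

/-- The two neighbours of a column enter only with the factors `b j` and `b (j + 1)`. These vanish
at the borders of the rectangle, so values outside it are irrelevant, including the value at the
truncated index `0 - 1`. -/
theorem mul_neighbour_congr (hβ : b β = 0) (hβ' : b (β + k) = 0) {f g : ℕ → ℝ}
    (h : ∀ j, β ≤ j → j < β + k → f j = g j) {j : ℕ} (hj : β ≤ j) (hj' : j < β + k) :
    b j * f (j - 1) = b j * g (j - 1) ∧ b (j + 1) * f (j + 1) = b (j + 1) * g (j + 1) := by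
  constructor
  · rcases hj.eq_or_lt with rfl | hj
    · simp [hβ]
    · rw [h (j - 1) (by omega) (by omega)]
  · rcases (Nat.succ_le_of_lt hj').eq_or_lt with h' | h'
    · rw [show j + 1 = β + k from h', hβ']
      simp
    · rw [h (j + 1) (by omega) h']

/-- A solution of the equations is reproduced by the row recursion. -/
theorem sweep_solution {s : ℕ → ℕ → ℝ} (hα : b α = 0) (hβ : b β = 0)
    (hβ' : b (β + k) = 0) (hb : ∀ i, α < i → i < α + m → b i ≠ 0)
    (hs : ∀ i j, α ≤ i → i < α + m → β ≤ j → j < β + k → triLyap a b s i j = c i j) (i : ℕ) :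
    i < m → ∀ j, β ≤ j → j < β + k → sweep a b α m β k c (s α) (i + 1) j = s (α + i) j := by
  induction i using Nat.strong_induction_on with
  | _ i ih =>
    intro hi j hj hj'
    match i with
    | 0 => simp [sweep, hj, hj']
    | i + 1 =>
      rw [sweep, if_pos ⟨hj, hj'⟩, if_pos hi]
      have e := hs (α + i) j (by omega) (by omega) hj hj'
      have h1 := ih i (by omega) (by omega)
      obtain ⟨n1, n2⟩ := mul_neighbour_congr hβ hβ' h1 hj hj'
      -- The recursion starts from a zero row in place of row `α - 1`; the factor `b α = 0` makes
      -- this harmless.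
      have n3 : b (α + i) * sweep a b α m β k c (s α) i j = b (α + i) * s (α + i - 1) j := by
        match i with
        | 0 => simp [hα]
        | i + 1 => rw [ih i (by omega) (by omega) j hj hj']; rfl
      rw [n1, n2, n3, h1 j hj hj', div_eq_iff (hb _ (by omega) (by omega)), ← e, triLyap,
        ← add_assoc α i 1]
      ring

/-- In the last row of the rectangle `b (α + m) = 0` removes the next row from the equation. What
the recursion then computes, with divisor `1`, is the defect of this equation, which is zero for a
true solution. -/
theorem sweep_residual {s : ℕ → ℕ → ℝ} (hm : 0 < m) (hα : b α = 0) (hα' : b (α + m) = 0)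
    (hβ : b β = 0) (hβ' : b (β + k) = 0) (hb : ∀ i, α < i → i < α + m → b i ≠ 0)
    (hs : ∀ i j, α ≤ i → i < α + m → β ≤ j → j < β + k → triLyap a b s i j = c i j)
    (j : ℕ) : sweep a b α m β k c (s α) (m + 1) j = 0 := by
  by_cases hJ : β ≤ j ∧ j < β + k
  · obtain ⟨hj, hj'⟩ := hJ
    obtain ⟨i, rfl⟩ : ∃ i, m = i + 1 := ⟨m - 1, by omega⟩
    rw [sweep, if_pos ⟨hj, hj'⟩, if_neg (lt_irrefl _)]
    have e := hs (α + i) j (by omega) (by omega) hj hj'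
    have h1 := sweep_solution hα hβ hβ' hb hs i (by omega)
    obtain ⟨n1, n2⟩ := mul_neighbour_congr hβ hβ' h1 hj hj'
    have n3 : b (α + i) * sweep a b α (i + 1) β k c (s α) i j = b (α + i) * s (α + i - 1) j := by
      match i with
      | 0 => simp [hα]
      | i + 1 => rw [sweep_solution hα hβ hβ' hb hs i (by omega) j hj hj']; rfl
    rw [n1, n2, n3, h1 j hj hj', ← e, triLyap, show α + i + 1 = α + (i + 1) from rfl, hα']
    ring
  · exact sweep_of_not _ hJ

/-- The rows computed by the recursion, at their positions, and zeros elsewhere. -/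
noncomputable def sweepRows (a b : ℕ → ℝ) (α m β k : ℕ) (σ : ℕ → ℝ) (i j : ℕ) : ℝ :=
  if α ≤ i ∧ i < α + m then sweep a b α m β k (fun _ _ => 0) σ (i - α + 1) j else 0

/-- Since `b` vanishes at the four borders, the rectangle is decoupled from its surroundings. A
homogeneous sweep with zero residual, extended by zeros, therefore solves the homogeneous equations
everywhere. -/
theorem triLyap_sweepRows (hα : b α = 0) (hα' : b (α + m) = 0)
    (hβ : b β = 0) (hβ' : b (β + k) = 0) (hb : ∀ i, α < i → i < α + m → b i ≠ 0)
    (hres : ∀ j, β ≤ j → j < β + k → sweep a b α m β k (fun _ _ => 0) σ (m + 1) j = 0)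
    (i j : ℕ) : triLyap a b (sweepRows a b α m β k σ) i j = 0 := by
  set y := sweepRows a b α m β k σ with hy
  have yI : ∀ i j, ¬ (α ≤ i ∧ i < α + m) → y i j = 0 := fun i j h => by
    simp [hy, sweepRows, h]
  have yJ : ∀ i j, ¬ (β ≤ j ∧ j < β + k) → y i j = 0 := fun i j h => by
    simp only [hy, sweepRows, sweep_of_not _ h, ite_self]
  have yr : ∀ r j, r < m → y (α + r) j = sweep a b α m β k (fun _ _ => 0) σ (r + 1) j :=
    fun r j hr => by
      simp [hy, sweepRows, hr]
  by_cases hJ : β ≤ j ∧ j < β + k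
  · by_cases hI : α ≤ i ∧ i < α + m
    · obtain ⟨r, rfl⟩ := Nat.exists_eq_add_of_le hI.1
      have hr : r < m := by omega
      have e3 : b (α + r) * y (α + r - 1) j =
          b (α + r) * sweep a b α m β k (fun _ _ => 0) σ r j := by
        match r with
        | 0 => simp [hα]
        | r + 1 => rw [← yr r j (by omega)]; rfl
      have e4 : b (α + r + 1) * y (α + r + 1) j =
          (if r + 1 < m then b (α + r + 1) else 1) *
            sweep a b α m β k (fun _ _ => 0) σ (r + 2) j := by
        split_ifs with h
        · rw [add_assoc, yr (r + 1) j h]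
        · have : r + 1 = m := by omega
          subst this
          rw [hres j hJ.1 hJ.2, show α + r + 1 = α + (r + 1) from rfl, hα']
          simp
      rw [triLyap, e3, e4, yr r _ hr, yr r _ hr, yr r _ hr, sweep, if_pos hJ,
        mul_div_cancel₀]
      · ring
      · split_ifs with h
        · exact hb _ (by omega) (by omega)
        · exact one_ne_zero
    · have h1 : b i * y (i - 1) j = 0 := by
        by_cases h : α ≤ i - 1 ∧ i - 1 < α + m
        · rw [show i = α + m by omega, hα', zero_mul]
        · rw [yI _ _ h, mul_zero]
      have h2 : b (i + 1) * y (i + 1) j = 0 := by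
        by_cases h : α ≤ i + 1 ∧ i + 1 < α + m
        · rw [show i + 1 = α by omega, hα, zero_mul]
        · rw [yI _ _ h, mul_zero]
      rw [triLyap, h1, h2, yI i _ hI, yI i _ hI, yI i _ hI]
      ring
  · have h1 : b j * y i (j - 1) = 0 := by
      by_cases h : β ≤ j - 1 ∧ j - 1 < β + k
      · rw [show j = β + k by omega, hβ', zero_mul]
      · rw [yJ _ _ h, mul_zero]
    have h2 : b (j + 1) * y i (j + 1) = 0 := by
      by_cases h : β ≤ j + 1 ∧ j + 1 < β + k
      · rw [show j + 1 = β by omega, hβ, zero_mul]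
      · rw [yJ _ _ h, mul_zero]
    rw [triLyap, h1, h2, yJ _ _ hJ, yJ _ _ hJ, yJ _ _ hJ]
    ring

/-- The homogeneous equations on the `p × p` grid have only the trivial solution. -/
def TriNonsingular (p : ℕ) (a b : ℕ → ℝ) : Prop :=
  ∀ y : ℕ → ℕ → ℝ, (∀ i j, p ≤ i ∨ p ≤ j → y i j = 0) → (∀ i j, triLyap a b y i j = 0) →
    ∀ i j, y i j = 0

/-- The matrix that maps the first row of the rectangle to the residual of the recursion. -/
noncomputable def sweepMatrix (a b : ℕ → ℝ) (α m β k : ℕ) : Matrix (Fin k) (Fin k) ℝ :=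
  Matrix.of fun j q => sweep a b α m β k (fun _ _ => 0) (unitRow β q) (m + 1) (β + j)

/-- A kernel vector is a first row with zero residual. It generates a homogeneous solution on the
whole grid, which vanishes by nonsingularity, and the kernel vector can be read off from row `α` of
it. -/
theorem isUnit_det_sweepMatrix (hp : TriNonsingular p a b) (hm : 0 < m) (hmp : α + m ≤ p)
    (hkp : β + k ≤ p) (hα : b α = 0) (hα' : b (α + m) = 0)
    (hβ : b β = 0) (hβ' : b (β + k) = 0) (hb : ∀ i, α < i → i < α + m → b i ≠ 0) :
    IsUnit (sweepMatrix a b α m β k).det := by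
  refine isUnit_det_of_mulVec_eq_zero fun x hx => ?_
  let σ : ℕ → ℝ := fun j => if h : β ≤ j ∧ j < β + k then x ⟨j - β, by omega⟩ else 0
  have hσ : ∀ q : Fin k, σ (β + q) = x q := fun q => by simp [σ]
  have hres : ∀ j, β ≤ j → j < β + k → sweep a b α m β k (fun _ _ => 0) σ (m + 1) j = 0 := by
    intro j hj hj'
    rw [sweep_eq]
    have h0 : sweep a b α m β k (fun _ _ => 0) 0 (m + 1) j = 0 := by
      have := sweep_smul (a := a) (b := b) (α := α) (m := m) (β := β) (k := k) (σ := 0) 0 (m + 1) j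
      simpa [Pi.zero_def] using this
    rw [h0, zero_add, ← Fin.sum_univ_eq_sum_range
      (fun q => sweep a b α m β k (fun _ _ => 0) (unitRow β q) (m + 1) j * σ (β + q))]
    have := congrFun hx ⟨j - β, by omega⟩
    simp only [Matrix.mulVec, dotProduct, sweepMatrix, Matrix.of_apply, Pi.zero_apply,
      show β + (j - β) = j by omega] at this
    simp only [hσ]
    exact this
  have h0 := hp _ ?_ (triLyap_sweepRows hα hα' hβ hβ' hb hres)
  · ext q
    have := h0 α (β + q)
    simp only [sweepRows, le_refl, true_and, Nat.lt_add_right_iff_pos, hm, if_true, Nat.sub_self,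
      zero_add, sweep, Nat.le_add_right, add_lt_add_iff_left, q.2, hσ] at this
    simpa using this
  · intro i j hij
    rcases hij with h | h
    · rw [sweepRows, if_neg (by omega)]
    · rw [sweepRows, sweep_of_not _ (by omega), ite_self]

/-- The residual is an affine function of the first row with invertible linear part, and it vanishes
at the true first row. -/
theorem first_row_eq {s : ℕ → ℕ → ℝ} (hp : TriNonsingular p a b) (hm : 0 < m) (hmp : α + m ≤ p)
    (hkp : β + k ≤ p) (hα : b α = 0) (hα' : b (α + m) = 0)
    (hβ : b β = 0) (hβ' : b (β + k) = 0) (hb : ∀ i, α < i → i < α + m → b i ≠ 0)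
    (hs : ∀ i j, α ≤ i → i < α + m → β ≤ j → j < β + k → triLyap a b s i j = c i j) :
    (fun q : Fin k => s α (β + q)) = -((sweepMatrix a b α m β k)⁻¹ *ᵥ
      fun j => sweep a b α m β k c 0 (m + 1) (β + j)) := by
  have hu := isUnit_det_sweepMatrix hp hm hmp hkp hα hα' hβ hβ' hb
  have h1 : sweepMatrix a b α m β k *ᵥ (fun q : Fin k => s α (β + q)) =
      -fun j : Fin k => sweep a b α m β k c 0 (m + 1) (β + j) := by
    ext j
    have := sweep_residual hm hα hα' hβ hβ' hb hs (β + j)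
    rw [sweep_eq, ← Fin.sum_univ_eq_sum_range (fun q =>
      sweep a b α m β k (fun _ _ => 0) (unitRow β q) (m + 1) (β + j) * s α (β + q))] at this
    simp only [Matrix.mulVec, dotProduct, sweepMatrix, Matrix.of_apply, Pi.neg_apply]
    linarith
  rw [← Matrix.mulVec_neg, ← h1, Matrix.mulVec_mulVec, Matrix.nonsing_inv_mul _ hu,
    Matrix.one_mulVec]

end Tridiagonal

/-! ### Cost of solving tridiagonal Lyapunov equations. -/

section TridiagonalCost

variable {Ω : Type} {D : Set Ω} {S : Set (Ω → ℝ)} {T T₁ T₂ p : ℕ} {a b : Ω → ℕ → ℝ}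
  {c s : Ω → ℕ → ℕ → ℝ}

/-- Quantities that are already available or identically zero on the domain are free. The families
describing a sweep have infinitely many members, but only those inside the rectangle require work.
-/
theorem Gen.collect {Q Q' : Set (Ω → ℝ)} (h : Gen D S T Q)
    (hQ : ∀ q ∈ Q', Known D S q ∨ Known D Q q ∨ ∀ ω ∈ D, q ω = 0) : Gen D S T Q' := by
  refine ((h.union (Gen.const 0)).bind (.of_known fun q hq => ?_)).le (T := T + 0 + 0) (by simp)
  rcases hQ q hq with h | h | h
  · exact h.mono subset_rfl Set.subset_union_left
  · exact h.mono subset_rfl fun q hq => .inr (.inl hq)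
  · exact ⟨_, .inr (.inr rfl), by simpa using h⟩

/-- Each entry needs a bounded number of operations on the two previous rows, and a row has only `k`
entries that are not trivially zero. -/
theorem Gen.sweep (ha : ∀ i, Gen D S 0 {fun ω => a ω i}) (hb : ∀ i, Gen D S 0 {fun ω => b ω i})
    (hc : ∀ i j, Gen D S 0 {fun ω => c ω i j}) {σ : Ω → ℕ → ℝ}
    (hσ : ∀ j, Gen D S 0 {fun ω => σ ω j}) (α m β k i : ℕ) :
    Gen D S (i * (k * 11) + k) {q | ∃ i' ≤ i + 1, ∃ j, q = fun ω =>
      SketchedFDA.sweep (a ω) (b ω) α m β k (c ω) (σ ω) i' j} := by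
  induction i with
  | zero =>
    refine (Gen.biUnion (t := Finset.Ico β (β + k)) (T := fun _ => 1)
      (fun j _ => (hσ j).le zero_le_one)).collect ?_ |>.le (by simp)
    rintro q ⟨i, hi, j, rfl⟩
    by_cases h : β ≤ j ∧ j < β + k
    · rcases Nat.le_one_iff_eq_zero_or_eq_one.1 hi with rfl | rfl
      · exact .inr (.inr fun ω _ => by simp [SketchedFDA.sweep])
      · refine .inr (.inl ⟨fun ω => σ ω j, ?_, fun ω _ => by simp [SketchedFDA.sweep, h]⟩)
        simp only [Set.mem_iUnion]
        exact ⟨j, Finset.mem_Ico.2 h, rfl⟩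
    · right; right
      intro ω _
      exact sweep_of_not _ h
  | succ i ih =>
    rw [show (i + 1) * (k * 11) + k = i * (k * 11) + k + k * 11 by ring]
    refine ih.bind ?_
    set S' := S ∪ {q | ∃ i' ≤ i + 1, ∃ j, q = fun ω =>
      SketchedFDA.sweep (a ω) (b ω) α m β k (c ω) (σ ω) i' j} with hS'
    have hS : S ⊆ S' := Set.subset_union_left
    have hw : ∀ i' ≤ i + 1, ∀ j, Gen D S' 0 {fun ω =>
        SketchedFDA.sweep (a ω) (b ω) α m β k (c ω) (σ ω) i' j} := fun i' hi' j =>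
      .of_mem (.inr ⟨i', hi', j, rfl⟩)
    have key : ∀ j ∈ Finset.Ico β (β + k), Gen D S' 11 {fun ω =>
        SketchedFDA.sweep (a ω) (b ω) α m β k (c ω) (σ ω) (i + 2) j} := by
      intro j hj
      rw [Finset.mem_Ico] at hj
      have ha' := fun i => (ha i).mono subset_rfl hS
      have hb' := fun i => (hb i).mono subset_rfl hS
      have hden : Gen D S' 0 {fun ω => if i + 1 < m then b ω (α + i + 1) else 1} := by
        split_ifs
        · exact hb' _
        · simpa using Gen.const (D := D) (S := S') 1
      refine ((((((((hc (α + i) j).mono subset_rfl hS).sub (((ha' (α + i)).add (ha' j)).mul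
        (hw (i + 1) le_rfl j))).sub ((hb' j).mul (hw (i + 1) le_rfl (j - 1)))).sub
        ((hb' (j + 1)).mul (hw (i + 1) le_rfl (j + 1)))).sub ((hb' (α + i)).mul
        (hw i (by omega) j))).div hden).le (T' := 11) (by simp)).congr fun ω _ => ?_
      rw [SketchedFDA.sweep, if_pos hj]
    refine ((Gen.biUnion key).le (by simp)).collect ?_
    rintro q ⟨i', hi', j, rfl⟩
    by_cases hle : i' ≤ i + 1
    · exact .inl (.of_mem (.inr ⟨i', hle, j, rfl⟩))
    · have : i' = i + 2 := by omega
      subst this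
      by_cases h : β ≤ j ∧ j < β + k
      · refine .inr (.inl (.of_mem ?_))
        simp only [Set.mem_iUnion]
        exact ⟨j, Finset.mem_Ico.2 h, rfl⟩
      · exact .inr (.inr fun ω _ => sweep_of_not _ h)

/-- The entries of `s` on `[α, α + m) × [β, β + k)`. -/
def rect (s : Ω → ℕ → ℕ → ℝ) (α m β k : ℕ) : Set (Ω → ℝ) :=
  {q | ∃ i j, α ≤ i ∧ i < α + m ∧ β ≤ j ∧ j < β + k ∧ q = fun ω => s ω i j}

/-- One homogeneous sweep per unit row yields the `k × k` matrix of the residuals, and one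
inhomogeneous sweep their constant part; inverting the matrix gives the first row, and a last sweep
the solution. The sweeps run along the longer side (`k ≤ m`), so that building and inverting the
matrix, of orders `mk²` and `k³`, stay within `O(p·mk)`. -/
theorem Gen.rect_unreduced (hp : ∀ ω ∈ D, TriNonsingular p (a ω) (b ω))
    (ha : ∀ i, Gen D S 0 {fun ω => a ω i}) (hb : ∀ i, Gen D S 0 {fun ω => b ω i})
    (hc : ∀ i j, Gen D S 0 {fun ω => c ω i j})
    (hs : ∀ ω ∈ D, ∀ i j, i < p → j < p → triLyap (a ω) (b ω) (s ω) i j = c ω i j)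
    {α m β k : ℕ} (hm : 0 < m) (hkm : k ≤ m) (hmp : α + m ≤ p) (hkp : β + k ≤ p)
    (hα : ∀ ω ∈ D, b ω α = 0) (hα' : ∀ ω ∈ D, b ω (α + m) = 0)
    (hβ : ∀ ω ∈ D, b ω β = 0) (hβ' : ∀ ω ∈ D, b ω (β + k) = 0)
    (hne : ∀ i, α < i → i < α + m → ∀ ω ∈ D, b ω i ≠ 0) :
    Gen D S (88 * (p * (m * k))) (rect s α m β k) := by
  have h0 : ∀ S, Gen D S 0 {fun _ : Ω => (0 : ℝ)} := fun S => by
    simpa using Gen.const (D := D) (S := S) 0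
  have hA : Gen D S (k * (m * (k * 11) + k))
      (entries fun ω => sweepMatrix (a ω) (b ω) α m β k) := by
    refine Gen.matTranspose (A := fun ω => (sweepMatrix (a ω) (b ω) α m β k)ᵀ) ?_
    refine Gen.of_rows fun q => ?_
    have := Gen.sweep (c := fun _ _ _ => 0) ha hb (fun _ _ => h0 S) (σ := fun _ => unitRow β q)
      (fun j => by
        by_cases h : j = β + q
        · simpa [unitRow, h] using Gen.const (D := D) (S := S) 1
        · simpa [unitRow, h] using h0 S) α m β k m
    refine this.subset ?_
    rintro _ ⟨j, rfl⟩
    exact ⟨m + 1, le_rfl, β + j, rfl⟩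
  have hw : Gen D S (m * (k * 11) + k)
      (coords fun ω (j : Fin k) => SketchedFDA.sweep (a ω) (b ω) α m β k (c ω) 0 (m + 1) (β + j)) := by
    refine (Gen.sweep ha hb hc (σ := fun _ => 0) (fun j => h0 S) α m β k m).subset ?_
    rintro _ ⟨j, rfl⟩
    exact ⟨m + 1, le_rfl, β + j, rfl⟩
  have hAi := hA.inv fun ω hω => isUnit_det_sweepMatrix (hp ω hω) hm hmp hkp (hα ω hω) (hα' ω hω)
    (hβ ω hω) (hβ' ω hω) fun i h1 h2 => hne i h1 h2 ω hω
  have hx := hAi.mulVec hw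
  have hσ := ((Gen.const (-1)).vecSmul hx).coords_congr (f' := fun ω (q : Fin k) => s ω α (β + q))
    fun ω hω => by
      rw [first_row_eq (hp ω hω) hm hmp hkp (hα ω hω) (hα' ω hω)
        (hβ ω hω) (hβ' ω hω) (fun i h1 h2 => hne i h1 h2 ω hω)
        (fun i j _ h1 _ h2 => hs ω hω i j (by omega) (by omega))]
      simp
  refine (hσ.bind (T₂ := m * (k * 11) + k) ?_).le ?_
  · set S' := S ∪ coords fun ω (q : Fin k) => s ω α (β + q)
    have hS : S ⊆ S' := Set.subset_union_left
    -- Only the entries of the first row inside the rectangle have been computed, and the sweep does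
    -- not look at any others.
    let σ : Ω → ℕ → ℝ := fun ω j => if β ≤ j ∧ j < β + k then s ω α j else 0
    have := Gen.sweep (fun i => (ha i).mono subset_rfl hS) (fun i => (hb i).mono subset_rfl hS)
      (fun i j => (hc i j).mono subset_rfl hS) (σ := σ) (fun j => by
        by_cases h : β ≤ j ∧ j < β + k
        · simp only [σ, h, and_self, if_true]
          refine .of_mem (.inr ⟨⟨j - β, by omega⟩, ?_⟩)
          simp [h.1]
        · simpa only [σ, h, if_false] using h0 S') α m β k m
    refine this.known ?_
    rintro _ ⟨i, j, h1, h2, h3, h4, rfl⟩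
    refine ⟨_, ⟨i - α + 1, by omega, j, rfl⟩, fun ω hω => ?_⟩
    have := sweep_solution (hα ω hω) (hβ ω hω) (hβ' ω hω) (fun i h1 h2 => hne i h1 h2 ω hω)
      (fun i j _ h1 _ h2 => hs ω hω i j (by omega) (by omega)) (i - α) (by omega) j h3 h4
    rw [show α + (i - α) = i by omega] at this
    beta_reduce
    rw [← this]
    refine sweep_congr (fun j h h' => ?_) _ _
    simp [σ, h, h']
  · simp only [Fintype.card_fin]
    have h1 : k * k * k ≤ p * (m * k) := by
      calc k * k * k = k * (k * k) := by ring
        _ ≤ p * (m * k) := Nat.mul_le_mul (by omega) (Nat.mul_le_mul hkm le_rfl)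
    have h2 : m * (k * k) ≤ p * (m * k) := by
      calc m * (k * k) = k * (m * k) := by ring
        _ ≤ p * (m * k) := Nat.mul_le_mul (by omega) le_rfl
    have h3 : k * k ≤ p * (m * k) := by
      calc k * k ≤ m * k := Nat.mul_le_mul hkm le_rfl
        _ ≤ p * (m * k) := Nat.le_mul_of_pos_left _ (by omega)
    have h4 : m * k ≤ p * (m * k) := Nat.le_mul_of_pos_left _ (by omega)
    have h5 : k ≤ p * (m * k) := (Nat.le_mul_of_pos_left _ hm).trans h4
    nlinarith

theorem rect_split_left {s : Ω → ℕ → ℕ → ℝ} {α m β k i : ℕ} (h : α ≤ i) (h' : i ≤ α + m) :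
    rect s α m β k ⊆ rect s α (i - α) β k ∪ rect s i (α + m - i) β k := by
  rintro _ ⟨i', j, h1, h2, h3, h4, rfl⟩
  by_cases hi : i' < i
  · exact .inl ⟨i', j, h1, by omega, h3, h4, rfl⟩
  · exact .inr ⟨i', j, by omega, by omega, h3, h4, rfl⟩

theorem rect_split_right {s : Ω → ℕ → ℕ → ℝ} {α m β k j : ℕ} (h : β ≤ j) (h' : j ≤ β + k) :
    rect s α m β k ⊆ rect s α m β (j - β) ∪ rect s α m j (β + k - j) := by
  rintro _ ⟨i, j', h1, h2, h3, h4, rfl⟩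
  by_cases hi : j' < j
  · exact .inl ⟨i, j', h1, h2, h3, by omega, rfl⟩
  · exact .inr ⟨i, j', h1, h2, by omega, by omega, rfl⟩

/-- Tridiagonal Lyapunov equations with a known pattern of nonzero off-diagonal entries. -/
theorem Gen.rect_of_pattern (hp : ∀ ω ∈ D, TriNonsingular p (a ω) (b ω))
    (ha : ∀ i, Gen D S 0 {fun ω => a ω i}) (hb : ∀ i, Gen D S 0 {fun ω => b ω i})
    (hc : ∀ i j, Gen D S 0 {fun ω => c ω i j})
    (hs : ∀ ω ∈ D, ∀ i j, i < p → j < p → triLyap (a ω) (b ω) (s ω) i j = c ω i j)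
    (hpat : ∀ i, (∀ ω ∈ D, b ω i = 0) ∨ ∀ ω ∈ D, b ω i ≠ 0) (N : ℕ) :
    ∀ α m β k : ℕ, m + k ≤ N → α + m ≤ p → β + k ≤ p → (∀ ω ∈ D, b ω α = 0) →
      (∀ ω ∈ D, b ω (α + m) = 0) → (∀ ω ∈ D, b ω β = 0) → (∀ ω ∈ D, b ω (β + k) = 0) →
      Gen D S (88 * (p * (m * k))) (rect s α m β k) := by
  induction N with
  | zero =>
    intro α m β k hN _ _ _ _ _ _
    refine (Gen.of_subset ?_).le (Nat.zero_le _)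
    rintro _ ⟨i, j, h1, h2, h3, h4, rfl⟩
    omega
  | succ N ih =>
    intro α m β k hN hmp hkp hα hα' hβ hβ'
    by_cases hmk : m = 0 ∨ k = 0
    · refine (Gen.of_subset ?_).le (Nat.zero_le _)
      rintro _ ⟨i, j, h1, h2, h3, h4, rfl⟩
      omega
    -- A vanishing off-diagonal entry cuts the rectangle in two. The bound is proportional to `m *
    -- k`, so the costs of the pieces add up exactly.
    by_cases hI : ∃ i, α < i ∧ i < α + m ∧ ∀ ω ∈ D, b ω i = 0
    · obtain ⟨i, h1, h2, h3⟩ := hI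
      refine (((ih α (i - α) β k (by omega) (by omega) hkp hα
        (by rwa [show α + (i - α) = i by omega]) hβ hβ').union
        (ih i (α + m - i) β k (by omega) (by omega) hkp h3
        (by rwa [show i + (α + m - i) = α + m by omega]) hβ hβ')).subset
        (rect_split_left h1.le h2.le)).le ?_
      obtain ⟨u, rfl⟩ := Nat.exists_eq_add_of_le h1.le
      obtain ⟨v, hv⟩ := Nat.exists_eq_add_of_le h2.le
      obtain rfl : m = u + v := by omega
      rw [show α + u - α = u by omega, show α + (u + v) - (α + u) = v by omega]
      apply le_of_eq; ring
    by_cases hJ : ∃ j, β < j ∧ j < β + k ∧ ∀ ω ∈ D, b ω j = 0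
    · obtain ⟨j, h1, h2, h3⟩ := hJ
      refine (((ih α m β (j - β) (by omega) hmp (by omega) hα hα' hβ
        (by rwa [show β + (j - β) = j by omega])).union
        (ih α m j (β + k - j) (by omega) hmp (by omega) hα hα' h3
        (by rwa [show j + (β + k - j) = β + k by omega]))).subset
        (rect_split_right h1.le h2.le)).le ?_
      obtain ⟨u, rfl⟩ := Nat.exists_eq_add_of_le h1.le
      obtain ⟨v, hv⟩ := Nat.exists_eq_add_of_le h2.le
      obtain rfl : k = u + v := by omega
      rw [show β + u - β = u by omega, show β + (u + v) - (β + u) = v by omega]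
      apply le_of_eq; ring
    push Not at hI hJ
    -- No interior entry vanishes identically, so by the known pattern each is nowhere zero. If the
    -- columns form the longer side, the transposed equations are solved instead.
    rcases le_total k m with h | h
    · refine Gen.rect_unreduced hp ha hb hc hs (by omega) h hmp hkp hα hα' hβ hβ'
        fun i h1 h2 => (hpat i).resolve_left fun h => ?_
      obtain ⟨ω, hω, hne⟩ := hI i h1 h2
      exact hne (h ω hω)
    · have := Gen.rect_unreduced (s := fun ω i j => s ω j i) (c := fun ω i j => c ω j i) hp ha hb
        (fun i j => hc j i)
        (fun ω hω i j hi hj => by rw [triLyap_swap]; exact hs ω hω j i hj hi)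
        (by omega) h hkp hmp hβ hβ' hα hα' fun i h1 h2 => (hpat i).resolve_left fun h => by
          obtain ⟨ω, hω, hne⟩ := hJ i h1 h2
          exact hne (h ω hω)
      rw [mul_comm m k]
      refine this.subset ?_
      rintro _ ⟨i, j, h1, h2, h3, h4, rfl⟩
      exact ⟨j, i, h3, h4, h1, h2, rfl⟩

/-- Branching until it is known which of finitely many quantities are zero. -/
theorem Gen.of_pattern {Q : Set (Ω → ℝ)} (hb : ∀ i, Gen D S 0 {fun ω => b ω i}) (n : ℕ) :
    ∀ D₀ ⊆ D, (∀ D' ⊆ D₀, (∀ i < n, (∀ ω ∈ D', b ω i = 0) ∨ ∀ ω ∈ D', b ω i ≠ 0) → Gen D' S T Q) →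
      Gen D₀ S (T + 2 * n) Q := by
  induction n with
  | zero => exact fun D₀ _ h => h D₀ subset_rfl (by simp)
  | succ n ih =>
    intro D₀ hD₀ h
    have hbn : ∀ D' ⊆ D, Gen D' S 0 {fun ω => b ω n} := fun D' hD' => (hb n).mono hD' subset_rfl
    have h0 : ∀ D', Gen D' S 0 {fun _ : Ω => (0 : ℝ)} := fun D' => by
      simpa using Gen.const (D := D') (S := S) 0
    have key : ∀ D₁ ⊆ D₀, ((∀ ω ∈ D₁, b ω n = 0) ∨ ∀ ω ∈ D₁, b ω n ≠ 0) →
        Gen D₁ S (T + 2 * n) Q := by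
      intro D₁ hD₁ hn
      refine ih D₁ (hD₁.trans hD₀) fun D' hD' hi => h D' (hD'.trans hD₁) fun i hin => ?_
      rcases Nat.lt_succ_iff_lt_or_eq.1 hin with h | rfl
      · exact hi i h
      · exact hn.imp (fun h ω hω => h ω (hD' hω)) fun h ω hω => h ω (hD' hω)
    -- Two comparisons, `b ≤ 0` and `0 ≤ b`, decide whether the entry is zero. The number of leaves
    -- is exponential in `n`, but only the length of a path counts.
    refine ((hbn D₀ hD₀).branch (h0 D₀) (T₃ := T + 2 * n + 1) (T₄ := T + 2 * n) ?_ ?_).le ?_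
    · refine ((h0 _).branch (hbn _ (Set.inter_subset_left.trans hD₀)) (T₃ := T + 2 * n)
        (T₄ := T + 2 * n) ?_ ?_).le (by simp)
      · refine key _ (Set.inter_subset_left.trans Set.inter_subset_left) (.inl fun ω hω => ?_)
        exact le_antisymm hω.1.2 hω.2
      · refine key _ (Set.inter_subset_left.trans Set.inter_subset_left) (.inr fun ω hω => ?_)
        exact ne_of_lt hω.2
    · refine key _ Set.inter_subset_left (.inr fun ω hω => ?_)
      exact ne_of_gt hω.2
    · simp only [zero_add]
      rw [max_eq_left (by omega)]
      omega

end TridiagonalCost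

end SketchedFDA

namespace SketchedFDA

/-! ### Lyapunov equations -/

section Lyapunov

variable {p : ℕ}

/-- The diagonal of a matrix, extended by zeros. -/
noncomputable def diagExt (H : Matrix (Fin p) (Fin p) ℝ) (i : ℕ) : ℝ :=
  if h : i < p then H ⟨i, h⟩ ⟨i, h⟩ else 0

/-- The subdiagonal of a matrix, extended by zeros. -/
noncomputable def offExt (H : Matrix (Fin p) (Fin p) ℝ) (i : ℕ) : ℝ :=
  if h : 0 < i ∧ i < p then H ⟨i, h.2⟩ ⟨i - 1, by omega⟩ else 0

/-- A vector, extended by zeros. -/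
noncomputable def vecExt (v : Fin p → ℝ) (i : ℕ) : ℝ := if h : i < p then v ⟨i, h⟩ else 0

/-- A matrix, extended by zeros. -/
noncomputable def matExt (X : Matrix (Fin p) (Fin p) ℝ) (i j : ℕ) : ℝ :=
  if h : i < p ∧ j < p then X ⟨i, h.1⟩ ⟨j, h.2⟩ else 0

/-- A symmetric Hessenberg matrix is tridiagonal. Extending the subdiagonal by zeros makes the
three-term formula valid in the first and last rows too. -/
theorem tridiagonal_row_sum {H : Matrix (Fin p) (Fin p) ℝ} (hs : Hᵀ = H)
    (hh : ∀ i j : Fin p, j.val + 1 < i → H i j = 0) (v : Fin p → ℝ) (i : Fin p) :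
    ∑ k, H i k * v k = offExt H i * vecExt v (i - 1) + diagExt H i * vecExt v i +
      offExt H (i + 1) * vecExt v (i + 1) := by
  have hsym : ∀ i j, H i j = H j i := fun i j => congrFun (congrFun hs j) i
  have h1 : ∀ k : Fin p, H i k * v k =
      ((if k.val + 1 = i then offExt H i * vecExt v (i - 1) else 0) +
      (if k.val = i then diagExt H i * vecExt v i else 0)) +
      (if k.val = i + 1 then offExt H (i + 1) * vecExt v (i + 1) else 0) := by
    intro k
    rcases lt_trichotomy (k.val + 1) i.val with h | h | h
    · rw [hh i k h, if_neg (by omega), if_neg (by omega), if_neg (by omega)]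
      ring
    · rw [if_pos h, if_neg (by omega), if_neg (by omega)]
      have hk : (⟨i.val - 1, by omega⟩ : Fin p) = k := Fin.ext (by simp; omega)
      simp [offExt, vecExt, show 0 < i.val by omega, show i.val - 1 < p by omega, hk]
    · rcases lt_trichotomy k.val i.val with h' | h' | h'
      · omega
      · rw [if_neg (by omega), if_pos h', if_neg (by omega)]
        have hk : k = i := Fin.ext h'
        simp [diagExt, vecExt, hk]
      · rcases (Nat.succ_le_of_lt h').eq_or_lt with h2 | h2
        · have h2 : k.val = i.val + 1 := h2.symm
          rw [if_neg (by omega), if_neg (by omega), if_pos h2]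
          have hk : (⟨i.val + 1, by omega⟩ : Fin p) = k := Fin.ext h2.symm
          simp [offExt, vecExt, show i.val + 1 < p by omega, hk, hsym i k]
        · rw [hsym i k, hh k i h2, if_neg (by omega), if_neg (by omega),
            if_neg (by have : i.val + 1 < k.val := h2; omega)]
          ring
  rw [Finset.sum_congr rfl fun k _ => h1 k, Finset.sum_add_distrib, Finset.sum_add_distrib]
  congr 1
  · congr 1
    · by_cases hi : 0 < i.val
      · rw [Finset.sum_eq_single (⟨i.val - 1, by omega⟩ : Fin p)]
        · rw [if_pos (by simp; omega)]
        · intro b _ hb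
          rw [if_neg]
          intro h
          exact hb (Fin.ext (by simp; omega))
        · simp
      · rw [Finset.sum_eq_zero fun k _ => if_neg (by omega), offExt, dif_neg (by omega), zero_mul]
    · rw [Finset.sum_eq_single i]
      · simp
      · intro b _ hb
        rw [if_neg fun h => hb (Fin.ext h)]
      · simp
  · by_cases hi : i.val + 1 < p
    · rw [Finset.sum_eq_single (⟨i.val + 1, hi⟩ : Fin p)]
      · rw [if_pos rfl]
      · intro b _ hb
        rw [if_neg fun h => hb (Fin.ext h)]
      · simp
    · rw [Finset.sum_eq_zero fun k _ => if_neg (by omega), offExt, dif_neg (by omega), zero_mul]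

theorem triLyap_ext {H : Matrix (Fin p) (Fin p) ℝ} (hs : Hᵀ = H)
    (hh : ∀ i j : Fin p, j.val + 1 < i → H i j = 0) (X : Matrix (Fin p) (Fin p) ℝ) (i j : Fin p) :
    triLyap (diagExt H) (offExt H) (matExt X) i j = (H * X + X * H) i j := by
  have e1 := tridiagonal_row_sum hs hh (fun k => X k j) i
  have e2 := tridiagonal_row_sum hs hh (fun k => X i k) j
  have hsym : ∀ i j, H i j = H j i := fun i j => congrFun (congrFun hs j) i
  rw [Matrix.add_apply, Matrix.mul_apply, Matrix.mul_apply, e1,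
    Finset.sum_congr rfl fun k _ => by rw [mul_comm (X i k), hsym k j], e2, triLyap]
  simp [matExt, vecExt]

/-- For positive definite `K`, the Lyapunov operator `X ↦ K X + X K` is injective. -/
theorem eq_zero_of_lyapunov {ι : Type*} [Fintype ι] {K X : Matrix ι ι ℝ} (hK : K.PosDef)
    (h : K * X + X * K = 0) : X = 0 := by
  classical
  -- Pairing the equation with `X` gives two nonnegative traces with sum zero; the first one then
  -- forces every column of `X` to vanish.
  have h1 : (Xᵀ * K * X).trace + (X * K * Xᵀ).trace = 0 := by
    have := congrArg (fun Y => (Xᵀ * Y).trace) h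
    simp only [Matrix.mul_add, Matrix.trace_add, Matrix.mul_zero, Matrix.trace_zero] at this
    rw [← this, Matrix.mul_assoc, Matrix.trace_mul_comm (X * K)]
  have h2 : (Xᵀ * K * X).PosSemidef := by
    simpa using hK.posSemidef.conjTranspose_mul_mul_same X
  have h3 : (X * K * Xᵀ).PosSemidef := by
    simpa using hK.posSemidef.mul_mul_conjTranspose_same X
  have h4 : (Xᵀ * K * X).trace = 0 := le_antisymm (by linarith [h3.trace_nonneg]) h2.trace_nonneg
  have h5 : Xᵀ * K * X = 0 := (h2.trace_eq_zero_iff).1 h4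
  refine Matrix.ext_of_mulVec_single fun i => ?_
  by_contra hne
  rw [Matrix.zero_mulVec] at hne
  have := hK.dotProduct_mulVec_pos hne
  have e : (X *ᵥ Pi.single i 1) ⬝ᵥ (K *ᵥ (X *ᵥ Pi.single i 1)) =
      Pi.single i 1 ⬝ᵥ ((Xᵀ * K * X) *ᵥ Pi.single i 1) := by
    rw [← Matrix.mulVec_mulVec, ← Matrix.mulVec_mulVec, Matrix.dotProduct_mulVec (Pi.single i 1) Xᵀ,
      Matrix.vecMul_transpose]
  rw [star_trivial, e, h5, Matrix.zero_mulVec, dotProduct_zero] at this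
  exact lt_irrefl _ this

variable {Ω : Type} {D : Set Ω} {S : Set (Ω → ℝ)} {T T₁ T₂ : ℕ}

/-- Lyapunov equations can be solved with `O(p³)` operations. -/
theorem Gen.lyapunov {K R X : Ω → Matrix (Fin p) (Fin p) ℝ} (hK : ∀ ω ∈ D, (K ω).PosDef)
    (hX : ∀ ω ∈ D, K ω * X ω + X ω * K ω = R ω)
    (hK' : Gen D S T₁ (entries K)) (hR : Gen D S T₂ (entries R)) :
    Gen D S (T₁ + T₂ + 128 * p ^ 3) (entries X) := by
  refine (hK'.union hR).bind ?_
  set S' := S ∪ (entries K ∪ entries R)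
  obtain ⟨H, Q, hG, hHQ⟩ := Gen.hessenberg (D := D) (K := K) (S := S')
    (fun q hq => .inr (.inl hq)) p
  let c : Ω → Matrix (Fin p) (Fin p) ℝ := fun ω => (Q ω)ᵀ * R ω * Q ω
  -- Conjugation by the orthogonal `Q` turns the equation into `Hs + sH = c` with `H` tridiagonal,
  -- and `X` is recovered as `QsQᵀ`.
  let s : Ω → Matrix (Fin p) (Fin p) ℝ := fun ω => (Q ω)ᵀ * X ω * Q ω
  have hQQ : ∀ ω ∈ D, Q ω * (Q ω)ᵀ = 1 := fun ω hω => mul_eq_one_comm.1 (hHQ ω hω).1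
  have hKsym : ∀ ω ∈ D, (K ω)ᵀ = K ω := fun ω hω => by simpa using (hK ω hω).isHermitian.eq
  have hHsym : ∀ ω ∈ D, (H ω)ᵀ = H ω := fun ω hω => by
    rw [(hHQ ω hω).2.1]
    simp [Matrix.mul_assoc, hKsym ω hω]
  have hHpos : ∀ ω ∈ D, (H ω).PosDef := fun ω hω => by
    rw [(hHQ ω hω).2.1]
    have hinj : Function.Injective (Q ω).mulVec := Matrix.mulVec_injective_of_isUnit
      ((Matrix.isUnit_iff_isUnit_det _).2 (Matrix.isUnit_det_of_left_inverse (hHQ ω hω).1))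
    simpa using (hK ω hω).conjTranspose_mul_mul_same hinj
  have hHs : ∀ ω ∈ D, H ω * s ω + s ω * H ω = c ω := fun ω hω => by
    have h1 : ∀ Y, Q ω * ((Q ω)ᵀ * Y) = Y := fun Y => by
      rw [← Matrix.mul_assoc, hQQ ω hω, Matrix.one_mul]
    simp only [s, c, (hHQ ω hω).2.1, Matrix.mul_assoc, h1, ← hX ω hω]
    simp only [Matrix.add_mul, Matrix.mul_add, Matrix.mul_assoc]
  -- Nonsingularity on the grid is injectivity of the Lyapunov operator of the positive definite
  -- `H`.
  have hnon : ∀ ω ∈ D, TriNonsingular p (diagExt (H ω)) (offExt (H ω)) := by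
    intro ω hω y hy hy'
    have h0 : (Matrix.of fun i j : Fin p => y i j) = 0 := by
      refine eq_zero_of_lyapunov (hHpos ω hω) ?_
      ext i j
      rw [← triLyap_ext (hHsym ω hω) (fun i j => (hHQ ω hω).2.2 i j j.2)]
      have : matExt (Matrix.of fun i j : Fin p => y i j) = y := by
        ext i j
        by_cases h : i < p ∧ j < p
        · simp [matExt, h]
        · rw [matExt, dif_neg h, hy i j (by omega)]
      rw [this, hy', Matrix.zero_apply]
    intro i j
    by_cases h : i < p ∧ j < p
    · exact congrFun (congrFun h0 ⟨i, h.1⟩) ⟨j, h.2⟩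
    · exact hy i j (by omega)
  refine (hG.bind (T₂ := 98 * p ^ 3) ?_).le (by apply le_of_eq; ring)
  set S'' := S' ∪ (entries H ∪ entries Q)
  have hH0 : Gen D S'' 0 (entries H) := .of_subset fun q hq => .inr (.inl hq)
  have hQ0 : Gen D S'' 0 (entries Q) := .of_subset fun q hq => .inr (.inr hq)
  have hR0 : Gen D S'' 0 (entries R) := .of_subset fun q hq => .inl (.inr (.inr hq))
  refine (((hQ0.matTranspose.matMul hR0).matMul hQ0).bind (T₂ := 94 * p ^ 3) ?_).le
    (by apply le_of_eq; ring)
  set S₃ := S'' ∪ entries fun ω => (Q ω)ᵀ * R ω * Q ω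
  have hH1 : Gen D S₃ 0 (entries H) := hH0.mono subset_rfl Set.subset_union_left
  have hc1 : Gen D S₃ 0 (entries c) := .of_subset Set.subset_union_right
  have hQ1 : Gen D S₃ 0 (entries Q) := hQ0.mono subset_rfl Set.subset_union_left
  have h0 : ∀ D, Gen D S₃ 0 {fun _ : Ω => (0 : ℝ)} := fun D => by
    simpa using Gen.const (D := D) (S := S₃) 0
  have ha : ∀ i, Gen D S₃ 0 {fun ω => diagExt (H ω) i} := fun i => by
    by_cases h : i < p
    · simpa [diagExt, h] using hH1.entry ⟨i, h⟩ ⟨i, h⟩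
    · simpa [diagExt, h] using h0 D
  have hb : ∀ i, Gen D S₃ 0 {fun ω => offExt (H ω) i} := fun i => by
    by_cases h : 0 < i ∧ i < p
    · simpa [offExt, h] using hH1.entry ⟨i, h.2⟩ ⟨i - 1, by omega⟩
    · simpa only [offExt, h, dif_neg, not_false_eq_true] using h0 D
  have hc : ∀ i j, Gen D S₃ 0 {fun ω => matExt (c ω) i j} := fun i j => by
    by_cases h : i < p ∧ j < p
    · simpa [matExt, h] using hc1.entry ⟨i, h.1⟩ ⟨j, h.2⟩
    · simpa only [matExt, h, dif_neg, not_false_eq_true] using h0 D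
  have hs : Gen D S₃ (88 * (p * (p * p)) + 2 * p) (entries s) := by
    -- After branching on the zero pattern of the subdiagonal, the whole grid is one rectangle; its
    -- borders are admissible because the extended subdiagonal vanishes at `0` and at `p`.
    have := Gen.of_pattern (D := D) (Q := rect (fun ω => matExt (s ω)) 0 p 0 p) hb p D subset_rfl
      fun D' hD' hpat => Gen.rect_of_pattern (p := p) (a := fun ω => diagExt (H ω))
        (c := fun ω => matExt (c ω))
        (fun ω hω => hnon ω (hD' hω)) (fun i => (ha i).mono hD' subset_rfl)
        (fun i => (hb i).mono hD' subset_rfl) (fun i j => (hc i j).mono hD' subset_rfl)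
        (fun ω hω i j hi hj => ?_) (fun i => ?_) (p + p) 0 p 0 p le_rfl (by simp) (by simp)
        (fun ω _ => by simp [offExt]) (fun ω _ => by simp [offExt])
        (fun ω _ => by simp [offExt]) (fun ω _ => by simp [offExt])
    · refine this.subset ?_
      rintro _ ⟨i, j, rfl⟩
      exact ⟨i, j, by simp, by simp, by simp, by simp, by simp [matExt]⟩
    · have := triLyap_ext (hHsym ω (hD' hω)) (fun i j => (hHQ ω (hD' hω)).2.2 i j j.2) (s ω)
        ⟨i, hi⟩ ⟨j, hj⟩
      rw [hHs ω (hD' hω)] at this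
      simpa [matExt, hi, hj] using this
    · by_cases h : i < p
      · exact hpat i h
      · left
        intro ω _
        simp [offExt, h]
  refine (((hQ1.matMul hs).matMul hQ1.matTranspose).le ?_).entries_congr fun ω hω => ?_
  · rcases Nat.eq_zero_or_pos p with rfl | hp
    · simp
    · have : p ≤ p ^ 3 := Nat.le_self_pow (by norm_num) p
      nlinarith
  · simp only [s]
    rw [Matrix.mul_assoc, Matrix.mul_assoc _ (Q ω), hQQ ω hω, Matrix.mul_one, ← Matrix.mul_assoc,
      hQQ ω hω, Matrix.one_mul]

end Lyapunov

end SketchedFDA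

namespace SketchedFDA

/-! ### The projection onto the tangent space -/

section Projection

variable {d p : ℕ} {B M : Matrix (Fin d) (Fin d) ℝ} {W ζ ξ : Matrix (Fin d) (Fin p) ℝ}

theorem mem_tangentSpace : ξ ∈ tangentSpace B W ↔ ξᵀ * B * W + Wᵀ * B * ξ = 0 := Iff.rfl

theorem metric_apply (ξ η : Matrix (Fin d) (Fin p) ℝ) : metric p M ξ η = (ξᵀ * M * η).trace := rfl

theorem transpose_eq_of_posDef {ι : Type*} [Fintype ι] {A : Matrix ι ι ℝ} (h : A.PosDef) :
    Aᵀ = A := by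
  simpa using h.isHermitian.eq

theorem metric_self_eq (M : Matrix (Fin d) (Fin d) ℝ) (ξ : Matrix (Fin d) (Fin p) ℝ) :
    metric p M ξ ξ = ∑ j, (fun i => ξ i j) ⬝ᵥ (M *ᵥ fun i => ξ i j) := by
  rw [metric_apply, Matrix.trace]
  refine Finset.sum_congr rfl fun j _ => ?_
  rw [Matrix.diag_apply, Matrix.mul_assoc, Matrix.mul_apply]
  rfl

theorem metric_self_pos (hM : M.PosDef) {ξ : Matrix (Fin d) (Fin p) ℝ} (h : ξ ≠ 0) :
    0 < metric p M ξ ξ := by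
  rw [metric_self_eq]
  obtain ⟨j, hj⟩ : ∃ j, (fun i => ξ i j) ≠ 0 := by
    by_contra! h'
    exact h (by ext i j; exact congrFun (h' j) i)
  refine Finset.sum_pos' (fun j _ => ?_) ⟨j, Finset.mem_univ _, ?_⟩
  · simpa using hM.posSemidef.dotProduct_mulVec_nonneg fun i => ξ i j
  · simpa using hM.dotProduct_mulVec_pos hj

theorem metric_comm (hM : M.PosDef) (ξ η : Matrix (Fin d) (Fin p) ℝ) :
    metric p M ξ η = metric p M η ξ := by
  rw [metric_apply, metric_apply, ← Matrix.trace_transpose]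
  simp [transpose_eq_of_posDef hM, Matrix.mul_assoc]

theorem isCompl_tangentSpace (hM : M.PosDef) :
    IsCompl (tangentSpace B W) (normalSpace B M W) := by
  refine LinearMap.BilinForm.isCompl_orthogonal_of_restrict_nondegenerate
    (fun x y h => by rwa [metric_comm hM]) ?_
  constructor
  · intro x hx
    by_contra hne
    have h0 := hx x
    have := metric_self_pos (p := p) hM (ξ := x.1) (by simpa using hne)
    exact this.ne' h0
  · intro x hx
    by_contra hne
    have h0 := hx x
    have := metric_self_pos (p := p) hM (ξ := x.1) (by simpa using hne)
    exact this.ne' h0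

theorem tangentProj_of_sub_mem (hM : M.PosDef) (hξ : ξ ∈ tangentSpace B W)
    (h : ζ - ξ ∈ normalSpace B M W) : tangentProj B M W ζ = ⟨ξ, hξ⟩ := by
  rw [tangentProj, dif_pos (isCompl_tangentSpace hM)]
  have e : ζ = ξ + (ζ - ξ) := by abel
  conv_lhs => rw [e]
  rw [map_add, (Submodule.projectionOnto_apply_eq_zero_iff _).2 h, add_zero]
  exact Submodule.projectionOnto_apply_left _ ⟨ξ, hξ⟩

/-- The factor `M` of the metric cancels `M⁻¹`, leaving `Tr(ξᵀBWS)`. For symmetric `S` this sees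
only the symmetric part of `ξᵀBW`, which is zero for tangent `ξ`. -/
theorem mem_normalSpace (hM : M.PosDef) (hB : Bᵀ = B) {S : Matrix (Fin p) (Fin p) ℝ}
    (hS : Sᵀ = S) : M⁻¹ * B * W * S ∈ normalSpace B M W := by
  rw [normalSpace, LinearMap.BilinForm.mem_orthogonal_iff]
  intro ξ hξ
  rw [mem_tangentSpace] at hξ
  change metric p M ξ _ = 0
  have hu : IsUnit M.det := (Matrix.isUnit_iff_isUnit_det _).1 hM.isUnit
  rw [metric_apply, Matrix.mul_assoc _ M, ← Matrix.mul_assoc M, ← Matrix.mul_assoc M,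
    ← Matrix.mul_assoc M, Matrix.mul_nonsing_inv _ hu, Matrix.one_mul, ← Matrix.mul_assoc,
    ← Matrix.mul_assoc]
  have h1 : (ξᵀ * B * W * S).trace = (Wᵀ * B * ξ * S).trace := by
    rw [← Matrix.trace_transpose]
    simp only [Matrix.transpose_mul, Matrix.transpose_transpose, hB, hS]
    rw [Matrix.trace_mul_comm]
    simp [Matrix.mul_assoc]
  have h2 : (ξᵀ * B * W * S).trace + (Wᵀ * B * ξ * S).trace = 0 := by
    rw [← Matrix.trace_add, ← Matrix.add_mul, hξ, Matrix.zero_mul, Matrix.trace_zero]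
  linarith

/-- The matrix of the Lyapunov equation for the normal component. -/
noncomputable def normalGram (B M : Matrix (Fin d) (Fin d) ℝ) (W : Matrix (Fin d) (Fin p) ℝ) :
    Matrix (Fin p) (Fin p) ℝ := Wᵀ * B * (M⁻¹ * (B * W))

/-- The vector subtracted is normal by `mem_normalSpace`; the Lyapunov equation for `S` says exactly
that the difference is tangent. -/
theorem tangentProj_eq (hM : M.PosDef) (hB : Bᵀ = B) {S : Matrix (Fin p) (Fin p) ℝ}
    (hS : Sᵀ = S) (h : normalGram B M W * S + S * normalGram B M W = Wᵀ * B * ζ + ζᵀ * B * W) :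
    (tangentProj B M W ζ : Matrix (Fin d) (Fin p) ℝ) = ζ - M⁻¹ * (B * W) * S := by
  have hMi : (M⁻¹)ᵀ = M⁻¹ := transpose_eq_of_posDef hM.inv
  have hmem : ζ - M⁻¹ * (B * W) * S ∈ tangentSpace B W := by
    rw [mem_tangentSpace]
    simp only [normalGram] at h
    have e1 : (M⁻¹ * (B * W) * S)ᵀ * B * W = S * (Wᵀ * B * (M⁻¹ * (B * W))) := by
      simp [hB, hS, hMi, Matrix.mul_assoc]
    have e2 : Wᵀ * B * (M⁻¹ * (B * W) * S) = Wᵀ * B * (M⁻¹ * (B * W)) * S :=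
      (Matrix.mul_assoc _ _ _).symm
    rw [Matrix.transpose_sub, Matrix.sub_mul, Matrix.sub_mul, Matrix.mul_sub, e1, e2]
    rw [← sub_eq_zero] at h
    rw [← neg_eq_zero, ← h]
    abel
  rw [tangentProj_of_sub_mem hM hmem]
  rw [sub_sub_cancel, ← Matrix.mul_assoc M⁻¹]
  exact mem_normalSpace hM hB hS

/-- In finite dimension the injective Lyapunov operator is surjective. The transpose of a solution
solves the same equation, so uniqueness makes the solution symmetric. -/
theorem exists_lyapunov {ι : Type*} [Fintype ι] {K : Matrix ι ι ℝ} (hK : K.PosDef)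
    (R : Matrix ι ι ℝ) (hR : Rᵀ = R) : ∃ S, Sᵀ = S ∧ K * S + S * K = R := by
  let L : Matrix ι ι ℝ →ₗ[ℝ] Matrix ι ι ℝ :=
    LinearMap.mulLeft ℝ K + LinearMap.mulRight ℝ K
  have hinj : Function.Injective L := by
    rw [← LinearMap.ker_eq_bot, LinearMap.ker_eq_bot']
    intro X hX
    exact eq_zero_of_lyapunov hK hX
  obtain ⟨S, hS⟩ := LinearMap.surjective_of_injective hinj R
  have hS' : K * S + S * K = R := hS
  refine ⟨S, ?_, hS'⟩
  refine sub_eq_zero.1 (eq_zero_of_lyapunov hK ?_)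
  have h2 := congrArg Matrix.transpose hS'
  simp only [Matrix.transpose_add, Matrix.transpose_mul, transpose_eq_of_posDef hK, hR] at h2
  rw [Matrix.mul_sub, Matrix.sub_mul]
  rw [← sub_eq_zero] at h2 hS'
  calc K * Sᵀ - K * S + (Sᵀ * K - S * K) = (Sᵀ * K + K * Sᵀ - R) - (K * S + S * K - R) := by abel
    _ = 0 := by rw [h2, hS', sub_zero]

theorem normalGram_posDef (hM : M.PosDef) (hB : B.PosDef)
    (hW : Function.Injective W.mulVec) : (normalGram B M W).PosDef := by
  have h1 : Function.Injective (B * W).mulVec := by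
    intro x y h
    simp only [← Matrix.mulVec_mulVec] at h
    exact hW (Matrix.mulVec_injective_of_isUnit hB.isUnit h)
  have := hM.inv.conjTranspose_mul_mul_same h1
  simpa [normalGram, transpose_eq_of_posDef hB, Matrix.mul_assoc] using this

theorem exists_tangentProj_eq (hM : M.PosDef) (hB : B.PosDef)
    (hW : Function.Injective W.mulVec) (ζ : Matrix (Fin d) (Fin p) ℝ) :
    ∃ S : Matrix (Fin p) (Fin p) ℝ, Sᵀ = S ∧
      normalGram B M W * S + S * normalGram B M W = Wᵀ * B * ζ + ζᵀ * B * W ∧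
      (tangentProj B M W ζ : Matrix (Fin d) (Fin p) ℝ) = ζ - M⁻¹ * (B * W) * S := by
  have hBt := transpose_eq_of_posDef hB
  obtain ⟨S, hS, hS'⟩ := exists_lyapunov (normalGram_posDef hM hB hW) (Wᵀ * B * ζ + ζᵀ * B * W)
    (by simp [hBt, Matrix.mul_assoc, add_comm])
  exact ⟨S, hS, hS', tangentProj_eq hM hBt hS hS'⟩

theorem injective_of_mem_stiefel (hW : W ∈ stiefel p B) : Function.Injective W.mulVec := by
  intro x y h
  have h' : Wᵀ * B * W = 1 := hW
  have := congrArg (fun z => (Wᵀ * B) *ᵥ z) h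
  simpa [Matrix.mulVec_mulVec, h'] using this

/-- Evaluation of the projection onto the tangent space. -/
theorem Gen.tangentProj {Ω : Type} {D : Set Ω} {S : Set (Ω → ℝ)} {T : ℕ}
    {B M : Ω → Matrix (Fin d) (Fin d) ℝ} {W ζ : Ω → Matrix (Fin d) (Fin p) ℝ}
    (hM : ∀ ω ∈ D, (M ω).PosDef) (hB : ∀ ω ∈ D, (B ω).PosDef)
    (hW : ∀ ω ∈ D, Function.Injective (W ω).mulVec) (hpd : p ≤ d)
    (hMi : Gen D S 0 (entries fun ω => (M ω)⁻¹)) (hBW : Gen D S 0 (entries fun ω => B ω * W ω))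
    (hζ : Gen D S T (entries ζ)) :
    Gen D S (T + (2 * (d * d * p) + 138 * (d * p * p)))
      (entries fun ω => (tangentProj (B ω) (M ω) (W ω) (ζ ω) : Matrix (Fin d) (Fin p) ℝ)) := by
  classical
  have key : ∀ ω, ∃ S : Matrix (Fin p) (Fin p) ℝ, ω ∈ D → Sᵀ = S ∧
      normalGram (B ω) (M ω) (W ω) * S + S * normalGram (B ω) (M ω) (W ω) =
        (W ω)ᵀ * B ω * ζ ω + (ζ ω)ᵀ * B ω * W ω ∧
      (SketchedFDA.tangentProj (B ω) (M ω) (W ω) (ζ ω) : Matrix (Fin d) (Fin p) ℝ) =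
        ζ ω - (M ω)⁻¹ * (B ω * W ω) * S := by
    intro ω
    by_cases hω : ω ∈ D
    · obtain ⟨S, h⟩ := exists_tangentProj_eq (hM ω hω) (hB ω hω) (hW ω hω) (ζ ω)
      exact ⟨S, fun _ => h⟩
    · exact ⟨0, fun h => absurd h hω⟩
  -- The solutions may be chosen noneffectively, because `Gen.lyapunov` computes whatever family
  -- solves the equations.
  choose L hL using key
  refine hζ.bind ?_
  set S₁ := S ∪ entries ζ
  have hζ1 : Gen D S₁ 0 (entries ζ) := .of_subset Set.subset_union_right
  have hMi1 := hMi.mono (D' := D) (S' := S₁) subset_rfl Set.subset_union_left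
  have hBW1 := hBW.mono (D' := D) (S' := S₁) subset_rfl Set.subset_union_left
  refine ((hMi1.matMul hBW1).bind (T₂ := 138 * (d * p * p)) ?_).le (by simp)
  set S₂ := S₁ ∪ entries fun ω => (M ω)⁻¹ * (B ω * W ω)
  have hζ2 := hζ1.mono (D' := D) (S' := S₂) subset_rfl Set.subset_union_left
  have hBW2 := hBW1.mono (D' := D) (S' := S₂) subset_rfl Set.subset_union_left
  have hU : Gen D S₂ 0 (entries fun ω => (M ω)⁻¹ * (B ω * W ω)) :=
    .of_subset Set.subset_union_right
  have hBt : ∀ ω ∈ D, (B ω)ᵀ = B ω := fun ω hω => transpose_eq_of_posDef (hB ω hω)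
  have hK : Gen D S₂ _ (entries fun ω => normalGram (B ω) (M ω) (W ω)) :=
    (hBW2.matTranspose.matMul hU).entries_congr fun ω hω => by
      rw [normalGram, Matrix.transpose_mul, hBt ω hω]
  have hR := (hBW2.matTranspose.matMul hζ2)
  have hR' := (hR.matAdd (hζ2.matTranspose.matMul hBW2)).entries_congr
    (A' := fun ω => (W ω)ᵀ * B ω * ζ ω + (ζ ω)ᵀ * B ω * W ω) fun ω hω => by
      rw [Matrix.transpose_mul, hBt ω hω, Matrix.mul_assoc (ζ ω)ᵀ]
  have hS := Gen.lyapunov (X := L)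
    (fun ω hω => normalGram_posDef (hM ω hω) (hB ω hω) (hW ω hω))
    (fun ω hω => (hL ω hω).2.1) hK hR'
  refine ((hζ2.matSub (hU.matMul hS)).le ?_).entries_congr fun ω hω => (hL ω hω).2.2
  have h1 : p ^ 3 ≤ d * p * p := by
    calc p ^ 3 = p * p * p := by ring
      _ ≤ d * p * p := by gcongr
  have h2 : p * p ≤ d * p := by gcongr
  have h3 : d * p ≤ d * p * p := by
    rcases Nat.eq_zero_or_pos p with rfl | hp
    · simp
    · exact Nat.le_mul_of_pos_right _ hp
  have h4 : p * d * p = d * p * p := by ring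
  simp only [h4]
  nlinarith

end Projection

end SketchedFDA

namespace SketchedFDA

/-! ### QR factorization -/

section QR

variable {d p : ℕ}

/-- The Gram matrix `G = YᵀBY` has an LDL factorization `JGJᵀ = diag(δ)` with `J` lower triangular.
Scaling the columns of `Jᵀ` to `E` normalizes `Y * E`, and the triangular factor is `E⁻¹`. -/
theorem exists_isQF {B : Matrix (Fin d) (Fin d) ℝ} {Y : Matrix (Fin d) (Fin p) ℝ} (hB : B.PosDef)
    (hY : Function.Injective Y.mulVec) : ∃ Q, IsQF B Y Q := by
  have hG : (Yᵀ * B * Y).PosDef := by simpa using hB.conjTranspose_mul_mul_same hY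
  set J := LDL.lowerInv hG with hJ
  have hJu : IsUnit J.det := Matrix.isUnit_det_of_invertible J
  have hdiag : Matrix.diagonal (LDL.diagEntries hG) = J * (Yᵀ * B * Y) * Jᵀ := by
    have := LDL.diag_eq_lowerInv_conj hG
    simpa [LDL.diag] using this
  set δ := LDL.diagEntries hG with hδ
  have hδpos : ∀ i, 0 < δ i := by
    rw [← Matrix.posDef_diagonal_iff, hdiag]
    have := hG.mul_mul_conjTranspose_same (B := J)
      (Matrix.vecMul_injective_of_isUnit ((Matrix.isUnit_iff_isUnit_det _).2 hJu))
    simpa using this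
  have hJtri : J.IsLowerTriangular := fun i j hij => LDL.lowerInv_triangular hG hij
  have hJne : ∀ i, J i i ≠ 0 := by
    have := hJu.ne_zero
    rw [Matrix.det_of_isLowerTriangular J hJtri, Finset.prod_ne_zero_iff] at this
    exact fun i => this i (Finset.mem_univ _)
  -- Of the diagonal of `J` only the nonvanishing is used; the sign makes the diagonal of `E`, hence
  -- that of its inverse, positive.
  let θ : Fin p → ℝ := fun i => SignType.sign (J i i) / √(δ i)
  have hθ : ∀ i, θ i * δ i * θ i = 1 := by
    intro i
    have h1 : (SignType.sign (J i i) : ℝ) * SignType.sign (J i i) = 1 := by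
      rcases (hJne i).lt_or_gt with h | h <;> simp [h]
    have h2 := Real.mul_self_sqrt (hδpos i).le
    have h3 : √(δ i) ≠ 0 := (Real.sqrt_pos.2 (hδpos i)).ne'
    simp only [θ]
    field_simp
    rw [sq, sq, h1, one_mul, h2]
  have hθne : ∀ i, θ i ≠ 0 := fun i h => by simpa [h] using hθ i
  set E := Jᵀ * Matrix.diagonal θ with hE
  have hEu : IsUnit E.det := by
    rw [hE, Matrix.det_mul, Matrix.det_transpose, Matrix.det_diagonal]
    exact hJu.mul (isUnit_iff_ne_zero.2 (Finset.prod_ne_zero_iff.2 fun i _ => hθne i))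
  have hEtri : E.BlockTriangular id := fun i j hij => by
    rw [hE, Matrix.mul_diagonal, Matrix.transpose_apply]
    exact mul_eq_zero_of_left (LDL.lowerInv_triangular hG (show j < i from hij)) _
  have hEpos : ∀ i, 0 < E i i := fun i => by
    rw [hE, Matrix.mul_diagonal, Matrix.transpose_apply]
    simp only [θ]
    rw [← mul_div_assoc, self_mul_sign]
    exact div_pos (abs_pos.2 (hJne i)) (Real.sqrt_pos.2 (hδpos i))
  let _ : Invertible E := E.invertibleOfIsUnitDet hEu
  have hRtri := Matrix.blockTriangular_inv_of_blockTriangular hEtri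
  refine ⟨Y * E, ?_, E⁻¹, fun i j hij => hRtri hij, fun i => ?_, ?_⟩
  · have : (Y * E)ᵀ * B * (Y * E) = Matrix.diagonal θ * (J * (Yᵀ * B * Y) * Jᵀ) *
        Matrix.diagonal θ := by
      simp [hE, Matrix.mul_assoc]
    rw [this, ← hdiag, Matrix.diagonal_mul_diagonal, Matrix.diagonal_mul_diagonal]
    simp only [hθ]
    exact Matrix.diagonal_one
  · have h1 : E i i * E⁻¹ i i = 1 := by
      have := congrFun (congrFun (Matrix.mul_nonsing_inv E hEu) i) i
      rw [Matrix.mul_apply, Finset.sum_eq_single i] at this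
      · simpa using this
      · intro k _ hk
        rcases hk.lt_or_gt with h | h
        · rw [hEtri (show (id k : Fin p) < id i from h), zero_mul]
        · rw [hRtri (show (id i : Fin p) < id k from h), mul_zero]
      · simp
    exact (pos_iff_pos_of_mul_pos (by rw [h1]; exact one_pos)).1 (hEpos i)
  · rw [Matrix.mul_assoc, Matrix.mul_nonsing_inv E hEu, Matrix.mul_one]

theorem isQF_qf {B : Matrix (Fin d) (Fin d) ℝ} {Y : Matrix (Fin d) (Fin p) ℝ} (hB : B.PosDef)
    (hY : Function.Injective Y.mulVec) : IsQF B Y (qf B Y) :=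
  Classical.epsilon_spec (exists_isQF hB hY)

/-- Column `k` of `Y` minus its projection onto the preceding columns of `Q`. -/
noncomputable def gsResidual (P Y Q A : Matrix (Fin d) (Fin p) ℝ) (k : Fin p) : Fin d → ℝ :=
  fun r => A r k - ∑ i with i < k, Q r i * ((fun r => Y r i) ⬝ᵥ fun r => P r k)

/-- The Gram–Schmidt recursion for the orthonormal factor `Q`. -/
theorem IsQF.gramSchmidt {B : Matrix (Fin d) (Fin d) ℝ} {Y Q : Matrix (Fin d) (Fin p) ℝ}
    (h : IsQF B Y Q) (k : Fin p) :
    (∀ r, Q r k = gsResidual (B * Y) Q Q Y k r /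
      √(gsResidual (B * Y) Q Q Y k ⬝ᵥ gsResidual (B * Y) Q (B * Q) (B * Y) k)) ∧
    ∀ r, (B * Q) r k = gsResidual (B * Y) Q (B * Q) (B * Y) k r /
      √(gsResidual (B * Y) Q Q Y k ⬝ᵥ gsResidual (B * Y) Q (B * Q) (B * Y) k) := by
  obtain ⟨hQ, R, hR, hRpos, rfl⟩ := h
  -- The coefficients `QᵀBY` are those of `R`. So any admissible factor satisfies the recursion, and
  -- computing the recursion computes the factor selected by `qf`.
  have hRij : ∀ i, (fun r => Q r i) ⬝ᵥ (fun r => (B * (Q * R)) r k) = R i k := by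
    intro i
    have : (Qᵀ * (B * (Q * R))) i k = R i k := by
      rw [← Matrix.mul_assoc, ← Matrix.mul_assoc, hQ, Matrix.one_mul]
    rw [← this, Matrix.mul_apply]
    rfl
  have hsplit : ∀ A : Matrix (Fin d) (Fin p) ℝ, ∀ r, (A * R) r k -
      ∑ i with i < k, A r i * R i k = R k k * A r k := by
    intro A r
    rw [Matrix.mul_apply, ← Finset.sum_filter_add_sum_filter_not Finset.univ (fun i => i < k),
      add_sub_cancel_left, Finset.sum_eq_single k]
    · ring
    · intro i hi hik
      rw [hR i k (lt_of_le_of_ne (not_lt.1 (Finset.mem_filter.1 hi).2) hik.symm), mul_zero]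
    · simp
  have e1 : gsResidual (B * (Q * R)) Q Q (Q * R) k = fun r => R k k * Q r k := by
    ext r
    simp only [gsResidual, hRij, hsplit]
  have e2 : gsResidual (B * (Q * R)) Q (B * Q) (B * (Q * R)) k = fun r => R k k * (B * Q) r k := by
    ext r
    simp only [gsResidual, hRij]
    rw [← Matrix.mul_assoc, hsplit]
  have e3 : (fun r => R k k * Q r k) ⬝ᵥ (fun r => R k k * (B * Q) r k) = R k k * R k k := by
    have : (Qᵀ * (B * Q)) k k = 1 := by rw [← Matrix.mul_assoc, hQ, Matrix.one_apply_eq]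
    rw [Matrix.mul_apply] at this
    simp only [dotProduct]
    rw [← mul_one (R k k * R k k), ← this, Finset.mul_sum]
    refine Finset.sum_congr rfl fun r _ => ?_
    rw [Matrix.transpose_apply]
    ring
  rw [e1, e2, e3, Real.sqrt_mul_self (hRpos k).le]
  constructor <;> intro r <;> rw [mul_div_cancel_left₀ _ (hRpos k).ne']

variable {Ω : Type} {D : Set Ω} {S : Set (Ω → ℝ)} {T T₁ T₂ : ℕ}

/-- The entries in the first `k` columns. -/
def columnsBelow (A : Ω → Matrix (Fin d) (Fin p) ℝ) (k : ℕ) : Set (Ω → ℝ) :=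
  {q | ∃ i, ∃ j : Fin p, j.val < k ∧ q = fun ω => A ω i j}

theorem Gen.gsResidual {P Y Q A : Ω → Matrix (Fin d) (Fin p) ℝ} {k : Fin p}
    (hA : Gen D S 0 (entries A))
    (hQ : ∀ r, ∀ i < k, Gen D S 0 {fun ω => Q ω r i})
    (hR : ∀ i < k, Gen D S 0 {fun ω => (fun r => Y ω r i) ⬝ᵥ fun r => P ω r k}) :
    Gen D S (d * (2 * p + 1))
      (coords fun ω => gsResidual (P ω) (Y ω) (Q ω) (A ω) k) := by
  refine (Gen.coords_const (T := 2 * p + 1) fun r => ?_).le (by simp)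
  refine ((hA.entry r k).sub (Gen.sum_const (t := Finset.univ.filter fun i => i < k) (T := 1)
    (q := fun i ω => Q ω r i * ((fun r => Y ω r i) ⬝ᵥ fun r => P ω r k))
    fun i hi => ?_)).le ?_
  · have hi : i < k := (Finset.mem_filter.1 hi).2
    exact (hQ r i hi).mul (hR i hi)
  · have : (Finset.univ.filter fun i => i < k).card ≤ p := by
      simpa using Finset.card_le_univ (Finset.univ.filter fun i => i < k)
    omega

/-- Computation of the orthonormal factor. -/
theorem Gen.isQF {B : Ω → Matrix (Fin d) (Fin d) ℝ} {Y Q : Ω → Matrix (Fin d) (Fin p) ℝ}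
    (hQ : ∀ ω ∈ D, IsQF (B ω) (Y ω) (Q ω)) (hd : 0 < d)
    (hY : Gen D S 0 (entries Y)) (hBY : Gen D S 0 (entries fun ω => B ω * Y ω)) :
    Gen D S (13 * (d * p * p)) (entries Q ∪ entries fun ω => B ω * Q ω) := by
  -- The columns of `Q` and `BQ` are produced together: the combination that gives a column of `Q`
  -- from `Y` gives that of `BQ` from `BY`. Beyond `BY`, no product with `B` is needed.
  have key : ∀ k ≤ p, Gen D S (k * (13 * (d * p)))
      (columnsBelow Q k ∪ columnsBelow (fun ω => B ω * Q ω) k) := by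
    intro k
    induction k with
    | zero =>
      intro _
      refine (Gen.of_subset ?_).le (Nat.zero_le _)
      rintro q (⟨i, j, h, rfl⟩ | ⟨i, j, h, rfl⟩) <;> exact absurd h (Nat.not_lt_zero _)
    | succ k ih =>
      intro hk
      set k' : Fin p := ⟨k, hk⟩
      rw [add_mul]
      refine (ih (by omega)).bind ?_
      set S₁ := S ∪ (columnsBelow Q k ∪ columnsBelow (fun ω => B ω * Q ω) k)
      have hS₁ : S ⊆ S₁ := Set.subset_union_left
      have hP1 := (hBY.mono (D' := D) subset_rfl hS₁)
      have hR : Gen D S₁ (p * (2 * d))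
          {q | ∃ i < k', q = fun ω => (fun r => Q ω r i) ⬝ᵥ fun r => (B ω * Y ω) r k'} := by
        refine (Gen.biUnion (t := Finset.univ.filter fun i => i < k') (T := fun _ => 2 * d)
          (Q := fun i => {fun ω => (fun r => Q ω r i) ⬝ᵥ fun r => (B ω * Y ω) r k'})
          fun i hi => ?_).le ?_ |>.subset ?_
        · have hi : i < k' := (Finset.mem_filter.1 hi).2
          refine (Gen.dotProduct (T₁ := 0) (u := fun ω r => Q ω r i) (.of_subset ?_)
            (hP1.coords_col k')).le (by simp)
          rintro _ ⟨r, rfl⟩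
          exact .inr (.inl ⟨r, i, hi, rfl⟩)
        · have : (Finset.univ.filter fun i => i < k').card ≤ p := by
            simpa using Finset.card_le_univ (Finset.univ.filter fun i => i < k')
          simp only [Finset.sum_const, smul_eq_mul]
          gcongr
        · rintro _ ⟨i, hi, rfl⟩
          simp only [Set.mem_iUnion]
          exact ⟨i, by simpa using hi, rfl⟩
      refine (hR.bind (T₂ := 4 * (d * p) + 7 * d) ?_).le ?_
      · set S₂ := S₁ ∪ {q | ∃ i < k', q = fun ω => (fun r => Q ω r i) ⬝ᵥ fun r => (B ω * Y ω) r k'}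
        have hS₂ : S ⊆ S₂ := hS₁.trans Set.subset_union_left
        have hR2 : ∀ i < k', Gen D S₂ 0
            {fun ω => (fun r => Q ω r i) ⬝ᵥ fun r => (B ω * Y ω) r k'} :=
          fun i hi => .of_mem (.inr ⟨i, hi, rfl⟩)
        have hv := Gen.gsResidual (Q := Q) (hY.mono (D' := D) subset_rfl hS₂)
          (fun r i hi => .of_mem (.inl (.inr (.inl ⟨r, i, hi, rfl⟩)))) hR2
        have hw := Gen.gsResidual (Q := fun ω => B ω * Q ω) (hBY.mono (D' := D) subset_rfl hS₂)
          (fun r i hi => .of_mem (.inl (.inr (.inr ⟨r, i, hi, rfl⟩)))) hR2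
        refine ((hv.union hw).bind (T₂ := 5 * d) ?_).le (by apply le_of_eq; ring)
        set v : Ω → Fin d → ℝ := fun ω => SketchedFDA.gsResidual (B ω * Y ω) (Q ω) (Q ω) (Y ω) k'
        set w : Ω → Fin d → ℝ := fun ω =>
          SketchedFDA.gsResidual (B ω * Y ω) (Q ω) (B ω * Q ω) (B ω * Y ω) k'
        set S₃ := S₂ ∪ (coords v ∪ coords w)
        have hv3 : Gen D S₃ 0 (coords v) := .of_subset fun q hq => .inr (.inl hq)
        have hw3 : Gen D S₃ 0 (coords w) := .of_subset fun q hq => .inr (.inr hq)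
        refine ((hv3.dotProduct hw3).sqrt.bind (T₂ := 2 * d) ?_).le (by simp; omega)
        have hn : Gen D (S₃ ∪ {fun ω => √(v ω ⬝ᵥ w ω)}) 0 {fun ω => √(v ω ⬝ᵥ w ω)} :=
          .of_subset Set.subset_union_right
        have hq : Gen D (S₃ ∪ {fun ω => √(v ω ⬝ᵥ w ω)}) (d * 1) (coords fun ω r => Q ω r k') := by
          refine (Gen.coords_const (T := 1) fun r => ?_).le (by simp)
          exact ((((hv3.coord r).mono subset_rfl Set.subset_union_left).div hn).le
            (by simp)).congr fun ω hω => ((hQ ω hω).gramSchmidt k').1 r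
        have hq' : Gen D (S₃ ∪ {fun ω => √(v ω ⬝ᵥ w ω)}) (d * 1)
            (coords fun ω r => (B ω * Q ω) r k') := by
          refine (Gen.coords_const (T := 1) fun r => ?_).le (by simp)
          exact ((((hw3.coord r).mono subset_rfl Set.subset_union_left).div hn).le
            (by simp)).congr fun ω hω => ((hQ ω hω).gramSchmidt k').2 r
        have hold : Gen D (S₃ ∪ {fun ω => √(v ω ⬝ᵥ w ω)}) 0
            (columnsBelow Q k ∪ columnsBelow (fun ω => B ω * Q ω) k) :=
          .of_subset fun q hq => .inl (.inl (.inl (.inr hq)))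
        refine ((hold.union (hq.union hq')).le (by omega)).subset ?_
        rintro _ (⟨i, j, hj, rfl⟩ | ⟨i, j, hj, rfl⟩)
        · rcases Nat.lt_succ_iff_lt_or_eq.1 hj with h | h
          · exact .inl (.inl ⟨i, j, h, rfl⟩)
          · obtain rfl : j = k' := Fin.ext h
            exact .inr (.inl ⟨i, rfl⟩)
        · rcases Nat.lt_succ_iff_lt_or_eq.1 hj with h | h
          · exact .inl (.inr ⟨i, j, h, rfl⟩)
          · obtain rfl : j = k' := Fin.ext h
            exact .inr (.inr ⟨i, rfl⟩)
      · have : d ≤ d * p := Nat.le_mul_of_pos_right _ (by omega)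
        nlinarith
  refine ((key p le_rfl).le (by apply le_of_eq; ring)).subset ?_
  rintro _ (⟨i, j, rfl⟩ | ⟨i, j, rfl⟩)
  · exact .inl ⟨i, j, j.2, rfl⟩
  · exact .inr ⟨i, j, j.2, rfl⟩

end QR

end SketchedFDA

namespace SketchedFDA

/-! ### Scatter matrices and the cost function -/

section Scatter

variable {n d l p : ℕ} (X : Matrix (Fin n) (Fin d) ℝ) (y : Fin n → Fin l)

theorem scatterB_eq : scatterB X y = (between X y)ᵀ * between X y := by
  ext i j
  simp only [scatterB, Matrix.sum_apply, Matrix.smul_apply, vecMulVec_apply, smul_eq_mul,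
    Matrix.mul_apply, Matrix.transpose_apply, between, Matrix.of_apply, Pi.sub_apply]
  refine Finset.sum_congr rfl fun k _ => ?_
  have := Real.mul_self_sqrt (Nat.cast_nonneg (α := ℝ) (classSize y k))
  linear_combination -(classMean X y k i - totalMean X i) * (classMean X y k j - totalMean X j) *
    this

theorem scatterB_transpose : (scatterB X y)ᵀ = scatterB X y := by
  simp [scatterB_eq]

theorem regScatterW_eq (lam : ℝ) : regScatterW X y lam = regGram (centered X y) lam := by
  rw [regScatterW, regGram]
  congr 1
  ext i j
  simp [scatterW, Matrix.sum_apply, vecMulVec_apply, Matrix.mul_apply, centered]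

theorem fdaCost_eq (μ : Fin p → ℝ) (W : Matrix (Fin d) (Fin p) ℝ) :
    fdaCost X y μ W = -(1 / 2) * ∑ j, ((fun k => (between X y * W) k j) ⬝ᵥ
      fun k => (between X y * W) k j) * μ j := by
  rw [fdaCost, Matrix.trace, scatterB_eq]
  congr 1
  refine Finset.sum_congr rfl fun j _ => ?_
  rw [Matrix.diag_apply, Matrix.mul_diagonal,
    show Wᵀ * ((between X y)ᵀ * between X y) * W = (between X y * W)ᵀ * (between X y * W) by
      simp [Matrix.mul_assoc]]
  rfl

/-- The bilinear form whose diagonal is the cost function. -/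
noncomputable def costForm (A : Matrix (Fin d) (Fin d) ℝ) (μ : Fin p → ℝ) :
    Matrix (Fin d) (Fin p) ℝ →ₗ[ℝ] Matrix (Fin d) (Fin p) ℝ →ₗ[ℝ] ℝ :=
  LinearMap.mk₂ ℝ (fun U W => -(1 / 2) * (Uᵀ * A * W * Matrix.diagonal μ).trace)
    (by intros; simp [Matrix.add_mul]; ring) (by intros; simp; ring)
    (by intros; simp [Matrix.mul_add, Matrix.add_mul]; ring) (by intros; simp; ring)

theorem costForm_apply (A : Matrix (Fin d) (Fin d) ℝ) (μ : Fin p → ℝ)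
    (U W : Matrix (Fin d) (Fin p) ℝ) :
    costForm A μ U W = -(1 / 2) * (Uᵀ * A * W * Matrix.diagonal μ).trace := rfl

theorem costForm_comm {A : Matrix (Fin d) (Fin d) ℝ} (hA : Aᵀ = A) (μ : Fin p → ℝ)
    (U W : Matrix (Fin d) (Fin p) ℝ) : costForm A μ U W = costForm A μ W U := by
  rw [costForm_apply, costForm_apply, ← Matrix.trace_transpose]
  simp only [Matrix.transpose_mul, Matrix.diagonal_transpose, Matrix.transpose_transpose, hA]
  rw [Matrix.trace_mul_comm]
  simp [Matrix.mul_assoc]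

-- The cost is the diagonal of a symmetric bilinear form, so its derivative is twice the form. The
-- norm on matrices serves only to apply the rule for bilinear maps.
attribute [local instance] Matrix.normedAddCommGroup Matrix.normedSpace in
theorem fderiv_fdaCost (μ : Fin p → ℝ) (W E : Matrix (Fin d) (Fin p) ℝ) :
    fderiv ℝ (fdaCost X y μ) W E = 2 * costForm (scatterB X y) μ E W := by
  have h := (LinearMap.toContinuousBilinearMap
    (costForm (p := p) (scatterB X y) μ)).hasFDerivAt_of_bilinear
    (hasFDerivAt_id W) (hasFDerivAt_id W)
  have h' : HasFDerivAt (fdaCost X y μ) _ W := h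
  rw [h'.fderiv]
  have e : (LinearMap.toContinuousBilinearMap (costForm (p := p) (scatterB X y) μ) W) E +
      (LinearMap.toContinuousBilinearMap (costForm (p := p) (scatterB X y) μ) E) W =
      2 * costForm (scatterB X y) μ E W := by
    rw [LinearMap.toContinuousBilinearMap_apply, LinearMap.toContinuousBilinearMap_apply,
      costForm_comm (scatterB_transpose X y) μ W E]
    ring
  exact e

theorem euclideanGradient_fdaCost (μ : Fin p → ℝ) (W : Matrix (Fin d) (Fin p) ℝ) :
    euclideanGradient (fdaCost X y μ) W = -(scatterB X y * W * Matrix.diagonal μ) := by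
  ext i j
  rw [euclideanGradient, Matrix.of_apply, fderiv_fdaCost, costForm_apply]
  simp [Matrix.mul_assoc, Matrix.trace_single_mul]

end Scatter

end SketchedFDA

namespace SketchedFDA

/-! ### The cost of an iteration -/

/-- Tangency cancels the cross terms, so `(W + tη)ᵀB(W + tη) = I + t²ηᵀBη` is positive definite.
Hence the retraction is defined for every step length the line search may try. -/
theorem injective_add_smul {d p : ℕ} {B : Matrix (Fin d) (Fin d) ℝ} (hB : B.PosDef)
    {W η : Matrix (Fin d) (Fin p) ℝ} (hW : W ∈ stiefel p B) (hη : η ∈ tangentSpace B W) (t : ℝ) :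
    Function.Injective (W + t • η).mulVec := by
  have hG : (W + t • η)ᵀ * B * (W + t • η) = 1 + (t • η)ᵀ * B * (t • η) := by
    have h1 : Wᵀ * B * W = 1 := hW
    have h2 : ηᵀ * B * W + Wᵀ * B * η = 0 := hη
    rw [← h1]
    simp only [Matrix.transpose_add, Matrix.add_mul, Matrix.mul_add, Matrix.transpose_smul,
      Matrix.smul_mul, Matrix.mul_smul, smul_add]
    have h3 : t • (ηᵀ * B * W) + t • (Wᵀ * B * η) = 0 := by rw [← smul_add, h2, smul_zero]
    rw [add_assoc, ← add_assoc (t • (ηᵀ * B * W)), h3, zero_add]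
  have hpos : ((W + t • η)ᵀ * B * (W + t • η)).PosDef := by
    rw [hG]
    refine Matrix.PosDef.one.add_posSemidef ?_
    simpa using hB.posSemidef.conjTranspose_mul_mul_same (t • η)
  intro x y h
  have h' : ((W + t • η)ᵀ * B * (W + t • η)) *ᵥ x = ((W + t • η)ᵀ * B * (W + t • η)) *ᵥ y := by
    rw [← Matrix.mulVec_mulVec, ← Matrix.mulVec_mulVec]
    have h : (W + t • η) *ᵥ x = (W + t • η) *ᵥ y := h
    rw [h, Matrix.mulVec_mulVec]
    rw [Matrix.mulVec_mulVec]
  exact Matrix.mulVec_injective_of_isUnit hpos.isUnit h'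

section Iteration

variable {n d l p s : ℕ} {y : Fin n → Fin l} {seed : SketchSeed n s}
  {E E' : Finset (Fin n × Fin d)} {D D' : Set (IterData n d p)} {S S' : Set (IterData n d p → ℝ)}
  {T T₁ T₂ N : ℕ}

/-- `N` bounds the numbers of operations of the elementary steps of an iteration. -/
structure StepBound (l d p e N : ℕ) : Prop where
  pos_d : 0 < d
  pos_p : 0 < p
  le : p ≤ d
  ldp : l * d * p ≤ N
  ep : e * p ≤ N
  ddp : d * d * p ≤ N
  dpp : d * p * p ≤ N

theorem StepBound.dp {e : ℕ} (h : StepBound l d p e N) : d * p ≤ N :=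
  (Nat.le_mul_of_pos_right _ h.pos_p).trans h.dpp

theorem StepBound.lp {e : ℕ} (h : StepBound l d p e N) : l * p ≤ N := by
  refine le_trans ?_ h.ldp
  rw [mul_right_comm]
  exact Nat.le_mul_of_pos_right _ h.pos_d

theorem StepBound.p_le {e : ℕ} (h : StepBound l d p e N) : p ≤ N :=
  (Nat.le_mul_of_pos_left _ h.pos_d).trans h.dp

theorem StepBound.one {e : ℕ} (h : StepBound l d p e N) : 1 ≤ N := (Nat.succ_le_of_lt h.pos_p).trans h.p_le

theorem iterInputs_centered :
    entries (fun ω : IterData n d p => centered ω.X y) ⊆ iterInputs y seed := by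
  intro q hq; simp only [iterInputs, Set.mem_union]; tauto

theorem iterInputs_between :
    entries (fun ω : IterData n d p => between ω.X y) ⊆ iterInputs y seed := by
  intro q hq; simp only [iterInputs, Set.mem_union]; tauto

theorem iterInputs_precond :
    entries (fun ω : IterData n d p => ω.precond y seed) ⊆ iterInputs y seed := by
  intro q hq; simp only [iterInputs, Set.mem_union]; tauto

theorem iterInputs_precond_inv :
    entries (fun ω : IterData n d p => (ω.precond y seed)⁻¹) ⊆ iterInputs y seed := by
  intro q hq; simp only [iterInputs, Set.mem_union]; tauto

theorem iterInputs_W : entries (fun ω : IterData n d p => ω.W) ⊆ iterInputs y seed := by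
  intro q hq; simp only [iterInputs, Set.mem_union]; tauto

theorem iterInputs_η : entries (fun ω : IterData n d p => ω.η) ⊆ iterInputs y seed := by
  intro q hq; simp only [iterInputs, Set.mem_union]; tauto

theorem iterInputs_μ (j : Fin p) :
    (fun ω : IterData n d p => ω.μ j) ∈ iterInputs y seed := by
  simp only [iterInputs, Set.mem_union]
  exact .inl (.inr ⟨j, rfl⟩)

theorem iterInputs_scalar {q : IterData n d p → ℝ}
    (hq : q ∈ ({fun ω => ω.lam, fun ω => ω.t₀, fun ω => ω.τ, fun ω => ω.c} :
      Set (IterData n d p → ℝ))) : q ∈ iterInputs y seed := by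
  simp only [iterInputs, Set.mem_union]
  exact .inr hq

/-- `S_w + λI`, depending on the instance. -/
noncomputable abbrev iterB (y : Fin n → Fin l) (ω : IterData n d p) : Matrix (Fin d) (Fin d) ℝ :=
  regScatterW ω.X y ω.lam

/-- `f_FDA`, depending on the instance. -/
noncomputable abbrev iterCost (y : Fin n → Fin l) (ω : IterData n d p) :
    Matrix (Fin d) (Fin p) ℝ → ℝ := fdaCost ω.X y ω.μ

/-- The matrix `B` is never formed: `BZ = X̂ᵀ(X̂Z) + λZ` takes two sparse products, which is the
origin of the term `nnz(X̂)p`. -/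
theorem Gen.regScatterW_mul (hN : StepBound l d p E'.card N) (hD : D ⊆ iterDomain y seed E E')
    (hS : iterInputs y seed ⊆ S) {Z : IterData n d p → Matrix (Fin d) (Fin p) ℝ}
    (hZ : Gen D S T (entries Z)) :
    Gen D S (T + 6 * N) (entries fun ω => iterB y ω * Z ω) := by
  refine hZ.bind ?_
  have hZ1 : Gen D (S ∪ entries Z) 0 (entries Z) := .of_subset Set.subset_union_right
  have hX : Gen D (S ∪ entries Z) 0 (entries fun ω : IterData n d p => centered ω.X y) :=
    .of_subset ((iterInputs_centered.trans hS).trans Set.subset_union_left)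
  have hlam : Gen D (S ∪ entries Z) 0 {fun ω : IterData n d p => ω.lam} :=
    .of_mem (.inl (hS (iterInputs_scalar (by simp))))
  have hE : ∀ ω ∈ D, sparsity (centered ω.X y) ⊆ E' := fun ω hω => (hD hω).2.1
  refine (((Gen.sparseTransposeMul hE hX (Gen.sparseMul hE hX hZ1)).matAdd
    (hlam.matSmul hZ1)).le ?_).entries_congr fun ω _ => ?_
  · have := hN.ep
    have := hN.dp
    omega
  · rw [iterB, regScatterW_eq, regGram, Matrix.add_mul, Matrix.mul_assoc, Matrix.smul_mul,
      Matrix.one_mul]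

theorem Gen.between_mul (hS : iterInputs y seed ⊆ S)
    {Z : IterData n d p → Matrix (Fin d) (Fin p) ℝ} (hZ : Gen D S T (entries Z)) :
    Gen D S (T + 2 * (l * d * p)) (entries fun ω => between ω.X y * Z ω) := by
  simpa using (Gen.of_subset (D := D) (S := S) (iterInputs_between.trans hS)).matMul hZ

/-- With `S_B = ŶᵀŶ` the cost is a weighted sum of the squared column norms of `ŶZ`, so `S_B` need
not be formed. -/
theorem Gen.fdaCost (hN : StepBound l d p E'.card N)
    (hS : iterInputs y seed ⊆ S) {Z : IterData n d p → Matrix (Fin d) (Fin p) ℝ}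
    (hZ : Gen D S T (entries Z)) : Gen D S (T + 7 * N) {fun ω => iterCost y ω (Z ω)} := by
  refine ((Gen.between_mul (seed := seed) hS hZ).bind (T₂ := 2 * (l * p) + 3 * p) ?_).le ?_
  · have hV : Gen D (S ∪ entries fun ω => between ω.X y * Z ω) 0
        (entries fun ω => between ω.X y * Z ω) := .of_subset Set.subset_union_right
    refine (((Gen.const (-(1 / 2))).mul (Gen.sum_const (t := Finset.univ) fun j _ =>
      ((hV.coords_col j).dotProduct (hV.coords_col j)).mul
        (Gen.of_mem (.inl (hS (iterInputs_μ j)))))).le ?_).congr fun ω _ => ?_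
    · simp only [Finset.card_univ, Fintype.card_fin]
      have := hN.pos_p
      nlinarith
    · rw [iterCost, fdaCost_eq]
      push_cast
      rfl
  · have := hN.ldp
    have := hN.lp
    have := hN.p_le
    omega

theorem Gen.euclideanGradient (hN : StepBound l d p E'.card N)
    (hS : iterInputs y seed ⊆ S) {Z : IterData n d p → Matrix (Fin d) (Fin p) ℝ}
    (hZ : Gen D S T (entries Z)) :
    Gen D S (T + 6 * N) (entries fun ω => euclideanGradient (iterCost y ω) (Z ω)) := by
  have hY : Gen D S 0 (entries fun ω : IterData n d p => between ω.X y) :=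
    .of_subset (iterInputs_between.trans hS)
  refine ((hY.matTranspose.matMul (Gen.between_mul (seed := seed) hS hZ)).bind
    (T₂ := d * p * 2) ?_).le ?_
  · set A := fun ω : IterData n d p => (between ω.X y)ᵀ * (between ω.X y * Z ω)
    have hA : Gen D (S ∪ entries A) 0 (entries A) := .of_subset Set.subset_union_right
    refine Gen.ofEntries_const (T := 2) fun i j => ?_
    refine (((hA.entry i j).mul (Gen.of_mem (.inl (hS (iterInputs_μ j))))).neg.le
      (by simp)).congr fun ω _ => ?_
    rw [iterCost, euclideanGradient_fdaCost, Matrix.neg_apply, Matrix.mul_diagonal, scatterB_eq,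
      Matrix.mul_assoc]
  · have h1 := hN.ldp
    have h2 := hN.dp
    have h3 : d * l * p = l * d * p := by ring
    omega

theorem Gen.iterProj (hN : StepBound l d p E'.card N) (hD : D ⊆ iterDomain y seed E E')
    (hS : iterInputs y seed ⊆ S) {Z ζ : IterData n d p → Matrix (Fin d) (Fin p) ℝ}
    (hZi : ∀ ω ∈ D, Function.Injective (Z ω).mulVec)
    (hBZ : Gen D S 0 (entries fun ω => iterB y ω * Z ω)) (hζ : Gen D S T (entries ζ)) :
    Gen D S (T + 140 * N) (entries fun ω =>
      (SketchedFDA.tangentProj (iterB y ω) (ω.precond y seed) (Z ω) (ζ ω) : Matrix (Fin d) (Fin p) ℝ)) := by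
  refine (Gen.tangentProj (fun ω hω => (hD hω).2.2.2.2.1) (fun ω hω => (hD hω).2.2.2.1) hZi hN.le
    (.of_subset (iterInputs_precond_inv.trans hS)) hBZ hζ).le ?_
  have := hN.ddp
  have := hN.dpp
  omega

theorem Gen.riemannianGradient (hN : StepBound l d p E'.card N) (hD : D ⊆ iterDomain y seed E E')
    (hS : iterInputs y seed ⊆ S) {Z : IterData n d p → Matrix (Fin d) (Fin p) ℝ}
    (hZi : ∀ ω ∈ D, Function.Injective (Z ω).mulVec) (hZ : Gen D S 0 (entries Z))
    (hBZ : Gen D S 0 (entries fun ω => iterB y ω * Z ω)) :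
    Gen D S (148 * N) (entries fun ω =>
      riemannianGradient (iterB y ω) (ω.precond y seed) (iterCost y ω) (Z ω)) := by
  have hMi : Gen D S 0 (entries fun ω : IterData n d p => (ω.precond y seed)⁻¹) :=
    .of_subset (iterInputs_precond_inv.trans hS)
  refine (Gen.iterProj hN hD hS hZi hBZ (hMi.matMul (Gen.euclideanGradient hN hS hZ))).le ?_
  have := hN.ddp
  omega

theorem Gen.metric (hN : StepBound l d p E'.card N)
    (hS : iterInputs y seed ⊆ S) {ξ η : IterData n d p → Matrix (Fin d) (Fin p) ℝ}
    (hξ : Gen D S T₁ (entries ξ)) (hη : Gen D S T₂ (entries η)) :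
    Gen D S (T₁ + T₂ + 5 * N) {fun ω => metric p (ω.precond y seed) (ξ ω) (η ω)} := by
  have hM : Gen D S 0 (entries fun ω : IterData n d p => ω.precond y seed) :=
    .of_subset (iterInputs_precond.trans hS)
  refine ((hξ.traceInner (hM.matMul hη)).le ?_).congr fun ω _ => ?_
  · have := hN.ddp
    have := hN.dp
    have := hN.p_le
    omega
  · rw [metric_apply, Matrix.mul_assoc]

theorem isQF_retraction (hD : D ⊆ iterDomain y seed E E') (t : IterData n d p → ℝ) :
    ∀ ω ∈ D, IsQF (iterB y ω) (ω.W + t ω • ω.η) (retraction (iterB y ω) ω.W (t ω • ω.η)) :=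
  fun _ hω => isQF_qf (hD hω).2.2.2.1
    (injective_add_smul (hD hω).2.2.2.1 (hD hω).2.2.2.2.2.2.2.1 (hD hω).2.2.2.2.2.2.2.2 _)

theorem Gen.retraction (hN : StepBound l d p E'.card N) (hD : D ⊆ iterDomain y seed E E')
    (hS : iterInputs y seed ⊆ S) {t : IterData n d p → ℝ} (ht : Gen D S T {t}) :
    Gen D S (T + 21 * N) (entries (fun ω => retraction (iterB y ω) ω.W (t ω • ω.η)) ∪
      entries fun ω => iterB y ω * retraction (iterB y ω) ω.W (t ω • ω.η)) := by
  have hW : Gen D S 0 (entries fun ω : IterData n d p => ω.W) :=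
    .of_subset (iterInputs_W.trans hS)
  have hη : Gen D S 0 (entries fun ω : IterData n d p => ω.η) :=
    .of_subset (iterInputs_η.trans hS)
  refine ((hW.matAdd (ht.matSmul hη)).bind (T₂ := 6 * N + 13 * (d * p * p)) ?_).le ?_
  · set Y := fun ω : IterData n d p => ω.W + t ω • ω.η
    have hY : Gen D (S ∪ entries Y) 0 (entries Y) := .of_subset Set.subset_union_right
    refine ((Gen.regScatterW_mul hN hD (hS.trans Set.subset_union_left) hY).bind
      (T₂ := 13 * (d * p * p)) ?_).le (by omega)
    exact Gen.isQF (Y := Y) (isQF_retraction hD t) hN.pos_d (hY.mono subset_rfl Set.subset_union_left)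
      (.of_subset Set.subset_union_right)
  · have := hN.dpp
    have := hN.dp
    omega

/-- The line search, followed by the retraction. -/
theorem Gen.backtrack (hN : StepBound l d p E'.card N)
    {v m : IterData n d p → ℝ} (L : ℕ) :
    ∀ (D : Set (IterData n d p)) (S : Set (IterData n d p → ℝ)) (t : IterData n d p → ℝ),
      D ⊆ iterDomain y seed E E' → iterInputs y seed ⊆ S → Gen D S 0 {v} → Gen D S 0 {m} →
      Gen D S 0 {t} →
      Gen D S (L * (33 * N) + 21 * N)
        (entries (fun ω => SketchedFDA.retraction (iterB y ω) ω.W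
          (backtrack (fun t => iterCost y ω (SketchedFDA.retraction (iterB y ω) ω.W (t • ω.η)) ≤
            v ω + ω.c * t * m ω) ω.τ L (t ω) • ω.η)) ∪
        entries fun ω => iterB y ω * SketchedFDA.retraction (iterB y ω) ω.W
          (backtrack (fun t => iterCost y ω (SketchedFDA.retraction (iterB y ω) ω.W (t • ω.η)) ≤
            v ω + ω.c * t * m ω) ω.τ L (t ω) • ω.η)) := by
  induction L with
  | zero =>
    intro D S t hD hS hv hm ht
    exact (Gen.retraction hN hD hS ht).le (by omega)
  | succ L ih =>
    intro D S t hD hS hv hm ht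
    refine ((Gen.retraction hN hD hS ht).bind (T₂ := L * (33 * N) + 33 * N) ?_).le
      (by apply le_of_eq; ring)
    set S₁ := S ∪ (entries (fun ω => SketchedFDA.retraction (iterB y ω) ω.W (t ω • ω.η)) ∪
      entries fun ω => iterB y ω * SketchedFDA.retraction (iterB y ω) ω.W (t ω • ω.η))
    have hS₁ : S ⊆ S₁ := Set.subset_union_left
    have hr : Gen D S₁ 0 (entries (fun ω => SketchedFDA.retraction (iterB y ω) ω.W (t ω • ω.η)) ∪
      entries fun ω => iterB y ω * SketchedFDA.retraction (iterB y ω) ω.W (t ω • ω.η)) :=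
      .of_subset Set.subset_union_right
    have hc : Gen D S₁ 0 {fun ω : IterData n d p => ω.c} :=
      .of_mem (hS₁ (hS (iterInputs_scalar (by simp))))
    have hτ : Gen D S₁ 0 {fun ω : IterData n d p => ω.τ} :=
      .of_mem (hS₁ (hS (iterInputs_scalar (by simp))))
    have hf := Gen.fdaCost hN (hS.trans hS₁) (hr.subset Set.subset_union_left)
    have hrhs := (hv.mono (D' := D) subset_rfl hS₁).add
      ((hc.mul (ht.mono subset_rfl hS₁)).mul (hm.mono subset_rfl hS₁))
    -- If the trial is accepted, its retraction and the product with `B` are already available.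
    -- Otherwise the search continues at `τt`. Retraction, cost and test take at most `28N + 5 ≤
    -- 33N` operations per trial.
    refine (hf.branch hrhs (T₃ := 0) (T₄ := 1 + (L * (33 * N) + 21 * N)) ?_ ?_).le ?_
    · refine (hr.mono Set.inter_subset_left subset_rfl).known ?_
      rintro q (⟨i, j, rfl⟩ | ⟨i, j, rfl⟩)
      · refine ⟨_, .inl (mem_entries _ i j), fun ω hω => ?_⟩
        have h := hω.2
        simp only [Set.mem_ofPred_eq] at h
        simp only [SketchedFDA.backtrack, if_pos h]
      · refine ⟨_, .inr (mem_entries _ i j), fun ω hω => ?_⟩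
        have h := hω.2
        simp only [Set.mem_ofPred_eq] at h
        simp only [SketchedFDA.backtrack, if_pos h]
    · refine (hτ.mul (ht.mono subset_rfl hS₁) |>.mono Set.inter_subset_left subset_rfl).bind
        (T₁ := 1) ?_
      have := ih (D ∩ {ω | v ω + ω.c * t ω * m ω <
          iterCost y ω (SketchedFDA.retraction (iterB y ω) ω.W (t ω • ω.η))})
        (S₁ ∪ {fun ω => ω.τ * t ω}) (fun ω => ω.τ * t ω) (Set.inter_subset_left.trans hD)
        ((hS.trans hS₁).trans Set.subset_union_left)
        (hv.mono Set.inter_subset_left (hS₁.trans Set.subset_union_left))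
        (hm.mono Set.inter_subset_left (hS₁.trans Set.subset_union_left))
        (.of_subset Set.subset_union_right)
      refine this.known ?_
      rintro q (⟨i, j, rfl⟩ | ⟨i, j, rfl⟩)
      · refine ⟨_, .inl (mem_entries _ i j), fun ω hω => ?_⟩
        have h := not_le.2 (Set.mem_ofPred_eq .. ▸ hω.2)
        simp only [SketchedFDA.backtrack, if_neg h]
      · refine ⟨_, .inr (mem_entries _ i j), fun ω hω => ?_⟩
        have h := not_le.2 (Set.mem_ofPred_eq .. ▸ hω.2)
        simp only [SketchedFDA.backtrack, if_neg h]
    · have := hN.one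
      rw [max_eq_right (by omega)]
      omega

theorem Gen.beta {Ω : Type} {D : Set Ω} {S : Set (Ω → ℝ)} (rule : CGRule) {a b c e : Ω → ℝ}
    (ha : Gen D S 0 {a}) (hb : Gen D S 0 {b}) (hc : Gen D S 0 {c}) (he : Gen D S 0 {e}) :
    Gen D S 2 {fun ω => rule.beta (a ω) (b ω) (c ω) (e ω)} := by
  have h0 : Gen D S 0 {fun _ : Ω => (0 : ℝ)} := by simpa using Gen.const (D := D) (S := S) 0
  cases rule with
  | fletcherReeves => exact (ha.div hc).le (by simp)
  | polakRibiere => exact (hb.div hc).le (by simp)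
  | polakRibierePlus => exact (h0.maximum (hb.div hc)).le (by simp)
  | hestenesStiefel => exact (hb.div he).le (by simp)
  | hestenesStiefelPlus => exact (h0.maximum (hb.div he)).le (by simp)
  | daiYuan => exact (ha.div he).le (by simp)

/-- One iteration of Riemannian conjugate gradient. -/
theorem Gen.cgStep (hN : StepBound l d p E'.card N) (hD : D ⊆ iterDomain y seed E E')
    (hS : iterInputs y seed ⊆ S) (rule : CGRule) (L : ℕ) :
    Gen D S ((L + 1) * (800 * N))
      (entries (fun ω => (cgStep (iterB y ω) (ω.precond y seed) (iterCost y ω) rule L ω.t₀ ω.τ ω.c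
        ω.W ω.η).1) ∪
      entries (fun ω => (cgStep (iterB y ω) (ω.precond y seed) (iterCost y ω) rule L ω.t₀ ω.τ ω.c
        ω.W ω.η).2)) := by
  set B : IterData n d p → Matrix (Fin d) (Fin d) ℝ := iterB y with hB
  set M : IterData n d p → Matrix (Fin d) (Fin d) ℝ := fun ω => ω.precond y seed with hM
  set f : IterData n d p → Matrix (Fin d) (Fin p) ℝ → ℝ := iterCost y with hf
  set G : IterData n d p → Matrix (Fin d) (Fin p) ℝ := fun ω =>
    SketchedFDA.riemannianGradient (B ω) (M ω) (f ω) ω.W with hG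
  set v : IterData n d p → ℝ := fun ω => f ω ω.W with hv
  set m : IterData n d p → ℝ := fun ω => SketchedFDA.metric p (M ω) (G ω) ω.η with hm
  set t : IterData n d p → ℝ := fun ω => SketchedFDA.backtrack
    (fun t => f ω (SketchedFDA.retraction (B ω) ω.W (t • ω.η)) ≤ v ω + ω.c * t * m ω) ω.τ L ω.t₀
    with ht
  set W' : IterData n d p → Matrix (Fin d) (Fin p) ℝ := fun ω =>
    SketchedFDA.retraction (B ω) ω.W (t ω • ω.η) with hW'
  set G' : IterData n d p → Matrix (Fin d) (Fin p) ℝ := fun ω =>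
    SketchedFDA.riemannianGradient (B ω) (M ω) (f ω) (W' ω) with hG'
  set P : IterData n d p → Matrix (Fin d) (Fin p) ℝ := fun ω =>
    (SketchedFDA.tangentProj (B ω) (M ω) (W' ω) (G ω) : Matrix (Fin d) (Fin p) ℝ) with hP
  set Q : IterData n d p → Matrix (Fin d) (Fin p) ℝ := fun ω =>
    (SketchedFDA.tangentProj (B ω) (M ω) (W' ω) ω.η : Matrix (Fin d) (Fin p) ℝ) with hQ
  set R : IterData n d p → Matrix (Fin d) (Fin p) ℝ := fun ω => G' ω - P ω with hR
  set β : IterData n d p → ℝ := fun ω => rule.beta (SketchedFDA.metric p (M ω) (G' ω) (G' ω))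
    (SketchedFDA.metric p (M ω) (G' ω) (R ω)) (SketchedFDA.metric p (M ω) (G ω) (G ω))
    (SketchedFDA.metric p (M ω) (Q ω) (R ω)) with hβ
  -- With these names the iteration is unfolded by definition: `P` and `Q` are the transported old
  -- gradient and direction, `R` is the gradient difference entering `β`.
  change Gen D S _ (entries W' ∪ entries fun ω => -G' ω + β ω • Q ω)
  have hdp := hN.dp
  have hone := hN.one
  have hWinj : ∀ ω ∈ D, Function.Injective ω.W.mulVec := fun ω hω =>
    injective_of_mem_stiefel (hD hω).2.2.2.2.2.2.2.1
  have hW'inj : ∀ ω ∈ D, Function.Injective (W' ω).mulVec := fun ω hω =>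
    injective_of_mem_stiefel (isQF_retraction hD t ω hω).1
  have hW : Gen D S 0 (entries fun ω : IterData n d p => ω.W) :=
    .of_subset (iterInputs_W.trans hS)
  refine ((Gen.regScatterW_mul hN hD hS hW).bind (T₂ := 794 * N + L * (800 * N)) ?_).le
    (by apply le_of_eq; ring)
  set S₁ := S ∪ entries fun ω => B ω * ω.W
  have hS₁ : S ⊆ S₁ := Set.subset_union_left
  have hG1 := Gen.riemannianGradient hN hD (hS.trans hS₁) hWinj (hW.mono (D' := D) subset_rfl hS₁)
    (.of_subset Set.subset_union_right)
  refine (hG1.bind (T₂ := 640 * N + L * (800 * N)) ?_).le (by omega)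
  set S₂ := S₁ ∪ entries G
  have hS₂ : S ⊆ S₂ := hS₁.trans Set.subset_union_left
  have hG2 : Gen D S₂ 0 (entries G) := .of_subset Set.subset_union_right
  have hη2 : Gen D S₂ 0 (entries fun ω : IterData n d p => ω.η) :=
    .of_subset ((iterInputs_η.trans hS).trans hS₂)
  refine (((Gen.fdaCost hN (hS.trans hS₂) (hW.mono (D' := D) subset_rfl hS₂)).union
    (Gen.metric hN (hS.trans hS₂) hG2 hη2)).bind
    (T₂ := 600 * N + L * (800 * N)) ?_).le (by omega)
  change Gen D (S₂ ∪ ({v} ∪ {m})) _ _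
  set S₃ := S₂ ∪ ({v} ∪ {m})
  have hS₃ : S ⊆ S₃ := hS₂.trans Set.subset_union_left
  have hback := Gen.backtrack hN (v := v) (m := m) L D S₃ (fun ω => ω.t₀) hD (hS.trans hS₃)
    (.of_subset fun q hq => .inr (.inl hq)) (.of_subset fun q hq => .inr (.inr hq))
    (.of_mem (hS₃ (hS (iterInputs_scalar (by simp)))))
  refine (hback.bind (T₂ := 570 * N) ?_).le (by nlinarith [Nat.zero_le (L * N)])
  change Gen D (S₃ ∪ (entries W' ∪ entries fun ω => B ω * W' ω)) _ _
  set S₄ := S₃ ∪ (entries W' ∪ entries fun ω => B ω * W' ω)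
  have hS₄ : S ⊆ S₄ := hS₃.trans Set.subset_union_left
  have hW4 : Gen D S₄ 0 (entries W') := .of_subset fun q hq => .inr (.inl hq)
  have hBW4 : Gen D S₄ 0 (entries fun ω => B ω * W' ω) := .of_subset fun q hq => .inr (.inr hq)
  have hG4 : Gen D S₄ 0 (entries G) := .of_subset fun q hq => .inl (.inl (.inr hq))
  have hη4 : Gen D S₄ 0 (entries fun ω : IterData n d p => ω.η) :=
    .of_subset ((iterInputs_η.trans hS).trans hS₄)
  refine (((Gen.riemannianGradient hN hD (hS.trans hS₄) hW'inj hW4 hBW4).union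
    ((Gen.iterProj hN hD (hS.trans hS₄) hW'inj hBW4 hG4).union
    (Gen.iterProj hN hD (hS.trans hS₄) hW'inj hBW4 hη4))).bind (T₂ := 30 * N) ?_).le (by omega)
  change Gen D (S₄ ∪ (entries G' ∪ (entries P ∪ entries Q))) _ _
  set S₅ := S₄ ∪ (entries G' ∪ (entries P ∪ entries Q))
  have hS₅ : S ⊆ S₅ := hS₄.trans Set.subset_union_left
  have hW5 : Gen D S₅ 0 (entries W') := hW4.mono subset_rfl Set.subset_union_left
  have hG5 : Gen D S₅ 0 (entries G) := hG4.mono subset_rfl Set.subset_union_left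
  have hG'5 : Gen D S₅ 0 (entries G') := .of_subset fun q hq => .inr (.inl hq)
  have hP5 : Gen D S₅ 0 (entries P) := .of_subset fun q hq => .inr (.inr (.inl hq))
  have hQ5 : Gen D S₅ 0 (entries Q) := .of_subset fun q hq => .inr (.inr (.inr hq))
  refine ((hG'5.matSub hP5).bind (T₂ := 29 * N) ?_).le (by omega)
  change Gen D (S₅ ∪ entries R) _ _
  have hR6 : Gen D (S₅ ∪ entries R) 0 (entries R) := .of_subset Set.subset_union_right
  have hup := Set.subset_union_left (s := S₅) (t := entries R)
  have hG'6 := hG'5.mono (D' := D) subset_rfl hup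
  have hG6 := hG5.mono (D' := D) subset_rfl hup
  have hQ6 := hQ5.mono (D' := D) subset_rfl hup
  refine (((Gen.metric hN (hS.trans (hS₅.trans hup)) hG'6 hG'6).union
    ((Gen.metric hN (hS.trans (hS₅.trans hup)) hG'6 hR6).union
    ((Gen.metric hN (hS.trans (hS₅.trans hup)) hG6 hG6).union
    (Gen.metric hN (hS.trans (hS₅.trans hup)) hQ6 hR6)))).bind (T₂ := 9 * N) ?_).le (by omega)
  refine ((Gen.beta rule (.of_subset fun q hq => .inr (.inl hq))
    (.of_subset fun q hq => .inr (.inr (.inl hq)))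
    (.of_subset fun q hq => .inr (.inr (.inr (.inl hq))))
    (.of_subset fun q hq => .inr (.inr (.inr (.inr hq))))).bind (T₂ := 7 * N) ?_).le (by omega)
  have hup' := (hup.trans (Set.subset_union_left (t :=
    {fun ω => SketchedFDA.metric p (M ω) (G' ω) (G' ω)} ∪
    ({fun ω => SketchedFDA.metric p (M ω) (G' ω) (R ω)} ∪
    ({fun ω => SketchedFDA.metric p (M ω) (G ω) (G ω)} ∪
    {fun ω => SketchedFDA.metric p (M ω) (Q ω) (R ω)}))))).trans
    (Set.subset_union_left (t := {β}))
  refine (((hW5.mono subset_rfl hup').union (((Gen.const (-1)).matSmul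
    (hG'5.mono subset_rfl hup')).matAdd (Gen.matSmul (c := β) (.of_subset Set.subset_union_right)
    (hQ5.mono subset_rfl hup')))).le (by omega)).subset ?_
  refine Set.union_subset_union_right _ (Eq.subset ?_)
  congr 1
  ext ω i j
  simp

end Iteration

end SketchedFDA

namespace SketchedFDA

/-! ### The cost of the preprocessing -/

section Preprocessing

variable {n d l p s : ℕ}

theorem sum_classSize (y : Fin n → Fin l) : ∑ k, classSize y k = n := by
  have := Finset.card_eq_sum_card_fiberwise (s := Finset.univ) (t := Finset.univ) (f := y) (by simp)
  simpa [classSize] using this.symm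

theorem known_pairOut {Ω : Type} {D : Set Ω} {a b a' b' : ℕ} (A : Ω → Matrix (Fin a) (Fin b) ℝ)
    (A' : Ω → Matrix (Fin a') (Fin b') ℝ) (k : (Fin a × Fin b) ⊕ (Fin a' × Fin b')) :
    Known D (entries A ∪ entries A') fun ω => pairOut (A ω) (A' ω) k := by
  rcases k with ⟨i, j⟩ | ⟨i, j⟩
  · exact .of_mem (.inl ⟨i, j, rfl⟩)
  · exact .of_mem (.inr ⟨i, j, rfl⟩)

/-- Each sample enters exactly one class sum, so all class means together cost about `nd + ld`, and
surjectivity of the labelling gives `l ≤ n`. The labels belong to the tree, so class sizes and their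
inverses are free rational constants; only their square roots are counted. -/
theorem computableWithin_centered_between (hl : 0 < l) {y : Fin n → Fin l}
    (hy : Function.Surjective y) :
    ComputableWithin (fun X : Matrix (Fin n) (Fin d) ℝ => pairOut (centered X y) (between X y))
      Set.univ (entries fun X => X) (8 * (n * d)) := by
  have hln : l * d ≤ n * d := by
    have := Fintype.card_le_of_surjective y hy
    simp only [Fintype.card_fin] at this
    gcongr
  set S : Set (Matrix (Fin n) (Fin d) ℝ → ℝ) := entries fun X => X
  have hX : Gen Set.univ S 0 (entries fun X : Matrix (Fin n) (Fin d) ℝ => X) :=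
    .of_subset subset_rfl
  have hmean : Gen Set.univ S (2 * (n * d))
      (entries fun X : Matrix (Fin n) (Fin d) ℝ => Matrix.of (classMean X y)) := by
    refine (Gen.ofEntries (T := fun k _ => classSize y k + 1) fun k j => ?_).le ?_
    · refine (((Gen.const ((classSize y k : ℚ)⁻¹)).mul (Gen.sum_const (T := 0)
        (t := Finset.univ.filter fun i => y i = k) fun i _ => hX.entry i j)).le ?_).congr
        fun X _ => ?_
      · simp [classSize]
      · simp [classMean]
    · simp only [Finset.sum_const, Finset.card_univ, Fintype.card_fin, smul_eq_mul,
        ← Finset.mul_sum, Finset.sum_add_distrib, sum_classSize]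
      nlinarith
  have htotal : Gen Set.univ S (d * (n + 1))
      (coords fun X : Matrix (Fin n) (Fin d) ℝ => totalMean X) := by
    refine (Gen.coords_const (T := n + 1) fun j => ?_).le (by simp)
    refine (((Gen.const ((n : ℚ)⁻¹)).mul (Gen.sum_const (T := 0)
        (t := Finset.univ) fun i _ => hX.entry i j)).le ?_).congr
        fun X _ => ?_
    · simp
    · simp [totalMean]
  have hall := hmean.union htotal
  refine (hall.bind (T₂ := n * d * 1 + l * d * 3) ?_).computableWithin ?_
    (known_pairOut (fun X => centered X y) fun X => between X y)
  · refine Gen.union (Gen.ofEntries_const fun i j => ?_) (Gen.ofEntries_const fun k j => ?_)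
    · exact ((Gen.of_mem (a := fun X : Matrix (Fin n) (Fin d) ℝ => X i j) (.inl ⟨i, j, rfl⟩)).sub
        (Gen.of_mem (a := fun X : Matrix (Fin n) (Fin d) ℝ => classMean X y (y i) j)
          (.inr (.inl ⟨y i, j, rfl⟩)))).le (by simp)
    · refine (((Gen.const (classSize y k : ℚ)).sqrt.mul
        ((Gen.of_mem (a := fun X : Matrix (Fin n) (Fin d) ℝ => classMean X y k j)
          (.inr (.inl ⟨k, j, rfl⟩))).sub
        (Gen.of_mem (a := fun X : Matrix (Fin n) (Fin d) ℝ => totalMean X j)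
          (.inr (.inr ⟨j, rfl⟩))))).le (by simp)).congr fun X _ => ?_
      simp [between]
  · have hd : d ≤ l * d := Nat.le_mul_of_pos_left _ hl
    nlinarith

/-- The hash function sends each position of `E'` to exactly one entry of the product, to which it
contributes one signed summand. The fibres partition `E'`, at two operations per element. -/
theorem computableWithin_sketch (seed : SketchSeed n s) (E' : Finset (Fin n × Fin d)) :
    ComputableWithin
      (fun (Z : Matrix (Fin n) (Fin d) ℝ) (ij : Fin s × Fin d) =>
        (countSketch seed * Z) ij.1 ij.2)
      {Z | sparsity Z ⊆ E'} (entries fun Z => Z) (2 * E'.card) := by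
  classical
  have hZ : Gen {Z | sparsity Z ⊆ E'} (entries fun Z => Z) 0
    (entries fun Z : Matrix (Fin n) (Fin d) ℝ => Z) := .of_subset subset_rfl
  refine (Gen.ofEntries (A := fun Z : Matrix (Fin n) (Fin d) ℝ => countSketch seed * Z)
    (T := fun i j => (E'.filter fun rj => (seed.1 rj.1, rj.2) = (i, j)).card * 2)
    fun i j => ?_).computableWithin (le_of_eq ?_) fun ij => .of_mem ⟨ij.1, ij.2, rfl⟩
  · refine (Gen.sum_const (T := 1)
      (q := fun rj Z => ((if seed.2 rj.1 then 1 else -1 : ℚ) : ℝ) * Z rj.1 rj.2)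
      fun rj _ => ((Gen.const _).mul (hZ.entry rj.1 rj.2)).le (by simp)).congr
      fun Z hZ => ?_
    have e : (countSketch seed * Z) i j = ∑ rj : Fin n × Fin d,
        if (seed.1 rj.1, rj.2) = (i, j) then
          ((if seed.2 rj.1 then 1 else -1 : ℚ) : ℝ) * Z rj.1 rj.2 else 0 := by
      rw [Matrix.mul_apply, Fintype.sum_prod_type]
      refine Finset.sum_congr rfl fun r _ => ?_
      rw [Finset.sum_eq_single j]
      · by_cases h : seed.1 r = i <;> by_cases h' : seed.2 r <;> simp [countSketch, h, h']
      · intro j' _ hj'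
        simp [hj']
      · simp
    rw [e, Finset.sum_filter]
    symm
    refine Finset.sum_subset (Finset.subset_univ _) fun rj _ h => ?_
    have : Z rj.1 rj.2 = 0 := by
      by_contra h0
      exact h (hZ (by simpa [sparsity] using h0))
    simp [this]
  · rw [← Fintype.sum_prod_type' (f := fun i j =>
      (E'.filter fun rj => (seed.1 rj.1, rj.2) = (i, j)).card * 2), ← Finset.sum_mul, mul_comm 2]
    congr 1
    exact (Finset.card_eq_sum_card_fiberwise (f := fun rj : Fin n × Fin d => (seed.1 rj.1, rj.2))
      (t := Finset.univ) (by simp)).symm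

/-- The cubic cost of the inversion is absorbed by that of the Gram matrix since `d ≤ s`. -/
theorem computableWithin_regGram (hds : d ≤ s) :
    ComputableWithin
      (fun ω : Matrix (Fin s) (Fin d) ℝ × ℝ => pairOut (regGram ω.1 ω.2) (regGram ω.1 ω.2)⁻¹)
      {ω | 0 ≤ ω.2 ∧ (regGram ω.1 ω.2).PosDef}
      (entries (fun ω => ω.1) ∪ {fun ω => ω.2}) (13 * (s * d ^ 2 + d ^ 2)) := by
  set D : Set (Matrix (Fin s) (Fin d) ℝ × ℝ) := {ω | 0 ≤ ω.2 ∧ (regGram ω.1 ω.2).PosDef}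
  set S : Set (Matrix (Fin s) (Fin d) ℝ × ℝ → ℝ) := entries (fun ω => ω.1) ∪ {fun ω => ω.2}
  have hA : Gen D S 0 (entries fun ω => ω.1) := .of_subset Set.subset_union_left
  have hlam : Gen D S 0 {fun ω => ω.2} := .of_subset Set.subset_union_right
  have hM : Gen D S _ (entries fun ω => regGram ω.1 ω.2) :=
    (hA.matTranspose.matMul hA).matAdd (hlam.matSmul Gen.matOne)
  have hM' : Gen D (S ∪ entries fun ω => regGram ω.1 ω.2) 0
    (entries fun ω => regGram ω.1 ω.2) := .of_subset Set.subset_union_right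
  refine (hM.bind (hM'.union (hM'.inv_posDef fun ω hω => hω.2))).computableWithin ?_
    (known_pairOut _ _)
  have : d ^ 3 ≤ s * d ^ 2 := by
    calc d ^ 3 = d * d ^ 2 := by ring
      _ ≤ s * d ^ 2 := by gcongr
  nlinarith

theorem computableWithin_cgStep (hp : 0 < p) (hpl : p < l) (hld : l ≤ d) (y : Fin n → Fin l)
    (seed : SketchSeed n s) (E E' : Finset (Fin n × Fin d)) (rule : CGRule) (L : ℕ) :
    ComputableWithin
      (fun ω : IterData n d p =>
        let next := cgStep (regScatterW ω.X y ω.lam) (ω.precond y seed)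
          (fdaCost ω.X y ω.μ) rule L ω.t₀ ω.τ ω.c ω.W ω.η
        pairOut next.1 next.2)
      (iterDomain y seed E E') (iterInputs y seed)
      (800 * (L + 1) * (p * (E.card + l * d) + E'.card * p + d ^ 2 * p + d * p ^ 2)) := by
  have hN : StepBound l d p E'.card
      (p * (E.card + l * d) + E'.card * p + d ^ 2 * p + d * p ^ 2) :=
    { pos_d := by omega
      pos_p := hp
      le := by omega
      ldp := by nlinarith [Nat.zero_le (p * E.card), Nat.zero_le (E'.card * p),
        Nat.zero_le (d ^ 2 * p), Nat.zero_le (d * p ^ 2)]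
      ep := by nlinarith [Nat.zero_le (p * (E.card + l * d)),
        Nat.zero_le (d ^ 2 * p), Nat.zero_le (d * p ^ 2)]
      ddp := by nlinarith [Nat.zero_le (p * (E.card + l * d)), Nat.zero_le (E'.card * p),
        Nat.zero_le (d * p ^ 2)]
      dpp := by nlinarith [Nat.zero_le (p * (E.card + l * d)), Nat.zero_le (E'.card * p),
        Nat.zero_le (d ^ 2 * p)] }
  exact (Gen.cgStep (y := y) (seed := seed) (E := E) hN subset_rfl subset_rfl rule
    L).computableWithin (by apply le_of_eq; ring) (known_pairOut _ _)

end Preprocessing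

end SketchedFDA

namespace SketchedFDA

/-! ### The Riemannian Hessian at a critical point -/

section Hessian

variable {d p : ℕ} {B M : Matrix (Fin d) (Fin d) ℝ} {W ζ ξ : Matrix (Fin d) (Fin p) ℝ}

theorem tangentProj_of_mem (hM : M.PosDef) (hξ : ξ ∈ tangentSpace B W) :
    tangentProj B M W ξ = ⟨ξ, hξ⟩ :=
  tangentProj_of_sub_mem hM hξ (by simp)

theorem tangentProj_eq_of_sub_mem (hM : M.PosDef) (h : ζ - ξ ∈ normalSpace B M W) :
    tangentProj B M W ζ = tangentProj B M W ξ := by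
  rw [← sub_eq_zero, ← map_sub]
  have := tangentProj_of_sub_mem (ζ := ζ - ξ) (ξ := 0) hM (zero_mem (tangentSpace B W)) (by simpa)
  rw [this]
  rfl

theorem metric_tangentProj (hM : M.PosDef) (hξ : ξ ∈ tangentSpace B W) :
    metric p M (tangentProj B M W ζ) ξ = metric p M ζ ξ := by
  have hmem : ζ - (tangentProj B M W ζ : Matrix (Fin d) (Fin p) ℝ) ∈ normalSpace B M W := by
    rw [tangentProj, dif_pos (isCompl_tangentSpace hM)]
    rw [← Submodule.projectionOnto_apply_eq_zero_iff (isCompl_tangentSpace hM), map_sub,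
      Submodule.projectionOnto_apply_left, sub_self]
  have h0 : metric p M ξ (ζ - (tangentProj B M W ζ : Matrix (Fin d) (Fin p) ℝ)) = 0 :=
    (LinearMap.BilinForm.mem_orthogonal_iff.1 hmem) ξ hξ
  rw [map_sub, sub_eq_zero] at h0
  rw [metric_comm hM, ← h0, metric_comm hM]

attribute [local instance] Matrix.normedAddCommGroup Matrix.normedSpace

theorem ContinuousLinearMap.continuousAt_inverse {X F : Type*} [TopologicalSpace X]
    [NormedAddCommGroup F] [NormedSpace ℝ F] [CompleteSpace F] {L : X → F →L[ℝ] F} {x : X}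
    (hL : ContinuousAt L x) (hx : IsUnit (L x)) :
    ContinuousAt (fun z => Ring.inverse (L z)) x := by
  obtain ⟨u, hu⟩ := hx
  have h1 := NormedRing.inverse_continuousAt u
  rw [hu] at h1
  exact ContinuousAt.comp (f := L) h1 hL

theorem ContinuousLinearMap.eventually_isUnit {X F : Type*} [TopologicalSpace X]
    [NormedAddCommGroup F] [NormedSpace ℝ F] [CompleteSpace F] {L : X → F →L[ℝ] F} {x : X}
    (hL : ContinuousAt L x) (hx : IsUnit (L x)) : ∀ᶠ z in nhds x, IsUnit (L z) :=
  hL.eventually (Units.isOpen.mem_nhds hx)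

/-- The Lyapunov operator `S ↦ K S + S K`, as a function of `K`. -/
noncomputable def lyapunovOp (p : ℕ) : Matrix (Fin p) (Fin p) ℝ →L[ℝ]
    Matrix (Fin p) (Fin p) ℝ →L[ℝ] Matrix (Fin p) (Fin p) ℝ :=
  LinearMap.toContinuousBilinearMap
    (LinearMap.mul ℝ (Matrix (Fin p) (Fin p) ℝ) + (LinearMap.mul ℝ (Matrix (Fin p) (Fin p) ℝ)).flip)

theorem lyapunovOp_apply (K S : Matrix (Fin p) (Fin p) ℝ) :
    lyapunovOp p K S = K * S + S * K := rfl

/-- The right-hand side `Wᵀ B ζ + ζᵀ B W` of the Lyapunov equation for the normal component. -/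
noncomputable def normalRhs (p : ℕ) (B : Matrix (Fin d) (Fin d) ℝ) : Matrix (Fin d) (Fin p) ℝ →L[ℝ]
    Matrix (Fin d) (Fin p) ℝ →L[ℝ] Matrix (Fin p) (Fin p) ℝ :=
  LinearMap.toContinuousBilinearMap <| LinearMap.mk₂ ℝ (fun W ζ => Wᵀ * B * ζ + ζᵀ * B * W)
    (by intros; simp [Matrix.add_mul, Matrix.mul_add]; abel) (by intros; simp)
    (by intros; simp [Matrix.add_mul, Matrix.mul_add]; abel) (by intros; simp)

/-- The normal vector `M⁻¹ B W S`. -/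
noncomputable def normalVec (p : ℕ) (B M : Matrix (Fin d) (Fin d) ℝ) : Matrix (Fin d) (Fin p) ℝ →L[ℝ]
    Matrix (Fin p) (Fin p) ℝ →L[ℝ] Matrix (Fin d) (Fin p) ℝ :=
  LinearMap.toContinuousBilinearMap <| LinearMap.mk₂ ℝ (fun W S => M⁻¹ * (B * W) * S)
    (by intros; simp [Matrix.add_mul, Matrix.mul_add]) (by intros; simp)
    (by intros; simp [Matrix.mul_add]) (by intros; simp)

theorem isUnit_lyapunovOp {K : Matrix (Fin p) (Fin p) ℝ} (hK : K.PosDef) :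
    IsUnit (lyapunovOp p K) := by
  have hinj : Function.Injective (lyapunovOp p K).toLinearMap := by
    rw [← LinearMap.ker_eq_bot, LinearMap.ker_eq_bot']
    intro X hX
    exact eq_zero_of_lyapunov hK hX
  exact ⟨ContinuousLinearEquiv.toUnit
    (LinearEquiv.ofInjectiveEndo (lyapunovOp p K).toLinearMap hinj).toContinuousLinearEquiv,
    by ext; rfl⟩

/-- The projection onto the tangent space, as a continuous operator. -/
noncomputable def projOp (B M : Matrix (Fin d) (Fin d) ℝ) (W : Matrix (Fin d) (Fin p) ℝ) :
    Matrix (Fin d) (Fin p) ℝ →L[ℝ] Matrix (Fin d) (Fin p) ℝ :=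
  .id ℝ _ - (normalVec p B M W).comp
    ((Ring.inverse (lyapunovOp p (normalGram B M W))).comp (normalRhs p B W))

/-- Wherever the Lyapunov operator is invertible, the explicit formula agrees with the orthogonal
projection. This is an open condition on `W`, so the projection can be analysed near the manifold
and not just on it. -/
theorem projOp_eq (hM : M.PosDef) (hB : Bᵀ = B) (hK : IsUnit (lyapunovOp p (normalGram B M W)))
    (ζ : Matrix (Fin d) (Fin p) ℝ) : projOp B M W ζ = tangentProj B M W ζ := by
  set S := Ring.inverse (lyapunovOp p (normalGram B M W)) (normalRhs p B W ζ) with hSdef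
  have hinv : ∀ R, lyapunovOp p (normalGram B M W)
      (Ring.inverse (lyapunovOp p (normalGram B M W)) R) = R := fun R =>
    DFunLike.congr_fun (Ring.mul_inverse_cancel _ hK) R
  have hinv' : ∀ R, Ring.inverse (lyapunovOp p (normalGram B M W))
      (lyapunovOp p (normalGram B M W) R) = R := fun R =>
    DFunLike.congr_fun (Ring.inverse_mul_cancel _ hK) R
  have hS : normalGram B M W * S + S * normalGram B M W = Wᵀ * B * ζ + ζᵀ * B * W :=
    hinv (normalRhs p B W ζ)
  have hMi : (M⁻¹)ᵀ = M⁻¹ := transpose_eq_of_posDef hM.inv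
  have hKt : (normalGram B M W)ᵀ = normalGram B M W := by
    simp [normalGram, hMi, hB, Matrix.mul_assoc]
  have hSt : Sᵀ = S := by
    have h2 := congrArg Matrix.transpose hS
    simp only [Matrix.transpose_add, Matrix.transpose_mul, hKt, hB,
      Matrix.transpose_transpose, ← Matrix.mul_assoc] at h2
    have h3 : lyapunovOp p (normalGram B M W) Sᵀ = lyapunovOp p (normalGram B M W) S := by
      rw [lyapunovOp_apply, lyapunovOp_apply, hS, add_comm, h2, add_comm]
    rw [← hinv' Sᵀ, h3, hinv']
  rw [tangentProj_eq hM hB hSt hS]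
  rfl

theorem isUnit_lyapunovOp_normalGram (hM : M.PosDef) (hB : B.PosDef)
    (hW : Function.Injective W.mulVec) : IsUnit (lyapunovOp p (normalGram B M W)) :=
  isUnit_lyapunovOp (normalGram_posDef hM hB hW)

theorem continuous_lyapunovOp_normalGram :
    Continuous fun W : Matrix (Fin d) (Fin p) ℝ => lyapunovOp p (normalGram B M W) := by
  refine (lyapunovOp p).continuous.comp ?_
  unfold normalGram
  fun_prop

theorem continuousAt_projOp (hM : M.PosDef) (hB : B.PosDef)
    (hW : Function.Injective W.mulVec) : ContinuousAt (projOp B M) W := by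
  unfold projOp
  refine continuousAt_const.sub (((normalVec p B M).continuous.continuousAt).clm_comp
    (ContinuousAt.clm_comp ?_ (normalRhs p B).continuous.continuousAt))
  exact ContinuousLinearMap.continuousAt_inverse (F := Matrix (Fin p) (Fin p) ℝ)
    continuous_lyapunovOp_normalGram.continuousAt (isUnit_lyapunovOp_normalGram hM hB hW)

/-- At a zero of `h` the term of the product rule with the derivative of `P` disappears. Continuity
of `P` at the point is enough: `(P z - P x)(h(z - x))` is `o(1)·O(‖z - x‖)`. -/
theorem hasFDerivAt_apply_of_eq_zero {E F : Type*} [NormedAddCommGroup E] [NormedSpace ℝ E]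
    [NormedAddCommGroup F] [NormedSpace ℝ F] {P : E → F →L[ℝ] F} {x : E} (hP : ContinuousAt P x)
    (h : E →L[ℝ] F) (hx : h x = 0) : HasFDerivAt (fun z => P z (h z)) ((P x).comp h) x := by
  rw [hasFDerivAt_iff_isLittleO]
  have h1 : (fun z => P z - P x) =o[nhds x] fun _ => (1 : ℝ) := by
    rw [Asymptotics.isLittleO_one_iff]
    exact tendsto_sub_nhds_zero_iff.2 hP
  have h2 : (fun z => h (z - x)) =O[nhds x] fun z => z - x := h.isBigO_sub _ _
  have h3 : (fun z => ‖P z - P x‖ * ‖h (z - x)‖) =o[nhds x] fun z => 1 * ‖z - x‖ :=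
    h1.norm_left.mul_isBigO h2.norm_norm
  refine Asymptotics.IsBigO.trans_isLittleO (Asymptotics.IsBigO.of_bound 1 ?_) h3 |>.trans_isBigO
    (Asymptotics.IsBigO.of_bound 1 ?_)
  · refine Filter.Eventually.of_forall fun z => ?_
    have e : P z (h z) - P x (h x) - ((P x).comp h) (z - x) = (P z - P x) (h (z - x)) := by
      simp [hx]
    rw [e, one_mul, Real.norm_of_nonneg (by positivity)]
    exact (P z - P x).le_opNorm _
  · exact Filter.Eventually.of_forall fun z => by simp

/-- Let `f` have the Euclidean gradient `Φ W`, with `Φ` linear, and let `Φ W = B W S` with `S`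
symmetric at the point `W`. -/
theorem metric_riemannianHessian (hM : M.PosDef) (hB : B.PosDef) (hW : Function.Injective W.mulVec)
    {f : Matrix (Fin d) (Fin p) ℝ → ℝ}
    (Φ : Matrix (Fin d) (Fin p) ℝ →ₗ[ℝ] Matrix (Fin d) (Fin p) ℝ)
    (hf : ∀ W, euclideanGradient f W = Φ W) {S : Matrix (Fin p) (Fin p) ℝ} (hS : Sᵀ = S)
    (hcrit : Φ W = B * W * S) (ξ η : tangentSpace B W) :
    metric p M (riemannianHessian B M f W ξ) η =
      ((Φ ξ - B * (ξ : Matrix (Fin d) (Fin p) ℝ) * S)ᵀ * (η : Matrix (Fin d) (Fin p) ℝ)).trace := by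
  have hBt := transpose_eq_of_posDef hB
  -- The field `M⁻¹(ΦZ - BZS)` differs from `M⁻¹∇f` by a normal vector at every `Z`, so it has the
  -- same projection. It is linear and vanishes at `W`, hence the Hessian is its projection at `W`.
  let h : Matrix (Fin d) (Fin p) ℝ →ₗ[ℝ] Matrix (Fin d) (Fin p) ℝ :=
    (mulLeftLinearMap (Fin p) ℝ M⁻¹) ∘ₗ (Φ - (mulRightLinearMap (Fin d) ℝ S) ∘ₗ
      (mulLeftLinearMap (Fin p) ℝ B))
  have happ : ∀ Z, h Z = M⁻¹ * (Φ Z - B * Z * S) := fun Z => rfl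
  have hgrad : ∀ Z : Matrix (Fin d) (Fin p) ℝ,
      riemannianGradient B M f Z = tangentProj B M Z (h Z) := by
    intro Z
    rw [riemannianGradient, hf, tangentProj_eq_of_sub_mem (ξ := h Z) hM]
    rw [happ, Matrix.mul_sub, sub_sub_cancel, ← Matrix.mul_assoc, ← Matrix.mul_assoc]
    exact mem_normalSpace hM hBt hS
  have hev : riemannianGradient B M f =ᶠ[nhds W] fun Z => projOp B M Z (h.toContinuousLinearMap Z) := by
    have hopen : ∀ᶠ Z in nhds W, IsUnit (lyapunovOp p (normalGram B M Z)) :=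
      ContinuousLinearMap.eventually_isUnit (F := Matrix (Fin p) (Fin p) ℝ)
        continuous_lyapunovOp_normalGram.continuousAt (isUnit_lyapunovOp_normalGram hM hB hW)
    filter_upwards [hopen] with Z hZ
    rw [projOp_eq hM hBt hZ, hgrad]
    rfl
  have hW0 : h W = 0 := by rw [happ, hcrit, sub_self, Matrix.mul_zero]
  have hder := (hasFDerivAt_apply_of_eq_zero (continuousAt_projOp hM hB hW) h.toContinuousLinearMap
    hW0).congr_of_eventuallyEq hev
  have hfd : ∀ Z, fderiv ℝ (riemannianGradient B M f) W Z = tangentProj B M W (h Z) := by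
    intro Z
    rw [← projOp_eq hM hBt (isUnit_lyapunovOp_normalGram hM hB hW)]
    exact DFunLike.congr_fun hder.fderiv Z
  have e : riemannianHessian B M f W ξ = tangentProj B M W (h ξ) := by
    change tangentProj B M W (fderiv ℝ (riemannianGradient B M f) W ξ) = _
    rw [hfd, tangentProj_of_mem hM (tangentProj B M W (h ξ)).2]
  -- Against a tangent vector the projection can be dropped, and the `M` of the metric cancels
  -- `M⁻¹`: the form does not depend on the preconditioner.
  rw [e, metric_tangentProj hM η.2, metric_apply, happ, Matrix.transpose_mul,
    transpose_eq_of_posDef hM.inv, Matrix.mul_assoc _ M⁻¹,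
    Matrix.nonsing_inv_mul _ ((Matrix.isUnit_iff_isUnit_det _).1 hM.isUnit), Matrix.mul_one]

end Hessian

end SketchedFDA

namespace SketchedFDA

/-! ### Global minimizers of the FDA cost -/

section Minimizer

/-- An optimal dual solution of the assignment problem with the values `r i * m j`, with strict
complementary slackness. -/
theorem exists_dual_of_antitone {r m : ℕ → ℝ} {p : ℕ} (hr : Antitone r)
    (hr' : ∀ k < p, r (k + 1) < r k) (hm : Antitone m) (hm' : ∀ k < p, m (k + 1) < m k)
    (hm0 : ∀ k, p ≤ k → m k = 0) :
    ∃ v : ℕ → ℝ, (∀ k, 0 ≤ v k) ∧ (∀ k, p ≤ k → v k = 0) ∧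
      ∀ j < p, ∀ i, i ≠ j → 0 < m j * (r j - r i) - (v j - v i) := by
  -- A trapezoidal sum of `m` against the decrements of `r`. For `j < i` the gap is the sum over `j
  -- ≤ k < i` of `(r_k - r_{k+1})(m_j - (m_k + m_{k+1})/2)`, and for `i < j` the sum over `i ≤ k <
  -- j` with the second factor negated. Averaging neighbouring values of `m` makes both strictly
  -- positive. The potential is `v = w p - w`.
  let w : ℕ → ℝ := fun k => ∑ t ∈ Finset.range k, (r t - r (t + 1)) * (m t + m (t + 1)) / 2
  have hw : ∀ k, w (k + 1) = w k + (r k - r (k + 1)) * (m k + m (k + 1)) / 2 := fun k =>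
    Finset.sum_range_succ _ _
  have hm1 : ∀ k, m (k + 1) ≤ m k := fun k => hm k.le_succ
  have hr1 : ∀ k, r (k + 1) ≤ r k := fun k => hr k.le_succ
  have hmpos : ∀ k, 0 ≤ m k := fun k => by
    rcases le_total p k with h | h
    · exact (hm0 k h).ge
    · exact (hm0 p le_rfl).ge.trans (hm h)
  have hwmono : Monotone w := monotone_nat_of_le_succ fun k => by
    rw [hw]
    have : 0 ≤ (r k - r (k + 1)) * (m k + m (k + 1)) :=
      mul_nonneg (by linarith [hr1 k]) (by linarith [hmpos k, hmpos (k + 1)])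
    linarith
  have hwp : ∀ k, p ≤ k → w k = w p := fun k hk => by
    induction k, hk using Nat.le_induction with
    | base => rfl
    | succ k hk ih => rw [hw, ih, hm0 k hk, hm0 (k + 1) (by omega)]; ring
  refine ⟨fun k => w p - w k, fun k => ?_, fun k hk => by simp [hwp k hk], fun j hj i hij => ?_⟩
  · rcases le_total p k with h | h
    · simp [hwp k h]
    · exact sub_nonneg.2 (hwmono h)
  · have key : (w p - w j) - (w p - w i) = w i - w j := by ring
    beta_reduce
    rw [key]
    rcases lt_or_gt_of_ne hij with h | h
    · clear hij key
      induction j, h using Nat.le_induction with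
      | base =>
        rw [hw]
        have := mul_pos (sub_pos.2 (hr' i (by omega))) (sub_pos.2 (hm' i (by omega)))
        simp only [Nat.succ_eq_add_one] at *
        nlinarith
      | succ j hij ih =>
        have := ih (by omega)
        rw [hw]
        have h1 := mul_nonneg (sub_nonneg.2 (hr1 j)) (sub_nonneg.2 (hm1 j))
        have h2 := mul_nonneg (sub_nonneg.2 (hr (show i ≤ j by omega))) (sub_nonneg.2 (hm1 j))
        nlinarith
    · clear hij key
      induction i, h using Nat.le_induction with
      | base =>
        rw [hw]
        have := mul_pos (sub_pos.2 (hr' j hj)) (sub_pos.2 (hm' j hj))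
        simp only [Nat.succ_eq_add_one] at *
        nlinarith
      | succ i hij ih =>
        rw [hw]
        have h1 := mul_nonneg (sub_nonneg.2 (hr1 i)) (sub_nonneg.2 (hm1 i))
        have h2 := mul_nonneg (sub_nonneg.2 (hr1 i)) (sub_nonneg.2 (hm (show j ≤ i by omega)))
        nlinarith

variable {d p : ℕ}

/-- A doubly substochastic matrix which maximizes `∑ r i * m j * P i j` is the identity. -/
theorem eq_of_le_sum_assignment {r m : ℕ → ℝ} (hr : Antitone r)
    (hr' : ∀ k < p, r (k + 1) < r k) (hm : Antitone m) (hm' : ∀ k < p, m (k + 1) < m k)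
    (hm0 : ∀ k, p ≤ k → m k = 0) (hpd : p ≤ d) {P : Fin d → Fin p → ℝ} (hP : ∀ i j, 0 ≤ P i j)
    (hcol : ∀ j, ∑ i, P i j = 1) (hrow : ∀ i, ∑ j, P i j ≤ 1)
    (hmax : ∑ j : Fin p, r j * m j ≤ ∑ j : Fin p, ∑ i : Fin d, r i * m j * P i j)
    {i : Fin d} {j : Fin p} (hij : i.val ≠ j.val) : P i j = 0 := by
  obtain ⟨v, hv, hv0, hgap⟩ := exists_dual_of_antitone hr hr' hm hm' hm0
  let gap : Fin d → Fin p → ℝ := fun i j => (m j * (r j - r i) - (v j - v i)) * P i j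
  have hgap' : ∀ i j, 0 ≤ gap i j := fun i j => by
    by_cases h : i.val = j.val
    · simp [gap, h]
    · exact mul_nonneg (hgap j j.2 i h).le (hP i j)
  have hv' : ∑ i : Fin d, v i = ∑ j : Fin p, v j := by
    obtain ⟨q, rfl⟩ := Nat.exists_eq_add_of_le hpd
    rw [Fin.sum_univ_add]
    simp [hv0]
  -- Weak duality: the total gap is the optimality defect of `P` plus a term that is nonpositive
  -- because the row sums are at most `1` and `v ≥ 0`. So every product of a gap with an entry of
  -- `P` vanishes, and the gaps off the diagonal are positive.
  have hsum : ∑ j, ∑ i, gap i j = ∑ j : Fin p, r j * m j -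
      ∑ j : Fin p, ∑ i : Fin d, r i * m j * P i j - ∑ j : Fin p, v j +
      ∑ i : Fin d, v i * ∑ j, P i j := by
    have h1 : ∀ j, ∑ i, gap i j = r j * m j - ∑ i : Fin d, r i * m j * P i j - v j +
        ∑ i : Fin d, v i * P i j := fun j => by
      have : ∀ i, gap i j = (r j * m j - v j) * P i j - r i * m j * P i j + v i * P i j :=
        fun i => by simp only [gap]; ring
      simp only [this, Finset.sum_add_distrib, Finset.sum_sub_distrib, ← Finset.mul_sum, hcol]
      ring
    simp only [h1, Finset.sum_add_distrib, Finset.sum_sub_distrib]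
    congr 1
    rw [Finset.sum_comm]
    simp only [Finset.mul_sum]
  have hle : ∑ i : Fin d, v i * ∑ j, P i j ≤ ∑ j : Fin p, v j := by
    rw [← hv']
    exact Finset.sum_le_sum fun i _ => mul_le_of_le_one_right (hv i) (hrow i)
  have h0 : ∑ j, ∑ i, gap i j = 0 :=
    le_antisymm (by linarith) (Finset.sum_nonneg fun j _ => Finset.sum_nonneg fun i _ => hgap' i j)
  have h2 := (Finset.sum_eq_zero_iff_of_nonneg fun j _ =>
    Finset.sum_nonneg fun i _ => hgap' i j).1 h0 j (Finset.mem_univ _)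
  have h3 := (Finset.sum_eq_zero_iff_of_nonneg fun i _ => hgap' i j).1 h2 i (Finset.mem_univ _)
  exact (mul_eq_zero.1 h3).resolve_left (hgap j j.2 i hij).ne'

/-- The matrix `ZZᵀ` is an orthogonal projection, so a diagonal entry `t`, being the squared norm of
its row, satisfies `t² ≤ t`. -/
theorem sum_row_sq_le_one {Z : Matrix (Fin d) (Fin p) ℝ} (hZ : Zᵀ * Z = 1) (i : Fin d) :
    ∑ j, Z i j ^ 2 ≤ 1 := by
  have hPP : (Z * Zᵀ) * (Z * Zᵀ) = Z * Zᵀ := by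
    rw [Matrix.mul_assoc, ← Matrix.mul_assoc Zᵀ, hZ, Matrix.one_mul]
  have hPt : ∀ a b, (Z * Zᵀ) a b = (Z * Zᵀ) b a := fun a b => by
    simp [Matrix.mul_apply, mul_comm]
  have h1 : (Z * Zᵀ) i i = ∑ j, Z i j ^ 2 := by simp [Matrix.mul_apply, sq]
  have h2 : (Z * Zᵀ) i i = ∑ k, (Z * Zᵀ) i k ^ 2 := by
    conv_lhs => rw [← hPP, Matrix.mul_apply]
    exact Finset.sum_congr rfl fun k _ => by rw [hPt k i, sq]
  have h3 : (Z * Zᵀ) i i ^ 2 ≤ (Z * Zᵀ) i i := by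
    conv_rhs => rw [h2]
    exact Finset.single_le_sum (f := fun k => (Z * Zᵀ) i k ^ 2) (fun k _ => sq_nonneg _)
      (Finset.mem_univ i)
  rw [← h1]
  nlinarith

variable {n l : ℕ} {X : Matrix (Fin n) (Fin d) ℝ} {y : Fin n → Fin l}
  {B V : Matrix (Fin d) (Fin d) ℝ} {ρ : Fin d → ℝ} {μ : Fin p → ℝ}

theorem mul_transpose_mul_of_orthonormal (hV : Vᵀ * B * V = 1) : V * (Vᵀ * B) = 1 :=
  mul_eq_one_comm.1 hV

theorem transpose_mul_mul_eq {A : Matrix (Fin d) (Fin d) ℝ} (hV : Vᵀ * B * V = 1)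
    (hA : A * V = B * V * Matrix.diagonal ρ) : Vᵀ * A * V = Matrix.diagonal ρ := by
  rw [Matrix.mul_assoc, hA, ← Matrix.mul_assoc, ← Matrix.mul_assoc, hV, Matrix.one_mul]

theorem trace_quadratic {A D : Matrix (Fin d) (Fin d) ℝ} (h : Vᵀ * A * V = D)
    (Z : Matrix (Fin d) (Fin p) ℝ) (ν : Fin p → ℝ) :
    ((V * Z)ᵀ * A * (V * Z) * Matrix.diagonal ν).trace =
      (Zᵀ * D * Z * Matrix.diagonal ν).trace := by
  rw [← h]
  simp only [Matrix.transpose_mul, Matrix.mul_assoc]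

theorem trace_diagonal_quadratic (ρ : Fin d → ℝ) (Z : Matrix (Fin d) (Fin p) ℝ) (ν : Fin p → ℝ) :
    (Zᵀ * Matrix.diagonal ρ * Z * Matrix.diagonal ν).trace =
      ∑ j, ∑ i, ρ i * ν j * Z i j ^ 2 := by
  rw [Matrix.trace]
  refine Finset.sum_congr rfl fun j _ => ?_
  rw [Matrix.diag_apply, Matrix.mul_diagonal, Matrix.mul_apply, Finset.sum_mul]
  refine Finset.sum_congr rfl fun i _ => ?_
  rw [Matrix.mul_diagonal, Matrix.transpose_apply]
  ring

/-- In the eigenbasis `V`, the matrix of a global minimizer is diagonal. -/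
theorem IsMinOn.coeff_eq_zero (hpd : p < d) (hρ : Antitone ρ)
    (hρ' : ∀ i j : Fin d, i < j → j.val ≤ p → ρ j < ρ i) (hμ : StrictAnti μ) (hμ' : ∀ j, 0 < μ j)
    (hV : Vᵀ * B * V = 1) (hA : scatterB X y * V = B * V * Matrix.diagonal ρ)
    {Z : Matrix (Fin d) (Fin p) ℝ} (hZ : Zᵀ * Z = 1)
    (hmin : IsMinOn (fdaCost X y μ) (stiefel p B) (V * Z)) {i : Fin d} {j : Fin p}
    (hij : i.val ≠ j.val) : Z i j = 0 := by
  have hcost : ∀ Z : Matrix (Fin d) (Fin p) ℝ, fdaCost X y μ (V * Z) =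
      -(1 / 2) * ∑ j, ∑ i, ρ i * μ j * Z i j ^ 2 := fun Z => by
    rw [fdaCost, trace_quadratic (transpose_mul_mul_eq hV hA), trace_diagonal_quadratic]
  -- The competitor `V * E` consists of the first `p` eigenvectors; comparing costs with it gives
  -- the optimality needed for the assignment problem.
  let E : Matrix (Fin d) (Fin p) ℝ := Matrix.of fun i j => if i.val = j.val then 1 else 0
  have hEsum : ∀ (j : Fin p) (g : Fin d → ℝ), ∑ i, g i * E i j = g ⟨j, by omega⟩ := fun j g => by
    rw [Finset.sum_eq_single ⟨j.val, by omega⟩]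
    · simp [E]
    · intro i _ hi
      have : i.val ≠ j.val := fun h => hi (Fin.ext h)
      simp [E, this]
    · simp
  have hE : Eᵀ * E = 1 := by
    ext a b
    rw [Matrix.mul_apply, hEsum b fun i => Eᵀ a i]
    by_cases h : a = b
    · subst h
      simp [E]
    · have : b.val ≠ a.val := fun h' => h (Fin.ext h'.symm)
      simp [E, this, h]
  have hmem : V * E ∈ stiefel p B := by
    change (V * E)ᵀ * B * (V * E) = 1
    calc (V * E)ᵀ * B * (V * E) = Eᵀ * (Vᵀ * B * V) * E := by
          simp only [Matrix.transpose_mul, Matrix.mul_assoc]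
      _ = 1 := by rw [hV, Matrix.mul_one, hE]
  have hle : fdaCost X y μ (V * Z) ≤ fdaCost X y μ (V * E) := hmin hmem
  rw [hcost, hcost] at hle
  have hEE : ∀ i j, E i j ^ 2 = E i j := fun i j => by
    by_cases h : i.val = j.val <;> simp [E, h]
  simp only [hEE, hEsum] at hle
  -- The eigenvalues are continued by the last one, the weights by `0`. Both remain antitone, and
  -- the strict drops at the indices `k < p` persist because `p < d` and `μ_p > 0`.
  let r : ℕ → ℝ := fun k => ρ ⟨min k (d - 1), by omega⟩
  let m : ℕ → ℝ := fun k => if h : k < p then μ ⟨k, h⟩ else 0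
  have hrv : ∀ i : Fin d, r i = ρ i := fun i => by
    simp only [r]; congr 1; ext; simp; omega
  have hmv : ∀ j : Fin p, m j = μ j := fun j => by simp [m]
  have hr : Antitone r := fun a b h => hρ (by simp only [Fin.mk_le_mk]; omega)
  have hr' : ∀ k < p, r (k + 1) < r k := fun k hk =>
    hρ' _ _ (by simp only [Fin.mk_lt_mk]; omega) (by simp only []; omega)
  have hm' : ∀ k < p, m (k + 1) < m k := fun k hk => by
    by_cases h : k + 1 < p
    · simp only [m, hk, h, dif_pos]
      exact hμ (by simp)
    · simp only [m, hk, h, dif_pos, dif_neg, not_false_iff]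
      exact hμ' _
  have hm0 : ∀ k, p ≤ k → m k = 0 := fun k hk => by simp [m, hk]
  have hm : Antitone m := antitone_nat_of_succ_le fun k => by
    by_cases h : k < p
    · exact (hm' k h).le
    · rw [hm0 k (by omega), hm0 (k + 1) (by omega)]
  have := eq_of_le_sum_assignment (P := fun i j => Z i j ^ 2) hr hr' hm hm' hm0 hpd.le
    (fun i j => sq_nonneg _) (fun j => ?_) (sum_row_sq_le_one hZ) ?_ hij
  · simpa using this
  · have := congrFun (congrFun hZ j) j
    simpa [Matrix.mul_apply, sq] using this
  · simp only [hrv, hmv]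
    have e : ∀ j : Fin p, r j.val = ρ ⟨j, by omega⟩ := fun j => hrv ⟨j, by omega⟩
    simp only [e]
    linarith

end Minimizer

end SketchedFDA

namespace SketchedFDA

/-! ### The spectrum of the Hessian at a minimizer -/

section Spectrum

variable {d p : ℕ}

/-- The denominator of `κ*`. -/
noncomputable def minGap (hpd : p < d) (μ : Fin p → ℝ) (ρ : Fin d → ℝ) : ℝ :=
  ⨅ j : Fin p,
    if h : j.val + 1 < p then
      1 / 2 * (μ j - μ ⟨j.val + 1, h⟩) * (ρ ⟨j.val, by omega⟩ - ρ ⟨j.val + 1, by omega⟩)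
    else μ j * (ρ ⟨j.val, by omega⟩ - ρ ⟨j.val + 1, by omega⟩)

variable {μ : Fin p → ℝ} {ρ : Fin d → ℝ}

theorem minGap_pos (hp : 0 < p) (hpd : p < d) (hρ : ∀ i j : Fin d, i < j → j.val ≤ p → ρ j < ρ i)
    (hμ : StrictAnti μ) (hμ' : ∀ j, 0 < μ j) : 0 < minGap hpd μ ρ := by
  have : Nonempty (Fin p) := ⟨⟨0, hp⟩⟩
  obtain ⟨j, hj⟩ := exists_eq_ciInf_of_finite (f := fun j : Fin p =>
    if h : j.val + 1 < p then
      1 / 2 * (μ j - μ ⟨j.val + 1, h⟩) * (ρ ⟨j.val, by omega⟩ - ρ ⟨j.val + 1, by omega⟩)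
    else μ j * (ρ ⟨j.val, by omega⟩ - ρ ⟨j.val + 1, by omega⟩))
  rw [minGap, ← hj]
  have h1 : 0 < ρ ⟨j.val, by omega⟩ - ρ ⟨j.val + 1, by omega⟩ :=
    sub_pos.2 (hρ _ _ (by simp) (by simp only []; omega))
  split_ifs with h
  · have h2 : 0 < μ j - μ ⟨j.val + 1, h⟩ := sub_pos.2 (hμ (by simp [Fin.lt_def]))
    positivity
  · exact mul_pos (hμ' j) h1

/-- Both factors for a pair `j < k` are at least those for the neighbours `j, j + 1`. -/
theorem minGap_le_of_lt (hpd : p < d) (hρ : Antitone ρ) (hμ : StrictAnti μ) {j k : Fin p}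
    (h : j < k) :
    minGap hpd μ ρ ≤ 1 / 2 * ((μ j - μ k) * (ρ ⟨j, by omega⟩ - ρ ⟨k, by omega⟩)) := by
  have hj : j.val + 1 < p := by have := Fin.lt_def.1 h; omega
  refine (ciInf_le (Finite.bddBelow_range _) j).trans ?_
  rw [dif_pos hj, mul_assoc]
  have h1 : μ k ≤ μ ⟨j.val + 1, hj⟩ := hμ.antitone (by
    rw [Fin.le_def]; exact Fin.lt_def.1 h)
  have h2 : ρ ⟨k, by omega⟩ ≤ ρ ⟨j.val + 1, by omega⟩ := hρ (by
    rw [Fin.le_def]; exact Fin.lt_def.1 h)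
  have h3 : μ ⟨j.val + 1, hj⟩ ≤ μ j := hμ.antitone (by simp [Fin.le_def])
  have h4 : ρ ⟨j.val + 1, by omega⟩ ≤ ρ ⟨j.val, by omega⟩ := hρ (by simp)
  refine mul_le_mul_of_nonneg_left (mul_le_mul (by linarith) (by linarith) ?_ ?_) (by norm_num)
  · linarith
  · linarith

/-- Both the weight and the eigenvalue gap are smallest for the last column and the first discarded
eigenvalue. -/
theorem minGap_le_of_le (hpd : p < d) (hρ : Antitone ρ) (hμ : StrictAnti μ)
    (hμ' : ∀ j, 0 < μ j) (j : Fin p) {i : Fin d} (h : p ≤ i.val) :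
    minGap hpd μ ρ ≤ μ j * (ρ ⟨j, by omega⟩ - ρ i) := by
  have hp : 0 < p := j.pos
  have hlast : ¬ (p - 1) + 1 < p := by omega
  refine (ciInf_le (Finite.bddBelow_range _) (⟨p - 1, by omega⟩ : Fin p)).trans ?_
  rw [dif_neg hlast]
  have h1 : μ ⟨p - 1, by omega⟩ ≤ μ j := hμ.antitone (by rw [Fin.le_def]; simp only []; omega)
  have h2 : ρ i ≤ ρ ⟨p - 1 + 1, by omega⟩ := hρ (by rw [Fin.le_def]; simp only []; omega)
  have h3 : ρ ⟨p - 1 + 1, by omega⟩ ≤ ρ ⟨p - 1, by omega⟩ := hρ (by simp)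
  have h4 : ρ ⟨p - 1, by omega⟩ ≤ ρ ⟨j, by omega⟩ := hρ (by rw [Fin.le_def]; simp only []; omega)
  exact mul_le_mul h1 (by linarith) (by linarith) (hμ' j).le

theorem gap_le_max (hp : 0 < p) (hpd : p < d) (hρ : Antitone ρ) (hμ : StrictAnti μ)
    (hμ' : ∀ j, 0 < μ j) (j : Fin p) (i : Fin d) :
    μ j * (ρ ⟨j, by omega⟩ - ρ i) ≤
      μ ⟨0, hp⟩ * (ρ ⟨0, by omega⟩ - ρ ⟨d - 1, by omega⟩) := by
  have h1 : μ j ≤ μ ⟨0, hp⟩ := hμ.antitone (by simp [Fin.le_def])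
  have h2 : ρ ⟨d - 1, by omega⟩ ≤ ρ i := hρ (by rw [Fin.le_def]; simp only []; omega)
  have h3 : ρ ⟨j, by omega⟩ ≤ ρ ⟨0, by omega⟩ := hρ (by simp [Fin.le_def])
  have h4 : ρ ⟨d - 1, by omega⟩ ≤ ρ ⟨0, by omega⟩ := hρ (by simp [Fin.le_def])
  calc μ j * (ρ ⟨j, by omega⟩ - ρ i)
      ≤ μ j * (ρ ⟨0, by omega⟩ - ρ ⟨d - 1, by omega⟩) :=
        mul_le_mul_of_nonneg_left (by linarith) (hμ' j).le
    _ ≤ _ := mul_le_mul_of_nonneg_right h1 (by linarith)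

/-- The quadratic form of the Hessian in the eigenbasis, on tangent vectors. -/
theorem minGap_mul_le (hpd : p < d) (hρ : Antitone ρ) (hμ : StrictAnti μ)
    (hμ' : ∀ j, 0 < μ j) {ζ : Matrix (Fin d) (Fin p) ℝ}
    (hζ : ∀ j k : Fin p, ζ ⟨j, by omega⟩ k ^ 2 = ζ ⟨k, by omega⟩ j ^ 2)
    (hζ' : ∀ j : Fin p, ζ ⟨j, by omega⟩ j = 0) :
    minGap hpd μ ρ * ∑ j, ∑ i, ζ i j ^ 2 ≤
      ∑ j : Fin p, ∑ i, μ j * (ρ ⟨j, by omega⟩ - ρ i) * ζ i j ^ 2 := by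
  set a := minGap hpd μ ρ
  rw [← sub_nonneg, Finset.mul_sum, ← Finset.sum_sub_distrib]
  have e : ∀ j : Fin p, (∑ i, μ j * (ρ ⟨j, by omega⟩ - ρ i) * ζ i j ^ 2) - a * ∑ i, ζ i j ^ 2 =
      ∑ i, (μ j * (ρ ⟨j, by omega⟩ - ρ i) - a) * ζ i j ^ 2 := fun j => by
    rw [Finset.mul_sum, ← Finset.sum_sub_distrib]
    exact Finset.sum_congr rfl fun i _ => by ring
  simp only [e]
  -- The rows `i ≥ p` have nonnegative coefficients and can be discarded.
  have hsplit : ∀ j : Fin p,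
      ∑ i : Fin p, (μ j * (ρ ⟨j, by omega⟩ - ρ ⟨i, by omega⟩) - a) * ζ ⟨i, by omega⟩ j ^ 2 ≤
      ∑ i, (μ j * (ρ ⟨j, by omega⟩ - ρ i) - a) * ζ i j ^ 2 := fun j => by
    refine (Finset.sum_map Finset.univ (Fin.castLEEmb hpd.le)
      fun i => (μ j * (ρ ⟨j, by omega⟩ - ρ i) - a) * ζ i j ^ 2).symm.trans_le ?_
    refine Finset.sum_le_sum_of_subset_of_nonneg (Finset.subset_univ _) fun i _ hi => ?_
    have : p ≤ i.val := by
      by_contra! h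
      exact hi (Finset.mem_map.2 ⟨⟨i, h⟩, Finset.mem_univ _, rfl⟩)
    exact mul_nonneg (sub_nonneg.2 (minGap_le_of_le hpd hρ hμ hμ' j this)) (sq_nonneg _)
  refine le_trans ?_ (Finset.sum_le_sum fun j _ => hsplit j)
  set c : Fin p → Fin p → ℝ := fun j i =>
    (μ j * (ρ ⟨j, by omega⟩ - ρ ⟨i, by omega⟩) - a) * ζ ⟨i, by omega⟩ j ^ 2
  -- A single coefficient `μ_j(ρ_j - ρ_i)` may be negative. Since the squares at `(i, j)` and `(j,
  -- i)` agree, the two terms combine to the average `½(μ_j - μ_i)(ρ_j - ρ_i)`, which explains the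
  -- factor `½` in `κ*`.
  have hc : ∀ j i, 0 ≤ c j i + c i j := fun j i => by
    have hs : c j i + c i j = 2 * ((1 / 2 * ((μ j - μ i) * (ρ ⟨j, by omega⟩ - ρ ⟨i, by omega⟩)) - a) *
        ζ ⟨i, by omega⟩ j ^ 2) := by
      simp only [c]
      rw [hζ j i]
      ring
    rw [hs]
    rcases lt_trichotomy i j with h | rfl | h
    · have := minGap_le_of_lt hpd hρ hμ h
      refine mul_nonneg (by norm_num) (mul_nonneg ?_ (sq_nonneg _))
      simp only [a]
      linarith
    · simp [hζ']
    · have := minGap_le_of_lt hpd hρ hμ h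
      refine mul_nonneg (by norm_num) (mul_nonneg ?_ (sq_nonneg _))
      simp only [a]
      linarith
  have h2 : 0 ≤ ∑ j, ∑ i, (c j i + c i j) :=
    Finset.sum_nonneg fun j _ => Finset.sum_nonneg fun i _ => hc j i
  simp only [Finset.sum_add_distrib] at h2
  rw [Finset.sum_comm (f := fun j i => c i j)] at h2
  linarith

variable {n l : ℕ} {X : Matrix (Fin n) (Fin d) ℝ} {y : Fin n → Fin l}
  {B M : Matrix (Fin d) (Fin d) ℝ} {W : Matrix (Fin d) (Fin p) ℝ}

theorem transpose_coeff_mul_coeff (hB : Bᵀ = B) {V : Matrix (Fin d) (Fin d) ℝ}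
    (hV : V * (Vᵀ * B) = 1) (U U' : Matrix (Fin d) (Fin p) ℝ) :
    (Vᵀ * B * U)ᵀ * (Vᵀ * B * U') = Uᵀ * B * U' := by
  calc (Vᵀ * B * U)ᵀ * (Vᵀ * B * U') = Uᵀ * B * (V * (Vᵀ * B)) * U' := by
        simp only [Matrix.transpose_mul, Matrix.transpose_transpose, hB, Matrix.mul_assoc]
    _ = _ := by rw [hV, Matrix.mul_one]

/-- Bounds for the quadratic form of the Hessian at a global minimizer. -/
theorem IsMinOn.hessian_bounds (hp : 0 < p) (hpd : p < d)
    (hM : M.PosDef) (hB : B.PosDef) (hρ : IsGenEigenvalues (scatterB X y) B ρ)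
    (hρ' : ∀ i j : Fin d, i < j → j.val ≤ p → ρ j < ρ i) (hμ : StrictAnti μ) (hμ' : ∀ j, 0 < μ j)
    (hW : W ∈ stiefel p B) (hmin : IsMinOn (fdaCost X y μ) (stiefel p B) W)
    (ξ : tangentSpace B W) :
    minGap hpd μ ρ * metric p B ξ ξ ≤
        metric p M (riemannianHessian B M (fdaCost X y μ) W ξ) ξ ∧
      metric p M (riemannianHessian B M (fdaCost X y μ) W ξ) ξ ≤
        μ ⟨0, hp⟩ * (ρ ⟨0, by omega⟩ - ρ ⟨d - 1, by omega⟩) * metric p B ξ ξ := by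
  obtain ⟨hanti, V, hV, hA⟩ := hρ
  have hBt := transpose_eq_of_posDef hB
  have hVV := mul_transpose_mul_of_orthonormal hV
  have hWB : Wᵀ * B * W = 1 := hW
  set Z : Matrix (Fin d) (Fin p) ℝ := Vᵀ * B * W with hZdef
  have hWZ : W = V * Z := by rw [hZdef, ← Matrix.mul_assoc, hVV, Matrix.one_mul]
  have hZ : Zᵀ * Z = 1 := (transpose_coeff_mul_coeff hBt hVV W W).trans hWB
  have hZ0 : ∀ (i : Fin d) (j : Fin p), i.val ≠ j.val → Z i j = 0 := fun i j hij =>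
    IsMinOn.coeff_eq_zero hpd hanti hρ' hμ hμ' hV hA hZ (hWZ ▸ hmin) hij
  have hZsum : ∀ (j : Fin p) (g : Fin d → ℝ),
      ∑ i, g i * Z i j = g ⟨j, by omega⟩ * Z ⟨j, by omega⟩ j := fun j g =>
    Finset.sum_eq_single _ (fun i _ hi => by
      rw [hZ0 i j fun h => hi (Fin.ext h), mul_zero]) (by simp)
  have hZ1 : ∀ j : Fin p, Z ⟨j, by omega⟩ j ^ 2 = 1 := fun j => by
    have := congrFun (congrFun hZ j) j
    rw [Matrix.mul_apply, hZsum j fun i => Zᵀ j i] at this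
    simpa [sq] using this
  set ζ : Matrix (Fin d) (Fin p) ℝ := Vᵀ * B * (ξ : Matrix (Fin d) (Fin p) ℝ) with hζdef
  have hξζ : (ξ : Matrix (Fin d) (Fin p) ℝ) = V * ζ := by
    rw [hζdef, ← Matrix.mul_assoc, hVV, Matrix.one_mul]
  have htan : ζᵀ * Z + Zᵀ * ζ = 0 := by
    rw [hζdef, hZdef, transpose_coeff_mul_coeff hBt hVV, transpose_coeff_mul_coeff hBt hVV]
    exact mem_tangentSpace.1 ξ.2
  -- The coordinates of `W` are signs on the diagonal and zero elsewhere, so tangency says that the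
  -- top block of `ζ` is skew-symmetric up to these signs.
  have hsign : ∀ j k : Fin p, ζ ⟨k, by omega⟩ j * Z ⟨k, by omega⟩ k =
      -(ζ ⟨j, by omega⟩ k * Z ⟨j, by omega⟩ j) := fun j k => by
    have := congrFun (congrFun htan j) k
    rw [Matrix.add_apply, Matrix.mul_apply, Matrix.mul_apply, hZsum k fun i => ζᵀ j i] at this
    simp only [Matrix.transpose_apply, mul_comm (Z _ j)] at this
    rw [hZsum j fun i => ζ i k] at this
    exact eq_neg_of_add_eq_zero_left this
  have hζ : ∀ j k : Fin p, ζ ⟨j, by omega⟩ k ^ 2 = ζ ⟨k, by omega⟩ j ^ 2 := fun j k => by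
    have := congrArg (· ^ 2) (hsign j k)
    simp only [neg_sq, mul_pow, hZ1, mul_one] at this
    exact this.symm
  have hζ' : ∀ j : Fin p, ζ ⟨j, by omega⟩ j = 0 := fun j => by
    have h1 := hsign j j
    have h2 : Z ⟨j, by omega⟩ j ≠ 0 := fun h => by simpa [h] using hZ1 j
    exact (mul_eq_zero.1 (show ζ ⟨j, by omega⟩ j * Z ⟨j, by omega⟩ j = 0 by linarith)).resolve_right h2
  let Φ : Matrix (Fin d) (Fin p) ℝ →ₗ[ℝ] Matrix (Fin d) (Fin p) ℝ :=
    -((mulRightLinearMap (Fin d) ℝ (Matrix.diagonal μ)) ∘ₗ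
      (mulLeftLinearMap (Fin p) ℝ (scatterB X y)))
  have hΦ : ∀ U, Φ U = -(scatterB X y * U * Matrix.diagonal μ) := fun U => rfl
  -- The Lagrange multiplier of the constraint: the columns of `W` are eigenvectors, so the
  -- Euclidean gradient is `-S_B W N = BWS`.
  set S : Matrix (Fin p) (Fin p) ℝ := -Matrix.diagonal fun j : Fin p => ρ ⟨j, by omega⟩ * μ j
    with hSdef
  have hcrit : Φ W = B * W * S := by
    have h1 : Matrix.diagonal ρ * Z = Z * Matrix.diagonal fun j : Fin p => ρ ⟨j, by omega⟩ := by
      ext i j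
      rw [Matrix.diagonal_mul, Matrix.mul_diagonal]
      by_cases h : i.val = j.val
      · have : i = ⟨j, by omega⟩ := Fin.ext h
        rw [this, mul_comm]
      · rw [hZ0 i j h]; simp
    rw [hΦ, hSdef, Matrix.mul_neg, hWZ, ← Matrix.mul_assoc, hA, Matrix.mul_assoc (B * V), h1,
      ← Matrix.diagonal_mul_diagonal]
    simp only [Matrix.mul_assoc]
  have hB2 : metric p B ξ ξ = ∑ j, ∑ i, ζ i j ^ 2 := by
    have := trace_diagonal_quadratic (fun _ => 1) ζ fun _ => 1
    rw [← trace_quadratic (A := B) (V := V) (by rw [hV]; simp), ← hξζ] at this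
    rw [metric_apply]
    simpa using this
  have hquad : metric p M (riemannianHessian B M (fdaCost X y μ) W ξ) ξ =
      ∑ j : Fin p, ∑ i, μ j * (ρ ⟨j, by omega⟩ - ρ i) * ζ i j ^ 2 := by
    rw [metric_riemannianHessian hM hB (injective_of_mem_stiefel hW) Φ
      (fun U => euclideanGradient_fdaCost X y μ U) (by simp [hSdef]) hcrit,
      ← Matrix.trace_transpose, Matrix.transpose_mul, Matrix.transpose_transpose, hΦ, hSdef,
      Matrix.mul_neg, sub_neg_eq_add, Matrix.mul_add, Matrix.mul_neg, ← Matrix.mul_assoc,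
      ← Matrix.mul_assoc, ← Matrix.mul_assoc, ← Matrix.mul_assoc, Matrix.trace_add,
      Matrix.trace_neg, hξζ, trace_quadratic (transpose_mul_mul_eq hV hA),
      trace_quadratic (A := B) (V := V) (D := Matrix.diagonal fun _ => 1) (by rw [hV]; simp),
      trace_diagonal_quadratic, trace_diagonal_quadratic, neg_add_eq_sub,
      ← Finset.sum_sub_distrib]
    refine Finset.sum_congr rfl fun j _ => ?_
    rw [← Finset.sum_sub_distrib]
    exact Finset.sum_congr rfl fun i _ => by ring
  rw [hB2, hquad]
  refine ⟨minGap_mul_le hpd hanti hμ hμ' hζ hζ', ?_⟩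
  rw [Finset.mul_sum]
  refine Finset.sum_le_sum fun j _ => ?_
  rw [Finset.mul_sum]
  exact Finset.sum_le_sum fun i _ =>
    mul_le_mul_of_nonneg_right (gap_le_max hp hpd hanti hμ hμ' j i) (sq_nonneg _)

/-- An endomorphism with all eigenvalues in `[a, b]`, `0 < a`, has condition number at most
`b / a`. -/
theorem condNumber_le {E : Type*} [AddCommGroup E] [Module ℝ E] {T : Module.End ℝ E} {a b : ℝ}
    (ha : 0 < a) (h : ∀ t, T.HasEigenvalue t → a ≤ t ∧ t ≤ b) :
    condNumber T ≤ ENNReal.ofReal (b / a) := by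
  rw [condNumber, if_neg fun h0 => absurd (h 0 h0).1 (not_le.2 ha), ENNReal.ofReal_div_of_pos ha]
  refine ENNReal.div_le_div (iSup₂_le fun t ht => ?_) (le_iInf₂ fun t ht => ?_)
  · have := h t ht
    rw [abs_of_pos (ha.trans_le this.1)]
    exact ENNReal.ofReal_le_ofReal this.2
  · have := h t ht
    rw [abs_of_pos (ha.trans_le this.1)]
    exact ENNReal.ofReal_le_ofReal this.1

/-- For an eigenvector `ξ` with eigenvalue `t`, the number `t·g(ξ, ξ)` lies between `a` and `b`
times the squared `B`-norm of `ξ`, which in turn lies between `2/3` and `2` times `g(ξ, ξ)`. So `t`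
lies in `[2a/3, 2b]`, and the ratio of the end points is `3b/a`. -/
theorem condNumber_riemannianHessian_le (hp : 0 < p) (hpd : p < d)
    (hM : M.PosDef) (hB : B.PosDef)
    (hlow : ∀ x : Fin d → ℝ, 1 / 2 * (x ⬝ᵥ B *ᵥ x) ≤ x ⬝ᵥ M *ᵥ x)
    (hupp : ∀ x : Fin d → ℝ, x ⬝ᵥ M *ᵥ x ≤ 3 / 2 * (x ⬝ᵥ B *ᵥ x))
    (hρ : IsGenEigenvalues (scatterB X y) B ρ)
    (hρ' : ∀ i j : Fin d, i < j → j.val ≤ p → ρ j < ρ i) (hμ : StrictAnti μ) (hμ' : ∀ j, 0 < μ j)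
    (hW : W ∈ stiefel p B) (hmin : IsMinOn (fdaCost X y μ) (stiefel p B) W) :
    condNumber (riemannianHessian B M (fdaCost X y μ) W) ≤
      ENNReal.ofReal (3 * kappaFDA hp hpd μ ρ) := by
  have ha := minGap_pos hp hpd hρ' hμ hμ'
  set a := minGap hpd μ ρ with hadef
  set b := μ ⟨0, hp⟩ * (ρ ⟨0, by omega⟩ - ρ ⟨d - 1, by omega⟩) with hbdef
  have hb : 0 ≤ b := mul_nonneg (hμ' _).le (sub_nonneg.2 (hρ.1 (by simp [Fin.le_def])))
  have hk : 3 * kappaFDA hp hpd μ ρ = 2 * b / (2 / 3 * a) := by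
    rw [show kappaFDA hp hpd μ ρ = b / a from rfl]
    field_simp
  rw [hk]
  refine condNumber_le (by positivity) fun t ht => ?_
  obtain ⟨ξ, hξ⟩ := ht.exists_hasEigenvector
  have hne : (ξ : Matrix (Fin d) (Fin p) ℝ) ≠ 0 := by simpa using hξ.2
  obtain ⟨h1, h2⟩ := IsMinOn.hessian_bounds hp hpd hM hB hρ hρ' hμ hμ' hW hmin ξ
  rw [hξ.apply_eq_smul, Submodule.coe_smul, map_smul, LinearMap.smul_apply, smul_eq_mul] at h1 h2
  have hpos := metric_self_pos (p := p) hM hne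
  have hl : 1 / 2 * metric p B ξ ξ ≤ metric p M ξ ξ := by
    rw [metric_self_eq, metric_self_eq, Finset.mul_sum]
    exact Finset.sum_le_sum fun j _ => hlow _
  have hu : metric p M ξ ξ ≤ 3 / 2 * metric p B ξ ξ := by
    rw [metric_self_eq, metric_self_eq, Finset.mul_sum]
    exact Finset.sum_le_sum fun j _ => hupp _
  constructor
  · by_contra! h
    have := mul_lt_mul_of_pos_right h hpos
    nlinarith
  · by_contra! h
    have := mul_lt_mul_of_pos_right h hpos
    nlinarith

end Spectrum

end SketchedFDA

namespace SketchedFDA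

/-! ### Moments of the CountSketch -/

section CountSketch

variable {n d s : ℕ}

/-- The random sign. -/
noncomputable def sign (b : Bool) : ℝ := if b then 1 else -1

theorem sign_mul_self (b : Bool) : sign b * sign b = 1 := by cases b <;> simp [sign]

theorem sign_not (b : Bool) : sign (!b) = -sign b := by cases b <;> simp [sign]

/-- Flipping the sign at `i` pairs the summands with opposite values, because `i` differs from the
other three indices. -/
theorem sum_sign_eq_zero {i j k l : Fin n} (hij : i ≠ j) (hik : i ≠ k) (hil : i ≠ l) :
    ∑ g : Fin n → Bool, sign (g i) * sign (g j) * (sign (g k) * sign (g l)) = 0 := by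
  refine Finset.sum_involution (fun g _ => Function.update g i (!g i)) (fun g _ => ?_)
    (fun g _ _ h => ?_) (fun g _ => Finset.mem_univ _) fun g _ => by simp
  · simp only [Function.update_self, Function.update_of_ne hij.symm,
      Function.update_of_ne hik.symm, Function.update_of_ne hil.symm, sign_not]
    ring
  · have := congrFun h i
    simp at this

/-- The second moment of a Rademacher chaos of order two. -/
theorem sum_sign_quadratic_sq_le (c : Fin n → Fin n → ℝ) (hc : ∀ i, c i i = 0) :
    ∑ g : Fin n → Bool, (∑ i, ∑ j, c i j * (sign (g i) * sign (g j))) ^ 2 ≤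
      2 ^ n * (2 * ∑ i, ∑ j, c i j ^ 2) := by
  have hcard : ∑ _g : Fin n → Bool, (1 : ℝ) = 2 ^ n := by simp
  have hpair : ∀ i j, ∑ k, ∑ l, c i j * c k l *
      ∑ g : Fin n → Bool, sign (g i) * sign (g j) * (sign (g k) * sign (g l)) =
        2 ^ n * (c i j * c i j + c i j * c j i) := by
    intro i j
    by_cases hij : i = j
    · subst hij; simp [hc]
    -- With `i ≠ j` and `k ≠ l`, some index occurs only once unless `{k, l} = {i, j}`, and then the
    -- average over the signs vanishes.
    · have h0 : ∀ k l, ¬ (k = i ∧ l = j) → ¬ (k = j ∧ l = i) → c i j * c k l *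
          ∑ g : Fin n → Bool, sign (g i) * sign (g j) * (sign (g k) * sign (g l)) = 0 := by
        intro k l h1 h2
        by_cases hkl : k = l
        · subst hkl; simp [hc]
        · refine mul_eq_zero_of_right _ ?_
          by_cases h3 : i = k ∨ i = l
          · have hjk : j ≠ k := by grind
            have hjl : j ≠ l := by grind
            rw [← sum_sign_eq_zero (Ne.symm hij) hjk hjl]
            exact Finset.sum_congr rfl fun g _ => by ring
          · push Not at h3
            exact sum_sign_eq_zero hij h3.1 h3.2
      rw [← Fintype.sum_prod_type' (f := fun k l => c i j * c k l *
        ∑ g : Fin n → Bool, sign (g i) * sign (g j) * (sign (g k) * sign (g l))),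
        ← Finset.sum_subset (Finset.subset_univ {(i, j), (j, i)}), Finset.sum_pair]
      · have e1 : ∀ g : Fin n → Bool,
            sign (g i) * sign (g j) * (sign (g i) * sign (g j)) = 1 := fun g => by
          linear_combination sign (g j) * sign (g j) * sign_mul_self (g i) + sign_mul_self (g j)
        have e2 : ∀ g : Fin n → Bool,
            sign (g i) * sign (g j) * (sign (g j) * sign (g i)) = 1 := fun g => by
          linear_combination sign (g j) * sign (g j) * sign_mul_self (g i) + sign_mul_self (g j)
        simp only [e1, e2, hcard]
        ring
      · simp [hij]
      · rintro ⟨k, l⟩ - h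
        simp only [Finset.mem_insert, Finset.mem_singleton, Prod.mk.injEq, not_or] at h
        exact h0 k l h.1 h.2
  have hexp : ∑ g : Fin n → Bool, (∑ i, ∑ j, c i j * (sign (g i) * sign (g j))) ^ 2 =
      ∑ i, ∑ j, 2 ^ n * (c i j * c i j + c i j * c j i) := by
    simp only [← hpair, sq, Finset.sum_mul, Finset.mul_sum]
    rw [Finset.sum_comm]
    refine Finset.sum_congr rfl fun i _ => ?_
    rw [Finset.sum_comm]
    refine Finset.sum_congr rfl fun j _ => ?_
    rw [Finset.sum_comm]
    refine Finset.sum_congr rfl fun k _ => ?_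
    rw [Finset.sum_comm]
    refine Finset.sum_congr rfl fun l _ => Finset.sum_congr rfl fun g _ => ?_
    ring
  rw [hexp]
  simp only [← Finset.mul_sum]
  refine mul_le_mul_of_nonneg_left ?_ (by positivity)
  calc ∑ i, ∑ j, (c i j * c i j + c i j * c j i)
      ≤ ∑ i, ∑ j, (3 / 2 * c i j ^ 2 + 1 / 2 * c j i ^ 2) :=
        Finset.sum_le_sum fun i _ => Finset.sum_le_sum fun j _ => by
          nlinarith [sq_nonneg (c i j - c j i)]
    _ = 2 * ∑ i, ∑ j, c i j ^ 2 := by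
        simp only [Finset.sum_add_distrib, ← Finset.mul_sum]
        rw [Finset.sum_comm (f := fun i j => c j i ^ 2)]
        ring

/-- Two keys collide with probability `1 / s`. -/
theorem mul_sum_collision (hs : 0 < s) {i j : Fin n} (hij : i ≠ j) :
    (s : ℝ) * ∑ h : Fin n → Fin s, (if h i = h j then 1 else 0) = s ^ n := by
  have : NeZero s := ⟨hs.ne'⟩
  -- Shifting the value `h i` by `c` permutes the hash functions. Summed over all `c`, each hash
  -- function is counted exactly once, for `c = h j - h i`.
  have hshift : ∀ c : Fin s, ∑ h : Fin n → Fin s, (if h i = h j then (1 : ℝ) else 0) =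
      ∑ h : Fin n → Fin s, (if c = h j - h i then (1 : ℝ) else 0) := fun c => by
    rw [← Equiv.sum_comp (Equiv.addRight (Pi.single i c))]
    refine Finset.sum_congr rfl fun h _ => ?_
    simp only [Equiv.coe_addRight, Pi.add_apply, Pi.single_eq_same, Pi.single_eq_of_ne hij.symm,
      add_zero, eq_sub_iff_add_eq, add_comm]
  have h1 : (s : ℝ) * ∑ h : Fin n → Fin s, (if h i = h j then (1 : ℝ) else 0) =
      ∑ c : Fin s, ∑ h : Fin n → Fin s, (if h i = h j then (1 : ℝ) else 0) := by simp
  rw [h1, Finset.sum_congr rfl fun c _ => hshift c, Finset.sum_comm]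
  simp

/-- The diagonal pairs carry squared signs and reproduce `UᵀU`. What remains is a sign chaos over
pairs of distinct colliding indices, to which the second moment bound applies. -/
theorem sketch_gram_sub (ω : SketchSeed n s) (U : Matrix (Fin n) (Fin d) ℝ) (a b : Fin d) :
    ((countSketch ω * U)ᵀ * (countSketch ω * U) - Uᵀ * U) a b =
      ∑ i, ∑ j, (if i ≠ j ∧ ω.1 i = ω.1 j then U i a * U j b else 0) *
        (sign (ω.2 i) * sign (ω.2 j)) := by
  have hS : ∀ k i, countSketch ω k i = if ω.1 i = k then sign (ω.2 i) else 0 := fun k i => rfl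
  have h1 : ((countSketch ω * U)ᵀ * (countSketch ω * U)) a b =
      ∑ i, ∑ j, (if ω.1 i = ω.1 j then U i a * U j b else 0) *
        (sign (ω.2 i) * sign (ω.2 j)) := by
    simp only [Matrix.mul_apply, Matrix.transpose_apply, Finset.sum_mul_sum, hS]
    rw [Finset.sum_comm]
    refine Finset.sum_congr rfl fun i _ => ?_
    rw [Finset.sum_comm]
    refine Finset.sum_congr rfl fun j _ => ?_
    rw [Finset.sum_eq_single (ω.1 i)]
    · by_cases h : ω.1 j = ω.1 i
      · simp only [h, if_true]; ring
      · simp [h, Ne.symm h]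
    · intro k _ hk
      simp [Ne.symm hk]
    · simp
  rw [Matrix.sub_apply, h1, Matrix.mul_apply, ← Finset.sum_sub_distrib]
  refine Finset.sum_congr rfl fun i _ => ?_
  have h2 : Uᵀ a i * U i b = ∑ j, if i = j then U i a * U j b else 0 := by simp
  rw [h2, ← Finset.sum_sub_distrib]
  refine Finset.sum_congr rfl fun j _ => ?_
  by_cases hij : i = j
  · subst hij
    simp [sign_mul_self]
  · simp [hij]

/-- The expected squared Frobenius error of the sketched Gram matrix. -/
theorem sum_sketch_gram_sub_sq_le (hs : 0 < s) (U : Matrix (Fin n) (Fin d) ℝ) :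
    s * ∑ ω : SketchSeed n s, ∑ a, ∑ b,
      ((countSketch ω * U)ᵀ * (countSketch ω * U) - Uᵀ * U) a b ^ 2 ≤
        2 * (Uᵀ * U).trace ^ 2 * Fintype.card (SketchSeed n s) := by
  have hab : ∀ a b, s * ∑ ω : SketchSeed n s,
      ((countSketch ω * U)ᵀ * (countSketch ω * U) - Uᵀ * U) a b ^ 2 ≤
        2 * 2 ^ n * s ^ n * ((∑ i, U i a ^ 2) * ∑ j, U j b ^ 2) := by
    intro a b
    -- The average over the signs is taken first, with the hash fixed; it leaves a sum over
    -- colliding pairs, and the average over the hash then contributes the factor `1 / s`.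
    have h1 : ∀ h : Fin n → Fin s, ∑ g : Fin n → Bool,
        ((countSketch (h, g) * U)ᵀ * (countSketch (h, g) * U) - Uᵀ * U) a b ^ 2 ≤
          2 * 2 ^ n * ∑ i, ∑ j, (if i ≠ j ∧ h i = h j then U i a * U j b else 0) ^ 2 := by
      intro h
      simp only [sketch_gram_sub]
      refine (sum_sign_quadratic_sq_le
        (fun i j => if i ≠ j ∧ h i = h j then U i a * U j b else 0) (by simp)).trans_eq (by ring)
    rw [Fintype.sum_prod_type]
    calc (s : ℝ) * ∑ h : Fin n → Fin s, ∑ g : Fin n → Bool,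
        ((countSketch (h, g) * U)ᵀ * (countSketch (h, g) * U) - Uᵀ * U) a b ^ 2
        ≤ s * ∑ h : Fin n → Fin s, 2 * 2 ^ n * ∑ i, ∑ j,
            (if i ≠ j ∧ h i = h j then U i a * U j b else 0) ^ 2 :=
          mul_le_mul_of_nonneg_left (Finset.sum_le_sum fun h _ => h1 h) (Nat.cast_nonneg _)
      _ = 2 * 2 ^ n * ∑ i, ∑ j, s * ∑ h : Fin n → Fin s,
            (if i ≠ j ∧ h i = h j then U i a * U j b else 0) ^ 2 := by
          rw [← Finset.mul_sum, Finset.sum_comm]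
          simp only [← Finset.mul_sum]
          rw [mul_left_comm]
          congr 2
          exact Finset.sum_congr rfl fun i _ => Finset.sum_comm
      _ ≤ 2 * 2 ^ n * ∑ i, ∑ j, s ^ n * (U i a ^ 2 * U j b ^ 2) := by
          refine mul_le_mul_of_nonneg_left (Finset.sum_le_sum fun i _ =>
            Finset.sum_le_sum fun j _ => ?_) (by positivity)
          by_cases hij : i = j
          · simp only [hij, ne_eq, not_true_eq_false, false_and, if_false]
            simp only [zero_pow two_ne_zero, Finset.sum_const_zero, mul_zero]
            positivity
          · have e : ∀ h : Fin n → Fin s, (if i ≠ j ∧ h i = h j then U i a * U j b else 0) ^ 2 =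
                (if h i = h j then 1 else 0) * (U i a ^ 2 * U j b ^ 2) := fun h => by
              by_cases hh : h i = h j <;> simp [hij, hh, mul_pow]
            simp only [e]
            rw [← Finset.sum_mul, ← mul_assoc, mul_sum_collision hs hij]
      _ = _ := by
          rw [Finset.sum_mul_sum]
          simp only [← Finset.mul_sum]
          ring
  have htr : (Uᵀ * U).trace = ∑ a, ∑ i, U i a ^ 2 := by
    simp [Matrix.trace, Matrix.mul_apply, sq]
  calc s * ∑ ω : SketchSeed n s, ∑ a, ∑ b,
      ((countSketch ω * U)ᵀ * (countSketch ω * U) - Uᵀ * U) a b ^ 2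
      = ∑ a, ∑ b, s * ∑ ω : SketchSeed n s,
        ((countSketch ω * U)ᵀ * (countSketch ω * U) - Uᵀ * U) a b ^ 2 := by
        rw [Finset.sum_comm]
        simp only [← Finset.mul_sum]
        congr 1
        exact Finset.sum_congr rfl fun a _ => Finset.sum_comm
    _ ≤ ∑ a, ∑ b, 2 * 2 ^ n * s ^ n * ((∑ i, U i a ^ 2) * ∑ j, U j b ^ 2) :=
        Finset.sum_le_sum fun a _ => Finset.sum_le_sum fun b _ => hab a b
    _ = _ := by
        simp only [← Finset.mul_sum, ← Finset.sum_mul]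
        rw [← htr]
        simp
        ring

/-- Cauchy–Schwarz for `D` and the rank-one matrix `zzᵀ`: a quadratic form is bounded by the
Frobenius norm. -/
theorem sq_dotProduct_mulVec_le (D : Matrix (Fin d) (Fin d) ℝ) (z : Fin d → ℝ) :
    (z ⬝ᵥ D *ᵥ z) ^ 2 ≤ (z ⬝ᵥ z) ^ 2 * ∑ a, ∑ b, D a b ^ 2 := by
  have h1 : z ⬝ᵥ D *ᵥ z = ∑ ab : Fin d × Fin d, (z ab.1 * z ab.2) * D ab.1 ab.2 := by
    rw [Fintype.sum_prod_type]
    simp only [dotProduct, mulVec, Finset.mul_sum]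
    exact Finset.sum_congr rfl fun a _ => Finset.sum_congr rfl fun b _ => by ring
  have h2 : (z ⬝ᵥ z) ^ 2 = ∑ ab : Fin d × Fin d, (z ab.1 * z ab.2) ^ 2 := by
    rw [Fintype.sum_prod_type, sq, dotProduct, Finset.sum_mul_sum]
    exact Finset.sum_congr rfl fun a _ => Finset.sum_congr rfl fun b _ => by ring
  rw [h1, h2, ← Fintype.sum_prod_type' (f := fun a b => D a b ^ 2)]
  exact Finset.sum_mul_sq_le_sq_mul_sq _ _ _

/-- If the sketch is accurate in the norm given by `ZᵀZ + λI`, the sketched matrix is spectrally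
equivalent. -/
theorem abs_sub_le_of_sketch {Z : Matrix (Fin n) (Fin d) ℝ} {lam : ℝ} {V : Matrix (Fin d) (Fin d) ℝ}
    (hV : Vᵀ * regGram Z lam * V = 1) {ω : SketchSeed n s}
    (h : ∑ a, ∑ b, ((countSketch ω * (Z * V))ᵀ * (countSketch ω * (Z * V)) -
      (Z * V)ᵀ * (Z * V)) a b ^ 2 ≤ 1 / 4) (x : Fin d → ℝ) :
    |x ⬝ᵥ regGram (countSketch ω * Z) lam *ᵥ x - x ⬝ᵥ regGram Z lam *ᵥ x| ≤
      1 / 2 * (x ⬝ᵥ regGram Z lam *ᵥ x) := by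
  set B := regGram Z lam with hBdef
  set M := regGram (countSketch ω * Z) lam with hMdef
  have hBt : Bᵀ = B := by simp [hBdef, regGram]
  -- In the coordinates `z` the form of `B` is the Euclidean one, and `M - B` becomes the Gram error
  -- of the sketch, as the two terms `λI` cancel.
  set z := (Vᵀ * B) *ᵥ x with hz
  have hx : x = V *ᵥ z := by
    rw [hz, Matrix.mulVec_mulVec, mul_transpose_mul_of_orthonormal hV, Matrix.one_mulVec]
  have hquad : ∀ A : Matrix (Fin d) (Fin d) ℝ, x ⬝ᵥ A *ᵥ x = z ⬝ᵥ (Vᵀ * A * V) *ᵥ z := fun A => by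
    rw [hx]
    simp only [← Matrix.mulVec_mulVec, Matrix.dotProduct_mulVec, Matrix.vecMul_mulVec,
      Matrix.vecMul_transpose]
  have hdiff : x ⬝ᵥ M *ᵥ x - x ⬝ᵥ B *ᵥ x = z ⬝ᵥ ((countSketch ω * (Z * V))ᵀ *
      (countSketch ω * (Z * V)) - (Z * V)ᵀ * (Z * V)) *ᵥ z := by
    rw [← dotProduct_sub, ← Matrix.sub_mulVec, hquad]
    congr 2
    simp only [hMdef, hBdef, regGram, add_sub_add_right_eq_sub, Matrix.mul_sub, Matrix.sub_mul,
      Matrix.transpose_mul, Matrix.mul_assoc]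
  have hB : x ⬝ᵥ B *ᵥ x = z ⬝ᵥ z := by rw [hquad, hV, Matrix.one_mulVec]
  have hzz : 0 ≤ z ⬝ᵥ z := Finset.sum_nonneg fun i _ => mul_self_nonneg _
  rw [hdiff, hB]
  refine abs_le_of_sq_le_sq ?_ (by positivity)
  refine (sq_dotProduct_mulVec_le _ z).trans ?_
  nlinarith [sq_nonneg (z ⬝ᵥ z)]

/-- Orthonormality of `V` gives `(ZᵀZ + λI)⁻¹ = VVᵀ`; the rest is cyclicity of the trace. -/
theorem effectiveDim_eq {Z : Matrix (Fin n) (Fin d) ℝ} {lam : ℝ} {V : Matrix (Fin d) (Fin d) ℝ}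
    (hV : Vᵀ * regGram Z lam * V = 1) : effectiveDim Z lam = ((Z * V)ᵀ * (Z * V)).trace := by
  have h1 : (regGram Z lam)⁻¹ = V * Vᵀ := by
    refine Matrix.inv_eq_left_inv ?_
    rw [Matrix.mul_assoc]
    exact mul_transpose_mul_of_orthonormal hV
  rw [effectiveDim, h1, Matrix.transpose_mul, Matrix.mul_assoc V, Matrix.trace_mul_comm]
  simp only [Matrix.mul_assoc]

/-- Markov's inequality by counting seeds. The mean squared error is at most `2s_λ²/s ≤ δ/10`, so it
exceeds `1/4` for at most a fraction `2δ/5` of the seeds. -/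
theorem le_uniformOn_sketch {Z : Matrix (Fin n) (Fin d) ℝ} {lam : ℝ} {V : Matrix (Fin d) (Fin d) ℝ}
    (hV : Vᵀ * regGram Z lam * V = 1) (hs : 0 < s) {δ : ℝ} (hδ : 0 < δ) (hδ' : δ < 1)
    (hsδ : 20 * effectiveDim Z lam ^ 2 / δ ≤ s) :
    ENNReal.ofReal (1 - δ) ≤ uniformOn (Set.univ : Set (SketchSeed n s))
      {ω | ∑ a, ∑ b, ((countSketch ω * (Z * V))ᵀ * (countSketch ω * (Z * V)) -
        (Z * V)ᵀ * (Z * V)) a b ^ 2 ≤ 1 / 4} := by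
  classical
  set err : SketchSeed n s → ℝ := fun ω => ∑ a, ∑ b, ((countSketch ω * (Z * V))ᵀ *
    (countSketch ω * (Z * V)) - (Z * V)ᵀ * (Z * V)) a b ^ 2 with herr
  have hsum := sum_sketch_gram_sub_sq_le hs (Z * V)
  rw [← effectiveDim_eq hV] at hsum
  have hspos : (0 : ℝ) < s := Nat.cast_pos.2 hs
  set N : ℝ := ((Fintype.card (SketchSeed n s) : ℕ) : ℝ) with hN
  have : Nonempty (Fin s) := ⟨⟨0, hs⟩⟩
  have hNpos : 0 < N := Nat.cast_pos.2 Fintype.card_pos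
  set G : Finset (SketchSeed n s) := Finset.univ.filter fun ω => err ω ≤ 1 / 4 with hG
  have hbad : 1 / 4 * (N - G.card) ≤ ∑ ω, err ω := by
    have h1 : N - G.card = ((Finset.univ.filter fun ω => ¬ err ω ≤ 1 / 4).card : ℝ) := by
      rw [sub_eq_iff_eq_add, hN, ← Finset.card_univ, ← Finset.card_filter_add_card_filter_not
        (s := Finset.univ) fun ω => err ω ≤ 1 / 4]
      push_cast
      ring
    rw [h1, mul_comm, ← nsmul_eq_mul]
    refine (Finset.card_nsmul_le_sum _ err _ fun ω hω => ?_).trans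
      (Finset.sum_le_sum_of_subset_of_nonneg (Finset.filter_subset _ _) fun ω _ _ => ?_)
    · exact (not_le.1 (Finset.mem_filter.1 hω).2).le
    · exact Finset.sum_nonneg fun a _ => Finset.sum_nonneg fun b _ => sq_nonneg _
  have hcard : (1 - δ) * N ≤ G.card := by
    have h1 : 20 * effectiveDim Z lam ^ 2 ≤ s * δ := (div_le_iff₀ hδ).1 hsδ
    have h2 : s * (1 / 4 * (N - G.card)) ≤ s * (1 / 10 * δ * N) := by
      calc s * (1 / 4 * (N - G.card)) ≤ s * ∑ ω, err ω := by gcongr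
        _ ≤ 2 * effectiveDim Z lam ^ 2 * N := hsum
        _ ≤ s * (1 / 10 * δ * N) := by nlinarith
    have h3 := le_of_mul_le_mul_left h2 hspos
    nlinarith [mul_pos hδ hNpos]
  have hset : {ω | err ω ≤ 1 / 4} = (G : Set (SketchSeed n s)) := by ext; simp [hG]
  rw [hset, uniformOn_univ, Measure.count_apply_finset]
  rw [ENNReal.le_div_iff_mul_le (.inl (Nat.cast_ne_zero.2 Fintype.card_ne_zero))
    (.inl (ENNReal.natCast_ne_top _))]
  rw [← ENNReal.ofReal_natCast, ← ENNReal.ofReal_natCast, ← ENNReal.ofReal_mul (by linarith)]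
  exact ENNReal.ofReal_le_ofReal hcard

end CountSketch

end SketchedFDA

/-! ### The main theorem. -/

theorem mainTheorem4 :
    (∀ (n d l p : ℕ) (hp : 0 < p) (hpd : p < d), p < l → l ≤ d →
      ∀ (X : Matrix (Fin n) (Fin d) ℝ) (y : Fin n → Fin l), Function.Surjective y →
      ∀ lam : ℝ, 0 ≤ lam → (regScatterW X y lam).PosDef →
      ∀ ρ : Fin d → ℝ, IsGenEigenvalues (scatterB X y) (regScatterW X y lam) ρ →
        (∀ i j : Fin d, i < j → j.val ≤ p → ρ j < ρ i) →
      ∀ δ : ℝ, 0 < δ → δ < 1 →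
      ∀ s : ℕ, s = max ⌈20 * effectiveDim (centered X y) lam ^ 2 / δ⌉₊ d →
        ENNReal.ofReal (1 - δ) ≤ uniformOn (Set.univ : Set (SketchSeed n s))
          {seed | (regGram (countSketch seed * centered X y) lam).PosDef ∧
            ∀ μ : Fin p → ℝ, StrictAnti μ → (∀ j, 0 < μ j) →
            ∀ W ∈ stiefel p (regScatterW X y lam),
              IsMinOn (fdaCost X y μ) (stiefel p (regScatterW X y lam)) W →
              condNumber (riemannianHessian (regScatterW X y lam)
                  (regGram (countSketch seed * centered X y) lam) (fdaCost X y μ) W) ≤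
                ENNReal.ofReal (3 * kappaFDA hp hpd μ ρ)}) ∧
    (∃ C : ℕ, ∀ (n d l p s : ℕ), 0 < p → p < l → l ≤ d → d ≤ s →
      ∀ y : Fin n → Fin l, Function.Surjective y →
      ∀ seed : SketchSeed n s,
        ComputableWithin (fun X : Matrix (Fin n) (Fin d) ℝ => pairOut (centered X y) (between X y))
          Set.univ (entries fun X => X) (C * (n * d)) ∧
        (∀ E' : Finset (Fin n × Fin d), E'.card ≤ n * d ∧
          ComputableWithin
            (fun (Z : Matrix (Fin n) (Fin d) ℝ) (ij : Fin s × Fin d) =>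
              (countSketch seed * Z) ij.1 ij.2)
            {Z | sparsity Z ⊆ E'} (entries fun Z => Z) (C * E'.card)) ∧
        ComputableWithin
          (fun ω : Matrix (Fin s) (Fin d) ℝ × ℝ =>
            pairOut (regGram ω.1 ω.2) (regGram ω.1 ω.2)⁻¹)
          {ω | 0 ≤ ω.2 ∧ (regGram ω.1 ω.2).PosDef}
          (entries (fun ω => ω.1) ∪ {fun ω => ω.2}) (C * (s * d ^ 2 + d ^ 2)) ∧
        ∀ (E E' : Finset (Fin n × Fin d)) (rule : CGRule) (L : ℕ),
          ComputableWithin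
            (fun ω : IterData n d p =>
              let next := cgStep (regScatterW ω.X y ω.lam) (ω.precond y seed)
                (fdaCost ω.X y ω.μ) rule L ω.t₀ ω.τ ω.c ω.W ω.η
              pairOut next.1 next.2)
            (iterDomain y seed E E') (iterInputs y seed)
            (C * (L + 1) *
              (p * (E.card + l * d) + E'.card * p + d ^ 2 * p + d * p ^ 2))) := by
  -- The constant of the conjugate gradient iteration dominates those of the other computations.
  refine ⟨?_, 800, ?_⟩
  · intro n d l p hp hpd _ _ X y _ lam _ hB ρ hρ hρ' δ hδ hδ' s hs
    -- For the sketch any `B`-orthonormal basis would do; the event depends neither on `μ` nor on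
    -- the minimizer, so the bound holds for all of them at once.
    obtain ⟨V, hV, -⟩ := hρ.2
    have hs0 : 0 < s := by omega
    have hsδ : 20 * effectiveDim (centered X y) lam ^ 2 / δ ≤ s :=
      (Nat.le_ceil _).trans (by rw [hs]; exact_mod_cast le_max_left _ _)
    have hBr := regScatterW_eq X y lam
    rw [hBr] at hV
    refine (le_uniformOn_sketch hV hs0 hδ hδ' hsδ).trans (measure_mono fun ω hω => ?_)
    have habs := abs_sub_le_of_sketch hV hω
    rw [← hBr] at habs
    have hlow : ∀ x : Fin d → ℝ, 1 / 2 * (x ⬝ᵥ regScatterW X y lam *ᵥ x) ≤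
        x ⬝ᵥ regGram (countSketch ω * centered X y) lam *ᵥ x := fun x => by
      linarith [(abs_le.1 (habs x)).1]
    have hupp : ∀ x : Fin d → ℝ, x ⬝ᵥ regGram (countSketch ω * centered X y) lam *ᵥ x ≤
        3 / 2 * (x ⬝ᵥ regScatterW X y lam *ᵥ x) := fun x => by
      linarith [(abs_le.1 (habs x)).2]
    have hM : (regGram (countSketch ω * centered X y) lam).PosDef := by
      refine Matrix.PosDef.of_dotProduct_mulVec_pos ?_ fun x hx => ?_
      · rw [Matrix.IsHermitian, Matrix.conjTranspose_eq_transpose_of_trivial]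
        simp [regGram]
      · have h1 := hB.dotProduct_mulVec_pos hx
        have h2 := hlow x
        simp only [star_trivial] at h1 ⊢
        linarith
    exact ⟨hM, fun μ hμ hμ' W hW hmin =>
      condNumber_riemannianHessian_le hp hpd hM hB hlow hupp hρ hρ' hμ hμ' hW hmin⟩
  · intro n d l p s hp hpl hld hds y hy seed
    have hmono : ∀ {Ω κ : Type} {f : Ω → κ → ℝ} {D : Set Ω} {S : Set (Ω → ℝ)} {T T' : ℕ},
        ComputableWithin f D S T → T ≤ T' → ComputableWithin f D S T' :=
      fun ⟨t, ht, h⟩ hT => ⟨t, ht.trans hT, h⟩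
    refine ⟨hmono (computableWithin_centered_between (by omega) hy) (by gcongr; norm_num),
      fun E' => ⟨?_, hmono (computableWithin_sketch seed E') (by gcongr; norm_num)⟩,
      hmono (computableWithin_regGram hds) (by gcongr; norm_num),
      fun E E' rule L => computableWithin_cgStep hp hpl hld y seed E E' rule L⟩
    simpa using E'.card_le_univ
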